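/- Let $R$ be an associative unital ring and $M$ an $R$-bimodule. Let $R\text{-proj}$ be (a small model of) the category of finitely generated projective left $R$-modules, $I\colon R\text{-proj}\to R\text{-mod}$ the inclusion and $I(M)$ the functor $P\mapsto M\otimes_R P$; a functor $F$ is called pointed if $F(0)=0$. For an exact sequence $0\to B\xrightarrow{b} C_1\xrightarrow{d} C_0\xrightarrow{a} A\to 0$ in an abelian category (an \emph{elementary extension} of $A$ by $B$), a \emph{splitting} is an object $C_{01}$ with maps $c_1\colon C_1\to C_{01}$ and $c_0\colon C_{01}\to C_0$ such that $c_0$ is an epimorphism and the square formed by $c_1$, $c_0$, $C_1\to\operatorname{Im} d$ and $\operatorname{Im} d\hookrightarrow C_0$ is cartesian; morphisms of splittings are the maps compatible with $c_1$ and $c_0$ (they are automatically invertible). Let $0\to I(M)\xrightarrow{b} C_1\xrightarrow{d} C_0\xrightarrow{a} I\to 0$ be an elementary extension of $I$ by $I(M)$ in the category of pointed functors $R\text{-proj}\to R\text{-mod}$. Then the underlying sequence of functors to abelian groups admits a splitting $\langle C_{01},c_1,c_0\rangle$. Fix any such splitting, and let $R'$ be the ring of its \emph{regular} endomorphisms: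 those natural additive endomorphisms $r'$ of $C_{01}$ for which there is $r\in R$ with $r'c_1=c_1r$ and $c_0r'=rc_0$. The element $r$ is unique; let $q\colon R'\to R$ send $r'$ to $r$, and let $i\colon M\to R'$ send $m$ to the composition $C_{01}\xrightarrow{c_0}C_0\xrightarrow{a} I\xrightarrow{m\otimes -} I(M)\xrightarrow{b} C_1\xrightarrow{c_1}C_{01}$. Then $0\to M\xrightarrow{i}R'\xrightarrow{q}R\to 0$ is a square-zero extension of $R$ by $M$. Extend functors $F$ on $R\text{-proj}$ to flat left $R$-modules $V$ by $F(V)=\operatorname{colim} F(P)$ over the category of $P\in R\text{-proj}$ equipped with a map $P\to V$. Then for every flat $R$-module $V$ the sequence $$0\to M\otimes_R V\to C_1(V)\to C_0(V)\to V\to 0 \qquad (*)$$ is exact, where $\operatorname{colim} (M\otimes_R P)$ is identified with $M\otimes_R V$ by the canonical isomorphism, and there is an equivalence of categories $$e_V\colon \mathcal{L}\mathit{ift}(V,R')\;\cong\;\mathcal{S}\mathit{pl}(C_\bullet(V))$$ between the groupoid of liftings of $V$ to $R'$ (flat $R'$-modules $V'$ with an isomorphism $R\otimes_{R'}V'\cong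 V$; morphisms are the isomorphisms of $R'$-modules compatible with it) and the groupoid of splittings of $(*)$. These equivalences can be chosen natural in $V$: for every $R$-linear map $f\colon V\to W$ of flat modules and liftings $V'$ of $V$ and $W'$ of $W$, there is a bijection between the $R'$-linear maps $V'\to W'$ over $f$ and the maps $e_V(V')\to e_W(W')$ compatible with $C_1(f)$ and $C_0(f)$; these bijections respect composition, and for $f=\operatorname{id}_V$ they agree with the functor $e_V$ on morphisms of liftings. -/

import Mathlib

open CategoryTheory CategoryTheory.Limits MulOpposite
open scoped TensorProduct

universe u v w

namespace SqZero

noncomputable section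

/-! ### Elementary extensions and their splittings in an abelian category -/

section Abelian

variable {E : Type w} [Category.{v} E] [Abelian E]

/-- The sequence `0 ⟶ B ⟶ C₁ ⟶ C₀ ⟶ A ⟶ 0` is exact. -/
structure IsElementaryExtension {B C₁ C₀ A : E} (b : B ⟶ C₁) (d : C₁ ⟶ C₀) (a : C₀ ⟶ A) :
    Prop where
  mono_b : Mono b
  b_d : b ≫ d = 0
  d_a : d ≫ a = 0
  exact₁ : (ShortComplex.mk b d b_d).Exact
  exact₀ : (ShortComplex.mk d a d_a).Exact
  epi_a : Epi a

/-- An elementary extension of `A` by `B`: a two-term complex `C₁ ⟶ C₀` (in homological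
degrees `1` and `0`) with a four-term exact sequence `0 ⟶ B ⟶ C₁ ⟶ C₀ ⟶ A ⟶ 0`. -/
structure ElementaryExtension (A B : E) where
  C₁ : E
  C₀ : E
  b : B ⟶ C₁
  d : C₁ ⟶ C₀
  a : C₀ ⟶ A
  isElementaryExtension : IsElementaryExtension b d a

/-- A splitting of an elementary extension `0 ⟶ B ⟶ C₁ ⟶ C₀ ⟶ A ⟶ 0` with differential
`d : C₁ ⟶ C₀`: an object `C₀₁` with maps `c₁ : C₁ ⟶ C₀₁` and `c₀ : C₀₁ ⟶ C₀` such that `c₀` is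
an epimorphism and the square formed by `c₁`, `c₀`, `C₁ ⟶ Im d` and `Im d ⟶ C₀` is cartesian.
In other words, `C₀₁` has a filtration `B ⊆ C₁ ⊆ C₀₁` with `C₀₁ / B ≅ C₀`, inducing `d`.
The notion depends only on the differential. -/
structure Splitting {C₁ C₀ : E} (d : C₁ ⟶ C₀) where
  obj : E
  c₁ : C₁ ⟶ obj
  c₀ : obj ⟶ C₀
  isPullback : IsPullback c₁ (factorThruImage d) c₀ (image.ι d)
  epi_c₀ : Epi c₀

namespace Splitting

/-- Maps from a splitting of `d` to a splitting of `d'` that lie over given maps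
`f₁ : C₁ ⟶ C₁'` and `f₀ : C₀ ⟶ C₀'`. -/
@[ext]
structure HomOver {C₁ C₀ C₁' C₀' : E} {d : C₁ ⟶ C₀} {d' : C₁' ⟶ C₀'}
    (f₁ : C₁ ⟶ C₁') (f₀ : C₀ ⟶ C₀') (X : Splitting d) (Y : Splitting d') where
  hom : X.obj ⟶ Y.obj
  w₁ : X.c₁ ≫ hom = f₁ ≫ Y.c₁
  w₀ : hom ≫ Y.c₀ = X.c₀ ≫ f₀

/-- Morphisms of splittings of a fixed elementary extension (automatically invertible). -/
@[ext]
structure Hom {C₁ C₀ : E} {d : C₁ ⟶ C₀} (X Y : Splitting d) where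
  hom : X.obj ⟶ Y.obj
  w₁ : X.c₁ ≫ hom = Y.c₁
  w₀ : hom ≫ Y.c₀ = X.c₀

instance {C₁ C₀ : E} (d : C₁ ⟶ C₀) : Category (Splitting d) where
  Hom X Y := Hom X Y
  id X := { hom := 𝟙 _, w₁ := by simp, w₀ := by simp }
  comp f g :=
    { hom := f.hom ≫ g.hom
      w₁ := by rw [← Category.assoc, f.w₁, g.w₁]
      w₀ := by rw [Category.assoc, g.w₀, f.w₀] }
  id_comp f := by ext; simp
  comp_id f := by ext; simp
  assoc f g h := by ext; simp

end Splitting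

end Abelian

/-! ### Tensor products and flatness over a ring that need not be commutative -/

section Tensor

variable (R : Type u) [Ring R]

/-- The elements `m r ⊗ v - m ⊗ r v` of `M ⊗_ℤ V`, for a right `R`-module `M` and a left
`R`-module `V`. -/
def balanceRelations (M : Type v) [AddCommGroup M] [Module Rᵐᵒᵖ M]
    (V : Type w) [AddCommGroup V] [Module R V] : Set (M ⊗[ℤ] V) :=
  {t | ∃ (m : M) (r : R) (v : V), t = (op r • m) ⊗ₜ[ℤ] v - m ⊗ₜ[ℤ] (r • v)}

/-- The tensor product `M ⊗_R V` of an `(A, R)`-bimodule `M` and a left `R`-module `V`, as a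
left `A`-module. For `A = ℤ` this is the tensor product of a right and a left module. -/
abbrev BalTensor (A : Type*) [Ring A] (M : Type v) [AddCommGroup M] [Module A M] [Module Rᵐᵒᵖ M]
    (V : Type w) [AddCommGroup V] [Module R V] :=
  (M ⊗[ℤ] V) ⧸ Submodule.span A (balanceRelations R M V)

/-- The map `id ⊗ g : M ⊗_R V ⟶ M ⊗_R W`. -/
def BalTensor.mapRight (A : Type*) [Ring A] (M : Type v) [AddCommGroup M] [Module A M]
    [Module Rᵐᵒᵖ M] {V W : Type w} [AddCommGroup V] [Module R V] [AddCommGroup W] [Module R W]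
    (g : V →ₗ[R] W) : BalTensor R A M V →ₗ[A] BalTensor R A M W :=
  Submodule.mapQ _ _ (TensorProduct.AlgebraTensorModule.lTensor A M (g.restrictScalars ℤ)) (by
    rw [Submodule.span_le]
    rintro _ ⟨m, r, v, rfl⟩
    refine Submodule.subset_span ⟨m, r, g v, ?_⟩
    simp)

/-- The map `f ⊗ id : M ⊗_R V ⟶ N ⊗_R V` of abelian groups. -/
def BalTensor.mapLeft {M N : Type v} [AddCommGroup M] [Module Rᵐᵒᵖ M] [AddCommGroup N]
    [Module Rᵐᵒᵖ N] (f : M →ₗ[Rᵐᵒᵖ] N) (V : Type w) [AddCommGroup V] [Module R V] :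
    BalTensor R ℤ M V →ₗ[ℤ] BalTensor R ℤ N V :=
  Submodule.mapQ _ _ (LinearMap.rTensor V (f.restrictScalars ℤ)) (by
    rw [Submodule.span_le]
    rintro _ ⟨m, r, v, rfl⟩
    refine Submodule.subset_span ⟨f m, r, v, ?_⟩
    simp)

/-- A left `R`-module `V` is flat if `- ⊗_R V` preserves injections of right `R`-modules. -/
def IsFlat (V : Type u) [AddCommGroup V] [Module R V] : Prop :=
  ∀ (M N : Type u) [AddCommGroup M] [Module Rᵐᵒᵖ M] [AddCommGroup N] [Module Rᵐᵒᵖ N]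
    (f : M →ₗ[Rᵐᵒᵖ] N), Function.Injective f → Function.Injective (BalTensor.mapLeft R f V)

end Tensor

section ExtendScalars

variable {S R : Type u} [Ring S] [Ring R] (q : S →+* R)

/-- `q^* V = R ⊗_S V` as a left `R`-module, where `S` acts on `R` on the right through `q`. -/
abbrev ExtendScalars (V : Type u) [AddCommGroup V] [Module S V] :=
  (R ⊗[ℤ] V) ⧸ Submodule.span R
    {t : R ⊗[ℤ] V | ∃ (x : R) (s : S) (v : V), t = (x * q s) ⊗ₜ[ℤ] v - x ⊗ₜ[ℤ] (s • v)}

/-- The map `q^* g : q^* V ⟶ q^* W`. -/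
def ExtendScalars.map {V W : Type u} [AddCommGroup V] [Module S V] [AddCommGroup W] [Module S W]
    (g : V →ₗ[S] W) : ExtendScalars q V →ₗ[R] ExtendScalars q W :=
  Submodule.mapQ _ _ (TensorProduct.AlgebraTensorModule.lTensor R R (g.restrictScalars ℤ)) (by
    rw [Submodule.span_le]
    rintro _ ⟨x, s, v, rfl⟩
    refine Submodule.subset_span ⟨x, s, g v, ?_⟩
    simp)

theorem ExtendScalars.map_id {V : Type u} [AddCommGroup V] [Module S V] :
    ExtendScalars.map q (LinearMap.id : V →ₗ[S] V) = LinearMap.id := by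
  ext v
  simp [ExtendScalars.map]

theorem ExtendScalars.map_comp {V W X : Type u} [AddCommGroup V] [Module S V] [AddCommGroup W]
    [Module S W] [AddCommGroup X] [Module S X] (g : V →ₗ[S] W) (h : W →ₗ[S] X) :
    ExtendScalars.map q (h ∘ₗ g) = ExtendScalars.map q h ∘ₗ ExtendScalars.map q g := by
  ext v
  simp [ExtendScalars.map]

end ExtendScalars

/-! ### Finitely generated projective modules and functors on them -/

section Functors

variable (R : Type u) [Ring R]

/-- A small set of representatives for finitely generated projective left `R`-modules: those
that are submodules of some `Rⁿ`. -/
structure ProjObj where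
  n : ℕ
  P : Submodule R (Fin n → R)
  finite : Module.Finite R P
  projective : Module.Projective R P

/-- The small category of finitely generated projective left `R`-modules. -/
abbrev ProjCat := InducedCategory (ModuleCat.{u} R) (fun X : ProjObj R => ModuleCat.of R X.P)

/-- The tautological functor `I` from finitely generated projective modules to modules. -/
abbrev taut : ProjCat R ⥤ ModuleCat.{u} R := inducedFunctor _

/-- A functor `F` is pointed if `F(0) = 0`. -/
def IsPointed (F : ProjCat R ⥤ ModuleCat.{u} R) : Prop :=
  ∀ P : ProjCat R, IsZero P → IsZero (F.obj P)

/- The bimodules considered below are modules `M` over `R` and over `Rᵐᵒᵖ`; the requirement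
`SMulCommClass R Rᵐᵒᵖ M` that the two actions commute is imposed where results are stated. -/
variable (M : Type u) [AddCommGroup M] [Module R M] [Module Rᵐᵒᵖ M]

/-- The functor `V ↦ M ⊗_R V` on left `R`-modules, for an `R`-bimodule `M`. -/
def tensorFunctor : ModuleCat.{u} R ⥤ ModuleCat.{u} R where
  obj V := ModuleCat.of R (BalTensor R R M V)
  map f := ModuleCat.ofHom (BalTensor.mapRight R R M f.hom)
  map_id V := by
    ext : 1
    ext v
    simp [BalTensor.mapRight]
  map_comp f g := by
    ext : 1
    ext v
    simp [BalTensor.mapRight]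

/-- The functor `I(M) : V ↦ M ⊗_R V` on finitely generated projective modules. -/
abbrev tautTensor : ProjCat R ⥤ ModuleCat.{u} R := taut R ⋙ tensorFunctor R M

/-- An elementary extension of the ring `R` by the bimodule `M`: an elementary extension of `I`
by `I(M)` in the category of pointed functors. (Kernels, cokernels and extensions of pointed
functors are the same in the category of all functors, where they are computed pointwise, and
`I`, `I(M)` are pointed.) -/
structure RingExtension extends ElementaryExtension (taut R) (tautTensor R M) where
  pointed₁ : IsPointed R C₁
  pointed₀ : IsPointed R C₀

/-- The functor `e_*` that forgets the `R`-module structure, on functors. -/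
abbrev forgetFun (F : ProjCat R ⥤ ModuleCat.{u} R) : ProjCat R ⥤ AddCommGrpCat.{u} :=
  F ⋙ forget₂ (ModuleCat.{u} R) AddCommGrpCat.{u}

variable {R} in
/-- The functor `e_*` that forgets the `R`-module structure, on natural transformations. -/
abbrev forgetMap {F G : ProjCat R ⥤ ModuleCat.{u} R} (τ : F ⟶ G) : forgetFun R F ⟶ forgetFun R G :=
  Functor.whiskerRight τ (forget₂ (ModuleCat.{u} R) AddCommGrpCat.{u})

variable {R} in
/-- The action of `r : R` on `e_* F` by left multiplication. -/
abbrev leftMul (F : ProjCat R ⥤ ModuleCat.{u} R) (r : R) : forgetFun R F ⟶ forgetFun R F :=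
  Functor.whiskerLeft F (ModuleCat.smulNatTrans R r)

variable {M} in
/-- The natural map `V ⟶ M ⊗_R V`, `v ↦ m ⊗ v`, of abelian groups. -/
def tensorElement (m : M) : forgetFun R (taut R) ⟶ forgetFun R (tautTensor R M) where
  app P := AddCommGrpCat.ofHom
    (((Submodule.mkQ (Submodule.span R (balanceRelations R M P.P))).toAddMonoidHom).comp
      (TensorProduct.mk ℤ M P.P m).toAddMonoidHom)
  naturality _ _ _ := rfl

/-! ### The square-zero extension attached to an elementary extension -/

variable {R M}

namespace RingExtension

variable (φ : RingExtension R M)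

/-- Splittings of the elementary extension `e_* φ` of pointed functors to abelian groups. -/
abbrev AbSplitting := Splitting (forgetMap φ.d)

variable {φ}

/-- An endomorphism `r'` of `C₀₁` is regular, over `r : R`, if it is compatible via `c₁` and `c₀`
with the action of `r` on `C₁` and `C₀`. -/
def IsRegularOver (σ : φ.AbSplitting) (r' : End σ.obj) (r : R) : Prop :=
  σ.c₁ ≫ r' = leftMul φ.C₁ r ≫ σ.c₁ ∧ r' ≫ σ.c₀ = σ.c₀ ≫ leftMul φ.C₀ r

theorem IsRegularOver.mul {σ : φ.AbSplitting} {x y : End σ.obj} {r s : R}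
    (hx : IsRegularOver σ x r) (hy : IsRegularOver σ y s) : IsRegularOver σ (x * y) (r * s) := by
  have key : ∀ F : ProjCat R ⥤ ModuleCat.{u} R, leftMul F (r * s) = leftMul F s ≫ leftMul F r := by
    intro F
    simp only [leftMul, map_mul, End.mul_def, Functor.whiskerLeft_comp]
  refine ⟨?_, ?_⟩
  · rw [End.mul_def, ← Category.assoc, hy.1, Category.assoc, hx.1, key, Category.assoc]
  · rw [End.mul_def, Category.assoc, hx.2, ← Category.assoc, hy.2, key, Category.assoc]

theorem IsRegularOver.add {σ : φ.AbSplitting} {x y : End σ.obj} {r s : R}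
    (hx : IsRegularOver σ x r) (hy : IsRegularOver σ y s) : IsRegularOver σ (x + y) (r + s) := by
  have key : ∀ F : ProjCat R ⥤ ModuleCat.{u} R, leftMul F (r + s) = leftMul F r + leftMul F s := by
    intro F
    ext P v
    exact add_smul (M := F.obj P) r s v
  refine ⟨?_, ?_⟩
  · rw [key, Preadditive.add_comp, ← hx.1, ← hy.1]
    exact Preadditive.comp_add _ _ _ _ _ _
  · rw [key, Preadditive.comp_add, ← hx.2, ← hy.2]
    exact Preadditive.add_comp _ _ _ _ _ _

theorem IsRegularOver.neg {σ : φ.AbSplitting} {x : End σ.obj} {r : R}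
    (hx : IsRegularOver σ x r) : IsRegularOver σ (-x) (-r) := by
  have key : ∀ F : ProjCat R ⥤ ModuleCat.{u} R, leftMul F (-r) = -leftMul F r := by
    intro F
    ext P v
    exact neg_smul (M := F.obj P) r v
  refine ⟨?_, ?_⟩
  · rw [key, Preadditive.neg_comp, ← hx.1]
    exact Preadditive.comp_neg _ _
  · rw [key, Preadditive.comp_neg, ← hx.2]
    exact Preadditive.neg_comp _ _

theorem isRegularOver_one (σ : φ.AbSplitting) : IsRegularOver σ 1 1 := by
  have key : ∀ F : ProjCat R ⥤ ModuleCat.{u} R, leftMul F 1 = 𝟙 _ := by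
    intro F
    ext P v
    exact one_smul R (α := F.obj P) v
  refine ⟨?_, ?_⟩
  · rw [key, Category.id_comp]
    exact Category.comp_id _
  · rw [key, Category.comp_id]
    exact Category.id_comp _

theorem isRegularOver_zero (σ : φ.AbSplitting) : IsRegularOver σ 0 0 := by
  simpa using (isRegularOver_one σ).add (isRegularOver_one σ).neg

/-- The ring `R'` of regular endomorphisms of the functor `C₀₁`. -/
def regularEnd (σ : φ.AbSplitting) : Subring (End σ.obj) where
  carrier := {r' | ∃ r : R, IsRegularOver σ r' r}
  mul_mem' := fun ⟨r, hr⟩ ⟨s, hs⟩ => ⟨r * s, hr.mul hs⟩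
  one_mem' := ⟨1, isRegularOver_one σ⟩
  add_mem' := fun ⟨r, hr⟩ ⟨s, hs⟩ => ⟨r + s, hr.add hs⟩
  zero_mem' := ⟨0, isRegularOver_zero σ⟩
  neg_mem' := fun ⟨r, hr⟩ => ⟨-r, hr.neg⟩

/-- The element `r : R` over which an endomorphism is regular is unique. -/
theorem IsRegularOver.unique {σ : φ.AbSplitting} {x : End σ.obj} {r s : R}
    (hr : IsRegularOver σ x r) (hs : IsRegularOver σ x s) : r = s := by
  have := σ.epi_c₀
  have := φ.isElementaryExtension.epi_a
  have h : leftMul φ.C₀ r = leftMul φ.C₀ s := by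
    rw [← cancel_epi σ.c₀, ← hr.2, ← hs.2]
  let P : ProjCat R := (⟨1, ⊤, inferInstance,
    Module.Projective.of_equiv (Submodule.topEquiv (R := R) (M := Fin 1 → R)).symm⟩ : ProjObj R)
  let e : P.P := ⟨fun _ => 1, trivial⟩
  have hsurj : Function.Surjective (φ.a.app P) := by
    rw [← ModuleCat.epi_iff_surjective]
    infer_instance
  obtain ⟨x, hx⟩ := hsurj e
  have h1 : r • x = s • x := by
    have := congrArg (fun τ => (τ.app P).hom x) h
    exact this
  have h2 : r • e = s • e := by
    have := congrArg (φ.a.app P).hom h1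
    rw [map_smul, map_smul] at this
    rw [← hx]
    exact this
  simpa [e] using congrArg (fun y : P.P => (y : Fin P.n → R) 0) h2

/-- The projection `q : R' ⟶ R`. -/
def proj (σ : φ.AbSplitting) : regularEnd σ →+* R where
  toFun r' := r'.2.choose
  map_one' := (1 : regularEnd σ).2.choose_spec.unique (isRegularOver_one σ)
  map_zero' := (0 : regularEnd σ).2.choose_spec.unique (isRegularOver_zero σ)
  map_mul' x y := (x * y).2.choose_spec.unique (x.2.choose_spec.mul y.2.choose_spec)
  map_add' x y := (x + y).2.choose_spec.unique (x.2.choose_spec.add y.2.choose_spec)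

theorem isRegularOver_proj (σ : φ.AbSplitting) (r' : regularEnd σ) :
    IsRegularOver σ (r' : End σ.obj) (proj σ r') := r'.2.choose_spec

end RingExtension

variable (M) in
/-- `0 ⟶ M ⟶ R' ⟶ R ⟶ 0`, with maps `i` and `q`, is a square-zero extension of the ring `R` by
the bimodule `M`. -/
structure IsSquareZeroExtension {R' : Type u} [Ring R'] (i : M →+ R') (q : R' →+* R) : Prop where
  injective : Function.Injective i
  exact : ∀ x : R', q x = 0 ↔ ∃ m : M, i m = x
  surjective : Function.Surjective q
  mul_right : ∀ (m : M) (x : R'), i m * x = i (op (q x) • m)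
  mul_left : ∀ (x : R') (m : M), x * i m = i (q x • m)
  mul_zero : ∀ m m' : M, i m * i m' = 0

/-! ### Extension of functors to all modules -/

/-- The value `F(V)` of a functor on finitely generated projective modules at an arbitrary module
`V`: the colimit of `F(P)` over the category of finitely generated projective modules `P` equipped
with a map `P ⟶ V`. It is functorial in `V`, and used for flat `V` only. -/
abbrev extend (F : ProjCat R ⥤ ModuleCat.{u} R) : ModuleCat.{u} R ⥤ ModuleCat.{u} R :=
  (taut R).pointwiseLeftKanExtension F

/-- Functoriality of `F(V)` in `F`. -/
def extendMap {F G : ProjCat R ⥤ ModuleCat.{u} R} (τ : F ⟶ G) (V : ModuleCat.{u} R) :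
    (extend F).obj V ⟶ (extend G).obj V :=
  colimMap (Functor.whiskerLeft (CostructuredArrow.proj (taut R) V) τ)

variable (R) in
/-- The canonical map `I(V) ⟶ V` (an isomorphism for flat `V`). -/
def fromTaut (V : ModuleCat.{u} R) : (extend (taut R)).obj V ⟶ V :=
  colimit.desc (CostructuredArrow.proj (taut R) V ⋙ taut R)
    { pt := V
      ι :=
        { app := fun j => j.hom
          naturality := fun _ _ f => (CostructuredArrow.w f).trans (Category.comp_id _).symm } }

variable (M) in
/-- The canonical map `I(M)(V) ⟶ M ⊗_R V` (an isomorphism for flat `V`). -/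
def fromTautTensor (V : ModuleCat.{u} R) :
    (extend (tautTensor R M)).obj V ⟶ (tensorFunctor R M).obj V :=
  colimit.desc (CostructuredArrow.proj (taut R) V ⋙ tautTensor R M)
    { pt := (tensorFunctor R M).obj V
      ι :=
        { app := fun j => (tensorFunctor R M).map j.hom
          naturality := fun _ _ f =>
            (((tensorFunctor R M).map_comp _ _).symm.trans
              (congrArg (tensorFunctor R M).map (CostructuredArrow.w f))).trans
                (Category.comp_id _).symm } }

/-- Splittings of the elementary extension `0 ⟶ M ⊗_R V ⟶ C₁(V) ⟶ C₀(V) ⟶ V ⟶ 0` of modules. -/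
abbrev RingExtension.SplittingAt (φ : RingExtension R M) (V : ModuleCat.{u} R) :=
  Splitting (extendMap φ.d V)

end Functors

/-! ### Liftings of modules -/

section Liftings

variable {R' R : Type u} [Ring R'] [Ring R] (q : R' →+* R)

/-- A lifting of an `R`-module `V` along `q : R' ⟶ R`: a flat `R'`-module `V'` equipped with an
isomorphism `q^* V' ≅ V`. -/
structure Lifting (V : ModuleCat.{u} R) where
  V' : ModuleCat.{u} R'
  flat : IsFlat R' V'
  iso : ExtendScalars q V' ≃ₗ[R] V

namespace Lifting

variable {q}

/-- Maps from a lifting of `V` to a lifting of `W` that lie over a given map `f : V ⟶ W`. -/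
@[ext]
structure HomOver {V W : ModuleCat.{u} R} (f : V ⟶ W) (X : Lifting q V) (Y : Lifting q W) where
  hom : X.V' →ₗ[R'] Y.V'
  w : Y.iso.toLinearMap ∘ₗ ExtendScalars.map q hom = f.hom ∘ₗ X.iso.toLinearMap

/-- Morphisms of liftings of `V`: isomorphisms compatible with the identifications with `V`. -/
@[ext]
structure Hom {V : ModuleCat.{u} R} (X Y : Lifting q V) where
  hom : X.V' ≃ₗ[R'] Y.V'
  w : Y.iso.toLinearMap ∘ₗ ExtendScalars.map q hom.toLinearMap = X.iso.toLinearMap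

instance (V : ModuleCat.{u} R) : Groupoid (Lifting q V) where
  Hom X Y := Hom X Y
  id X :=
    { hom := LinearEquiv.refl R' X.V'
      w := by rw [LinearEquiv.refl_toLinearMap, ExtendScalars.map_id, LinearMap.comp_id] }
  comp f g :=
    { hom := f.hom.trans g.hom
      w := by
        rw [← LinearEquiv.comp_coe, ExtendScalars.map_comp, ← LinearMap.comp_assoc, g.w, f.w] }
  inv {X Y} f :=
    { hom := f.hom.symm
      w := by
        rw [← f.w, LinearMap.comp_assoc, ← ExtendScalars.map_comp, LinearEquiv.comp_coe,
          LinearEquiv.symm_trans_self, LinearEquiv.refl_toLinearMap, ExtendScalars.map_id,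
          LinearMap.comp_id] }
  id_comp f := by ext; rfl
  comp_id f := by ext; rfl
  assoc f g h := by ext; rfl
  inv_comp f := by apply Hom.ext; exact LinearEquiv.symm_trans_self f.hom
  comp_inv f := by apply Hom.ext; exact LinearEquiv.self_trans_symm f.hom

/-- Composition of maps of liftings over composable maps of modules. -/
def HomOver.comp {V W U : ModuleCat.{u} R} {f : V ⟶ W} {g : W ⟶ U} {X : Lifting q V}
    {Y : Lifting q W} {Z : Lifting q U} (x : HomOver f X Y) (y : HomOver g Y Z) :
    HomOver (f ≫ g) X Z where
  hom := y.hom ∘ₗ x.hom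
  w := by
    rw [ExtendScalars.map_comp, ← LinearMap.comp_assoc, y.w, LinearMap.comp_assoc, x.w,
      ModuleCat.hom_comp, LinearMap.comp_assoc]

/-- A morphism of liftings of `V` lies over the identity of `V`. -/
def Hom.toHomOver {V : ModuleCat.{u} R} {X Y : Lifting q V} (g : X ⟶ Y) : HomOver (𝟙 V) X Y where
  hom := (Hom.hom g).toLinearMap
  w := by
    rw [Hom.w g]
    rfl

end Lifting

end Liftings

end

end SqZero

/-! A splitting over abelian groups exists because its obstruction is a nonadditive phenomenon with
values in an additive functor. A lift of the generator of R to C₀(R) gives, by naturality, a natural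
section s of a : C₀ → I, usually not additive. Its additivity defect lies in the image of d and
lifts to a natural cochain with values in C₁. The failure of that cochain to be symmetric and to
satisfy the cocycle identity takes values in Ker d = I(M), and it vanishes as soon as one variable
is zero. Natural maps of several variables into I(M) with this property are zero
(`eq_zero_of_crossEffect`). So the cochain is a symmetric cocycle, and the extension of I by C₁ that
it defines is a splitting (`exists_naturalCocycle`).

The same vanishing argument lifts each r in R to a regular endomorphism (`exists_isRegularOver`), so
q is surjective. A regular endomorphism over 0 kills C₁ and lands in I(M). It is therefore
determined by its value on the generator of R, an element of M ⊗ R = M, and so Ker q = M.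

Flatness enters through the equational criterion. The criterion makes the category of maps P → V
filtered (`IsEquationallyFlat.isFiltered`), so exactness at every P passes to V. Moreover E = C₀₁(V)
is an R'-module that splits (*) additively, and m in M acts on it as E → V → M ⊗ V → C₁(V) → E, with
middle map m ⊗ -.

A lifting V' amounts to an extension 0 → M ⊗ V → V' → V → 0 of R'-modules on which M acts in the
standard way (`Lifting.liftData`, and `LiftData.isFlat` for the converse). Both E and V' thus carry
the same kind of M-action, and the two cancel in the Baer-type quotient (E ×_V V') / (M ⊗ V). This
quotient is an R-module, and it is the splitting attached to V' (`TwistedSplitting.splitting`). In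
the other direction, a splitting X gives the lifting (E ×_{C₀(V)} X) / C₁(V)
(`ModuleSplitting.liftData`, `ModuleSplitting.exists_map_tot`). Maps correspond because the second
component of a class is determined by the class and its first component
(`TwistedSplitting.Hom.exists_map_eq`). Since E is functorial in V, all of this works over an
arbitrary map V → W. -/

namespace SqZero

noncomputable section

/-! ### Tensor products over a noncommutative ring -/

section BalTensor

variable {R : Type u} [Ring R]

section

variable {A : Type*} [Ring A] {M : Type v} [AddCommGroup M] [Module A M] [Module Rᵐᵒᵖ M]
  {V : Type w} [AddCommGroup V] [Module R V]

variable (R A) in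
/-- The pure tensor `m ⊗ v` in `M ⊗_R V`. -/
def BalTensor.tmul (m : M) (v : V) : BalTensor R A M V := Submodule.Quotient.mk (m ⊗ₜ[ℤ] v)

namespace BalTensor

theorem add_tmul (m m' : M) (v : V) : tmul R A (m + m') v = tmul R A m v + tmul R A m' v := by
  simp only [tmul, TensorProduct.add_tmul, Submodule.Quotient.mk_add]

theorem tmul_add (m : M) (v v' : V) : tmul R A m (v + v') = tmul R A m v + tmul R A m v' := by
  simp only [tmul, TensorProduct.tmul_add, Submodule.Quotient.mk_add]

theorem smul_tmul_left (a : A) (m : M) (v : V) : a • tmul R A m v = tmul R A (a • m) v := rfl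

theorem op_smul_tmul (r : R) (m : M) (v : V) : tmul R A (op r • m) v = tmul R A m (r • v) :=
  (Submodule.Quotient.eq _).2 (Submodule.subset_span ⟨m, r, v, rfl⟩)

variable (R A) in
/-- The pure tensor as a biadditive map. -/
def mkHom : M →+ V →+ BalTensor R A M V :=
  AddMonoidHom.mk' (fun m => AddMonoidHom.mk' (tmul R A m) (tmul_add m)) fun m m' => by
    ext v
    exact add_tmul m m' v

theorem tmul_zero (m : M) : tmul R A m (0 : V) = 0 := (mkHom R A m).map_zero

theorem zero_tmul (v : V) : tmul R A (0 : M) v = 0 := by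
  simp only [tmul, TensorProduct.zero_tmul, Submodule.Quotient.mk_zero]

theorem tmul_sum {ι : Type*} (s : Finset ι) (m : M) (v : ι → V) :
    tmul R A m (∑ i ∈ s, v i) = ∑ i ∈ s, tmul R A m (v i) := map_sum (mkHom R A m) v s

@[elab_as_elim]
theorem induction {p : BalTensor R A M V → Prop} (tmul : ∀ m v, p (tmul R A m v))
    (add : ∀ x y, p x → p y → p (x + y)) (t : BalTensor R A M V) : p t := by
  obtain ⟨t, rfl⟩ := Submodule.Quotient.mk_surjective _ t
  induction t using TensorProduct.induction_on with
  | zero => simpa [BalTensor.tmul] using tmul 0 0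
  | tmul m v => exact tmul m v
  | add x y hx hy => exact add _ _ hx hy

theorem addHom_ext {N : Type*} [AddCommMonoid N] {f g : BalTensor R A M V →+ N}
    (h : ∀ m v, f (tmul R A m v) = g (tmul R A m v)) : f = g := by
  ext t
  induction t using BalTensor.induction with
  | tmul m v => exact h m v
  | add x y hx hy => rw [map_add, map_add, hx, hy]

theorem exists_sum (t : BalTensor R A M V) :
    ∃ (n : ℕ) (m : Fin n → M) (v : Fin n → V), t = ∑ i, tmul R A (m i) (v i) := by
  induction t using BalTensor.induction with
  | tmul m v => exact ⟨1, fun _ => m, fun _ => v, by simp⟩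
  | add x y hx hy =>
    obtain ⟨n, m, v, rfl⟩ := hx
    obtain ⟨n', m', v', rfl⟩ := hy
    exact ⟨n + n', Fin.append m m', Fin.append v v', by simp [Fin.sum_univ_add]⟩

/-- Additive maps out of `M ⊗_R V` from balanced biadditive maps. -/
def lift [SMulCommClass A Rᵐᵒᵖ M] {N : Type*} [AddCommGroup N] (f : M →+ V →+ N)
    (hf : ∀ (r : R) m v, f (op r • m) v = f m (r • v)) : BalTensor R A M V →+ N :=
  QuotientAddGroup.lift (Submodule.span A (balanceRelations R M V)).toAddSubgroup
    (TensorProduct.liftAddHom f (fun r m v => by simp)) (by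
      intro x hx
      refine Submodule.closure_induction (p := fun x _ => (TensorProduct.liftAddHom f
        (fun r m v => by simp) : M ⊗[ℤ] V →+ N) x = 0) (map_zero _) ?_ ?_ hx
      · intro x y _ _ hx hy
        rw [map_add, hx, hy, add_zero]
      · rintro a _ ⟨m, r, v, rfl⟩
        simp only [smul_sub, TensorProduct.smul_tmul', map_sub, TensorProduct.liftAddHom_tmul]
        rw [smul_comm, hf, sub_self])

@[simp]
theorem lift_tmul [SMulCommClass A Rᵐᵒᵖ M] {N : Type*} [AddCommGroup N] (f : M →+ V →+ N)
    (hf : ∀ (r : R) m v, f (op r • m) v = f m (r • v)) (m : M) (v : V) :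
    lift (A := A) f hf (tmul R A m v) = f m v := rfl

@[simp]
theorem mapRight_tmul {W : Type w} [AddCommGroup W] [Module R W] (g : V →ₗ[R] W) (m : M) (v : V) :
    mapRight R A M g (tmul R A m v) = tmul R A m (g v) := rfl

theorem mapRight_comp {W U : Type w} [AddCommGroup W] [Module R W] [AddCommGroup U] [Module R U]
    (g : V →ₗ[R] W) (h : W →ₗ[R] U) (t : BalTensor R A M V) :
    mapRight R A M (h ∘ₗ g) t = mapRight R A M h (mapRight R A M g t) := by
  induction t using BalTensor.induction with
  | tmul m v => rfl
  | add x y hx hy => simp only [map_add, hx, hy]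

end BalTensor

end

namespace BalTensor

variable {M N : Type v} [AddCommGroup M] [Module Rᵐᵒᵖ M] [AddCommGroup N] [Module Rᵐᵒᵖ N]
  {V W : Type w} [AddCommGroup V] [Module R V] [AddCommGroup W] [Module R W]

@[simp]
theorem mapLeft_tmul (f : M →ₗ[Rᵐᵒᵖ] N) (m : M) (v : V) :
    mapLeft R f V (tmul R ℤ m v) = tmul R ℤ (f m) v := rfl

theorem mapRight_mapLeft (f : M →ₗ[Rᵐᵒᵖ] N) (g : V →ₗ[R] W) (t : BalTensor R ℤ M V) :
    mapRight R ℤ N g (mapLeft R f V t) = mapLeft R f W (mapRight R ℤ M g t) := by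
  induction t using BalTensor.induction with
  | tmul m v => rfl
  | add x y hx hy => simp only [map_add, hx, hy]

/-- Right exactness of `- ⊗_R V`. -/
theorem exists_of_mapLeft_mkQ_eq_zero (K : Submodule Rᵐᵒᵖ M) (t : BalTensor R ℤ M V)
    (ht : mapLeft R K.mkQ V t = 0) : ∃ t', mapLeft R K.subtype V t' = t := by
  obtain ⟨t, rfl⟩ := Submodule.Quotient.mk_surjective _ t
  have ht' : LinearMap.rTensor V (K.mkQ.restrictScalars ℤ) t ∈
      Submodule.span ℤ (balanceRelations R (M ⧸ K) V) := (Submodule.Quotient.mk_eq_zero _).1 ht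
  have h : LinearMap.rTensor V (K.mkQ.restrictScalars ℤ) t ∈
      (Submodule.span ℤ (balanceRelations R M V)).map
        (LinearMap.rTensor V (K.mkQ.restrictScalars ℤ)) := by
    refine Submodule.span_le.2 ?_ ht'
    rintro _ ⟨m, r, v, rfl⟩
    obtain ⟨m, rfl⟩ := K.mkQ_surjective m
    exact ⟨_, Submodule.subset_span ⟨m, r, v, rfl⟩, by simp⟩
  obtain ⟨x, hx, hxt⟩ := h
  have hex : Function.Exact (LinearMap.rTensor V (K.subtype.restrictScalars ℤ))
      (LinearMap.rTensor V (K.mkQ.restrictScalars ℤ)) :=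
    rTensor_exact V (LinearMap.exact_subtype_mkQ K) K.mkQ_surjective
  obtain ⟨y, hy⟩ := (hex (t - x)).1 (by rw [map_sub, hxt, sub_self])
  refine ⟨Submodule.Quotient.mk y, ?_⟩
  refine (Submodule.Quotient.eq _).2 ?_
  rw [hy, sub_sub_cancel_left]
  exact neg_mem (S := Submodule ℤ (M ⊗[ℤ] V)) hx

end BalTensor

/-! ### The equational criterion of flatness -/

section Equational

variable {V : Type u} [AddCommGroup V] [Module R V]

/-- A tensor `∑ nᵢ ⊗ vᵢ` that vanishes in `N ⊗_R V` for a flat `V` vanishes trivially. -/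
theorem IsFlat.vanishes_trivially (hV : IsFlat R V) {N : Type u} [AddCommGroup N] [Module Rᵐᵒᵖ N]
    {n : ℕ} (x : Fin n → N) (v : Fin n → V) (h : ∑ i, BalTensor.tmul R ℤ (x i) (v i) = 0) :
    ∃ (k : ℕ) (a : Fin n → Fin k → R) (y : Fin k → V),
      (∀ i, v i = ∑ j, a i j • y j) ∧ ∀ j, ∑ i, op (a i j) • x i = 0 := by
  -- The submodule of N spanned by the xᵢ is presented as Rⁿ / K. By flatness, ∑ eᵢ ⊗ vᵢ already
  -- vanishes in (Rⁿ / K) ⊗ V, and right exactness then puts it in the image of K ⊗ V.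
  let g : (Fin n → R) →ₗ[Rᵐᵒᵖ] N :=
    { toFun := fun c => ∑ i, op (c i) • x i
      map_add' := fun c c' => by simp [add_smul, Finset.sum_add_distrib]
      map_smul' := fun r c => by
        simp only [Pi.smul_apply, RingHom.id_apply, Finset.smul_sum]
        refine Finset.sum_congr rfl fun i _ => ?_
        rw [smul_smul]
        rfl }
  have hg : ∀ i, g (Pi.single i 1) = x i := by
    intro i
    change ∑ j, op ((Pi.single i 1 : Fin n → R) j) • x j = x i
    rw [Finset.sum_eq_single i]
    · simp
    · intro j _ hj
      simp [Pi.single_eq_of_ne hj]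
    · simp
  let K := LinearMap.ker g
  let gbar : ((Fin n → R) ⧸ K) →ₗ[Rᵐᵒᵖ] N := K.liftQ g le_rfl
  have hgbar : Function.Injective gbar := by
    rw [← LinearMap.ker_eq_bot]
    exact Submodule.ker_liftQ_eq_bot _ _ _ le_rfl
  let t : BalTensor R ℤ (Fin n → R) V := ∑ i, BalTensor.tmul R ℤ (Pi.single i 1) (v i)
  have ht : BalTensor.mapLeft R K.mkQ V t = 0 := by
    apply hV _ _ gbar hgbar
    rw [map_zero, ← h]
    simp only [t, map_sum, BalTensor.mapLeft_tmul]
    refine Finset.sum_congr rfl fun i _ => ?_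
    congr 1
    exact hg i
  obtain ⟨t', ht'⟩ := BalTensor.exists_of_mapLeft_mkQ_eq_zero K t ht
  obtain ⟨k, c, y, rfl⟩ := BalTensor.exists_sum t'
  refine ⟨k, fun i j => (c j).1 i, y, fun i => ?_, fun j => (c j).2⟩
  -- The i-th coordinate map Rⁿ ⊗ V → V recovers vᵢ from the tensor. The remaining identities only
  -- say that the vectors cⱼ lie in K.
  let ev : BalTensor R ℤ (Fin n → R) V →+ V := BalTensor.lift
    (AddMonoidHom.mk' (fun c => DistribSMul.toAddMonoidHom V (c i)) fun c c' => by
      ext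
      simp [add_smul])
    (fun r c v => by simp [mul_smul])
  have := congrArg ev ht'
  simp only [t, map_sum, BalTensor.mapLeft_tmul, ev, BalTensor.lift_tmul] at this
  simp only [AddMonoidHom.mk'_apply, DistribSMul.toAddMonoidHom_apply, Submodule.subtype_apply]
    at this
  rw [this, Finset.sum_eq_single i]
  · simp
  · intro j _ hj
    simp [Pi.single_eq_of_ne' hj]
  · simp

variable (R V) in
/-- The equational criterion: every linear relation in `V` is trivial. -/
def IsEquationallyFlat : Prop :=
  ∀ (n : ℕ) (r : Fin n → R) (v : Fin n → V), ∑ i, r i • v i = 0 →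
    ∃ (k : ℕ) (a : Fin n → Fin k → R) (y : Fin k → V),
      (∀ i, v i = ∑ j, a i j • y j) ∧ ∀ j, ∑ i, r i * a i j = 0

variable (R V) in
/-- The map `v ↦ 1 ⊗ v` from `V` to `R ⊗_R V` inverts multiplication. -/
def BalTensor.selfHom : BalTensor R ℤ R V →+ V :=
  BalTensor.lift (AddMonoidHom.mk' (fun c => DistribSMul.toAddMonoidHom V c) fun c c' => by
      ext
      simp [add_smul])
    (fun r c v => by simp [mul_smul])

@[simp]
theorem BalTensor.selfHom_tmul (r : R) (v : V) : selfHom R V (tmul R ℤ r v) = r • v := rfl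

theorem BalTensor.one_tmul_selfHom (t : BalTensor R ℤ R V) : tmul R ℤ 1 (selfHom R V t) = t := by
  induction t using BalTensor.induction with
  | tmul r v =>
    rw [selfHom_tmul, ← op_smul_tmul]
    simp
  | add x y hx hy => rw [map_add, tmul_add, hx, hy]

theorem BalTensor.selfHom_injective : Function.Injective (selfHom R V) :=
  Function.LeftInverse.injective (g := tmul R ℤ 1) one_tmul_selfHom

/-- The case N = R of the vanishing criterion, since multiplication R ⊗ V → V is injective. -/
theorem IsFlat.isEquationallyFlat (hV : IsFlat R V) : IsEquationallyFlat R V := by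
  intro n r v h
  refine hV.vanishes_trivially r v ?_
  apply BalTensor.selfHom_injective
  simpa using h

end Equational

/-! ### Finitely generated projective modules are flat -/

section Projective

variable {M N : Type u} [AddCommGroup M] [Module Rᵐᵒᵖ M] [AddCommGroup N] [Module Rᵐᵒᵖ N]

/-- The coordinates of an element of `M ⊗_R Rⁿ`. -/
def BalTensor.coord {n : ℕ} (i : Fin n) : BalTensor R ℤ M (Fin n → R) →+ M :=
  BalTensor.lift
    (AddMonoidHom.mk' (fun m => AddMonoidHom.mk' (fun c => op (c i) • m) fun c c' => by
      simp [add_smul]) fun m m' => by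
      ext
      simp)
    (fun r m c => by simp [mul_smul])

@[simp]
theorem BalTensor.coord_tmul {n : ℕ} (i : Fin n) (m : M) (c : Fin n → R) :
    coord i (tmul R ℤ m c) = op (c i) • m := rfl

theorem BalTensor.sum_coord {n : ℕ} (t : BalTensor R ℤ M (Fin n → R)) :
    ∑ i, tmul R ℤ (coord i t) (Pi.single i 1 : Fin n → R) = t := by
  induction t using BalTensor.induction with
  | tmul m c =>
    simp only [coord_tmul, op_smul_tmul]
    rw [← tmul_sum]
    congr 1
    ext j
    simp [Finset.sum_apply, Pi.single_apply]
  | add x y hx hy =>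
    simp only [map_add, add_tmul, Finset.sum_add_distrib, hx, hy]

theorem BalTensor.coord_mapLeft {n : ℕ} (f : M →ₗ[Rᵐᵒᵖ] N) (i : Fin n)
    (t : BalTensor R ℤ M (Fin n → R)) : coord i (mapLeft R f _ t) = f (coord i t) := by
  induction t using BalTensor.induction with
  | tmul m c => simp
  | add x y hx hy => simp only [map_add, hx, hy]

/-- An element of M ⊗ Rⁿ is determined by its coordinates in M, and f acts on these injectively. The
general case follows because P is a retract of some Rⁿ. -/
theorem isFlat_of_finite_projective (P : Type u) [AddCommGroup P] [Module R P] [Module.Finite R P]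
    [Module.Projective R P] : IsFlat R P := by
  intro M N _ _ _ _ f hf
  obtain ⟨n, g, s, -, -, hgs⟩ := Module.Finite.exists_comp_eq_id_of_projective R P
  rw [injective_iff_map_eq_zero]
  intro t ht
  have h1 : BalTensor.mapRight R ℤ M s t = 0 := by
    rw [← BalTensor.sum_coord (BalTensor.mapRight R ℤ M s t)]
    refine Finset.sum_eq_zero fun i _ => ?_
    have : BalTensor.coord i (BalTensor.mapRight R ℤ M s t) = 0 := by
      apply hf
      rw [← BalTensor.coord_mapLeft, ← BalTensor.mapRight_mapLeft, ht]
      simp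
    rw [this, BalTensor.zero_tmul]
  have h2 : BalTensor.mapRight R ℤ M g (BalTensor.mapRight R ℤ M s t) = t := by
    clear ht h1
    induction t using BalTensor.induction with
    | tmul m p =>
      simp only [BalTensor.mapRight_tmul]
      congr 1
      exact LinearMap.congr_fun hgs p
    | add x y hx hy => simp only [map_add, hx, hy]
  rw [← h2, h1, map_zero]

end Projective

end BalTensor

/-! ### The category of finitely generated projective modules -/

section ProjCat

variable {R : Type u} [Ring R]

namespace ProjCat

/-- The underlying linear map of a morphism of finitely generated projective modules. -/
def lin {P Q : ProjCat R} (f : P ⟶ Q) : P.P →ₗ[R] Q.P := ((taut R).map f).hom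

/-- A linear map as a morphism of finitely generated projective modules. -/
def ofLin {P Q : ProjCat R} (f : P.P →ₗ[R] Q.P) : P ⟶ Q := InducedCategory.homMk (ModuleCat.ofHom f)

@[simp]
theorem lin_ofLin {P Q : ProjCat R} (f : P.P →ₗ[R] Q.P) : lin (ofLin f) = f := rfl

@[simp]
theorem lin_comp {P Q T : ProjCat R} (f : P ⟶ Q) (g : Q ⟶ T) : lin (f ≫ g) = lin g ∘ₗ lin f := rfl

@[simp]
theorem lin_id (P : ProjCat R) : lin (𝟙 P) = LinearMap.id := rfl

theorem lin_injective {P Q : ProjCat R} {f g : P ⟶ Q} (h : lin f = lin g) : f = g :=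
  InducedCategory.hom_ext (ModuleCat.hom_ext h)

instance (P : ProjCat R) : Module.Finite R P.P := ProjObj.finite P

instance (P : ProjCat R) : Module.Projective R P.P := ProjObj.projective P

/-- Every finitely generated projective module is isomorphic to an object of `ProjCat R`. -/
theorem exists_linearEquiv (X : Type u) [AddCommGroup X] [Module R X] [Module.Finite R X]
    [Module.Projective R X] : ∃ P : ProjCat R, Nonempty (X ≃ₗ[R] P.P) := by
  obtain ⟨n, g, s, -, hs, hgs⟩ := Module.Finite.exists_comp_eq_id_of_projective R X
  let e : X ≃ₗ[R] LinearMap.range s := LinearEquiv.ofInjective s hs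
  exact ⟨(⟨n, LinearMap.range s, Module.Finite.equiv e, Module.Projective.of_equiv e⟩ : ProjObj R),
    ⟨e⟩⟩

variable (R) in
/-- The free module `Rⁿ`. -/
def free (n : ℕ) : ProjCat R := (⟨n, ⊤, inferInstance,
  Module.Projective.of_equiv (Submodule.topEquiv (R := R) (M := Fin n → R)).symm⟩ : ProjObj R)

variable (R) in
/-- The identification of the free module with `Rⁿ`. -/
def freeEquiv (n : ℕ) : (free R n).P ≃ₗ[R] (Fin n → R) :=
  (Submodule.topEquiv : (⊤ : Submodule R (Fin n → R)) ≃ₗ[R] (Fin n → R))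

/-- The standard basis of `Rⁿ`. -/
def basis {n : ℕ} (i : Fin n) : (free R n).P := (freeEquiv R n).symm (Pi.single i 1)

/-- The linear map `Rⁿ ⟶ V` with given values on the standard basis. -/
def freeMap {V : Type*} [AddCommGroup V] [Module R V] {n : ℕ} (v : Fin n → V) :
    (free R n).P →ₗ[R] V :=
  Fintype.linearCombination R v ∘ₗ (freeEquiv R n).toLinearMap

@[simp]
theorem freeMap_basis {V : Type*} [AddCommGroup V] [Module R V] {n : ℕ} (v : Fin n → V)
    (i : Fin n) : freeMap v (basis (R := R) i) = v i := by
  simp [freeMap, basis, Fintype.linearCombination_apply_single]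

theorem free_hom_ext {V : Type*} [AddCommGroup V] [Module R V] {n : ℕ}
    {f g : (free R n).P →ₗ[R] V} (h : ∀ i, f (basis i) = g (basis i)) : f = g := by
  have : f ∘ₗ (freeEquiv R n).symm.toLinearMap = g ∘ₗ (freeEquiv R n).symm.toLinearMap :=
    LinearMap.pi_ext' fun i => LinearMap.ext_ring (h i)
  ext x
  simpa using LinearMap.congr_fun this (freeEquiv R n x)

/-- The morphism `Rⁿ ⟶ P` with given values on the standard basis. -/
def freeHom {P : ProjCat R} {n : ℕ} (v : Fin n → P.P) : free R n ⟶ P := ofLin (freeMap v)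

theorem freeHom_comp {P Q : ProjCat R} {n : ℕ} (v : Fin n → P.P) (f : P ⟶ Q) :
    freeHom v ≫ f = freeHom fun i => lin f (v i) := by
  apply lin_injective
  apply free_hom_ext
  intro i
  simp [freeHom]

theorem isZero_free_zero : IsZero (free R 0) := by
  have h : ∀ {V : Type u} [AddCommGroup V] [Module R V] (f g : (free R 0).P →ₗ[R] V), f = g :=
    fun f g => free_hom_ext fun i => i.elim0
  refine ⟨fun Y => ⟨⟨⟨ofLin 0⟩, fun f => lin_injective (h _ _)⟩⟩,
    fun Y => ⟨⟨⟨ofLin 0⟩, fun f => lin_injective (LinearMap.ext fun y => ?_)⟩⟩⟩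
  exact LinearMap.congr_fun (h LinearMap.id 0) _

end ProjCat

end ProjCat

/-! ### Modules satisfying the equational criterion are filtered colimits -/

section Filtered

variable {R : Type u} [Ring R] {V : ModuleCat.{u} R}

/-- An object of the category of finitely generated projective modules over `V`. -/
abbrev overMk {P : ProjCat R} (g : P.P →ₗ[R] V) : CostructuredArrow (taut R) V :=
  CostructuredArrow.mk (Y := P) (ModuleCat.ofHom g)

/-- A morphism in the category of finitely generated projective modules over `V`. -/
abbrev overHom {P Q : ProjCat R} {g : P.P →ₗ[R] V} {g' : Q.P →ₗ[R] V} (h : P ⟶ Q)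
    (w : g' ∘ₗ ProjCat.lin h = g) : overMk g ⟶ overMk g' :=
  CostructuredArrow.homMk h (ModuleCat.hom_ext w)

/-- Finitely many relations in an equationally flat module are killed by a map of free modules. -/
theorem IsEquationallyFlat.exists_kill (hV : IsEquationallyFlat R V) {n : ℕ}
    (g : (Fin n → R) →ₗ[R] V) (s : Finset (Fin n → R)) (hs : ∀ x ∈ s, g x = 0) :
    ∃ (k : ℕ) (h : (Fin n → R) →ₗ[R] (Fin k → R)) (g' : (Fin k → R) →ₗ[R] V),
      g' ∘ₗ h = g ∧ ∀ x ∈ s, h x = 0 := by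
  classical
  induction s using Finset.induction_on with
  | empty => exact ⟨n, LinearMap.id, g, rfl, by simp⟩
  | insert x s _ ih =>
    obtain ⟨k, h, g', rfl, hk⟩ := ih fun y hy => hs y (Finset.mem_insert_of_mem hy)
    have hx : g' (h x) = 0 := hs x (Finset.mem_insert_self _ _)
    have hsum : ∀ c : Fin k → R, g' c = ∑ i, c i • g' (Pi.single i 1) := fun c => by
      conv_lhs => rw [pi_eq_sum_univ' c, map_sum]
      exact Finset.sum_congr rfl fun i _ => g'.map_smul _ _
    -- Since g' kills h x, the coordinates of h x are a linear relation among the values of g' on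
    -- the standard basis. Trivializing it factors g' through a map Rᵏ → Rˡ that kills h x; whatever
    -- was killed before stays killed.
    obtain ⟨l, a, y, hy, ha⟩ := hV k (h x) (fun i => g' (Pi.single i 1)) (by rw [← hsum, hx])
    refine ⟨l, Fintype.linearCombination R a ∘ₗ h, Fintype.linearCombination R y, ?_, ?_⟩
    · rw [← LinearMap.comp_assoc]
      congr 1
      refine LinearMap.pi_ext' fun i => LinearMap.ext_ring ?_
      simp [hy i, Fintype.linearCombination_apply]
    · intro z hz
      have key : ∀ c : Fin k → R, (∀ j, ∑ i, c i * a i j = 0) →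
          Fintype.linearCombination R a c = 0 := fun c hc => by
        ext j
        simpa [Fintype.linearCombination_apply, Finset.sum_apply] using hc j
      rcases Finset.mem_insert.1 hz with rfl | hz
      · exact key _ ha
      · simp [hk z hz]

/-- Two objects map to their direct sum. The difference of two parallel maps has a finitely
generated image that goes to zero in V, and `exists_kill` provides a free module over V in which the
generators die. -/
theorem IsEquationallyFlat.isFiltered (hV : IsEquationallyFlat R V) :
    IsFiltered (CostructuredArrow (taut R) V) := by
  have : Nonempty (CostructuredArrow (taut R) V) := ⟨overMk (P := ProjCat.free R 0) 0⟩
  have : IsFilteredOrEmpty (CostructuredArrow (taut R) V) := by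
    refine ⟨fun X Y => ?_, fun X Y f g => ?_⟩
    · obtain ⟨Q, ⟨e⟩⟩ := ProjCat.exists_linearEquiv (R := R) (X.left.P × Y.left.P)
      refine ⟨overMk (P := Q) (LinearMap.coprod X.hom.hom Y.hom.hom ∘ₗ e.symm.toLinearMap),
        overHom (g := X.hom.hom) (ProjCat.ofLin (e.toLinearMap ∘ₗ LinearMap.inl R _ _)) ?_,
        overHom (g := Y.hom.hom) (ProjCat.ofLin (e.toLinearMap ∘ₗ LinearMap.inr R _ _)) ?_, trivial⟩
      · ext x
        simp
      · ext x
        simp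
    · obtain ⟨n, p, s, -, -, hps⟩ := Module.Finite.exists_comp_eq_id_of_projective R Y.left.P
      classical
      obtain ⟨S, hS⟩ := Module.Finite.fg_top (R := R) (M := X.left.P)
      -- `exists_kill` starts from a free module, so the difference is first carried into Rⁿ by a
      -- section s of a projection p from Rⁿ onto Y.
      let δ : X.left.P →ₗ[R] (Fin n → R) := s ∘ₗ (ProjCat.lin f.left - ProjCat.lin g.left)
      have hps' : ∀ y, p (s y) = y := LinearMap.congr_fun hps
      have hf : Y.hom.hom ∘ₗ ProjCat.lin f.left = X.hom.hom :=
        congrArg ModuleCat.Hom.hom (CostructuredArrow.w f)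
      have hg : Y.hom.hom ∘ₗ ProjCat.lin g.left = X.hom.hom :=
        congrArg ModuleCat.Hom.hom (CostructuredArrow.w g)
      obtain ⟨k, h, g', hgh, hk⟩ := hV.exists_kill (Y.hom.hom ∘ₗ p) (S.image δ) (by
        intro x hx
        obtain ⟨x, -, rfl⟩ := Finset.mem_image.1 hx
        have h1 := LinearMap.congr_fun hf x
        have h2 := LinearMap.congr_fun hg x
        simp only [LinearMap.comp_apply] at h1 h2
        simp [δ, hps', h1, h2])
      have hδ : h ∘ₗ δ = 0 := by
        refine LinearMap.ext_on hS fun x hx => ?_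
        exact hk _ (Finset.mem_image_of_mem _ hx)
      refine ⟨overMk (P := ProjCat.free R k) (g' ∘ₗ (ProjCat.freeEquiv R k).toLinearMap),
        overHom (g := Y.hom.hom)
          (ProjCat.ofLin ((ProjCat.freeEquiv R k).symm.toLinearMap ∘ₗ h ∘ₗ s)) ?_, ?_⟩
      · ext y
        have := LinearMap.congr_fun hgh (s y)
        simp only [LinearMap.comp_apply] at this
        simp [this, hps']
      · apply CostructuredArrow.hom_ext
        apply ProjCat.lin_injective
        ext x : 1
        have := LinearMap.congr_fun hδ x
        simp only [δ, LinearMap.comp_apply, LinearMap.sub_apply, map_sub, LinearMap.zero_apply,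
          sub_eq_zero] at this
        exact congrArg (ProjCat.freeEquiv R k).symm this
  exact {}

end Filtered

/-! ### Extension of functors to modules -/

section Extend

variable {R : Type u} [Ring R] {S : Type u} [Ring S]

/-- The extension of functors from finitely generated projective modules to all modules, for
functors with values in modules over another ring. -/
abbrev extendTo {S : Type v} [Ring S] (G : ProjCat R ⥤ ModuleCat.{u} S) :
    ModuleCat.{u} R ⥤ ModuleCat.{u} S :=
  (taut R).pointwiseLeftKanExtension G

section

variable {S : Type v} [Ring S] (G : ProjCat R ⥤ ModuleCat.{u} S) {V W : ModuleCat.{u} R}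

/-- The structure map `G(P) ⟶ G(V)` for a map `P ⟶ V`. -/
def incl {P : ProjCat R} (g : P.P →ₗ[R] V) : G.obj P →ₗ[S] (extendTo G).obj V :=
  (colimit.ι (CostructuredArrow.proj (taut R) V ⋙ G) (overMk g)).hom

theorem incl_map {P Q : ProjCat R} (h : P ⟶ Q) (g : Q.P →ₗ[R] V) (x : G.obj P) :
    incl G g ((G.map h).hom x) = incl G (g ∘ₗ ProjCat.lin h) x :=
  congrArg (fun f => f.hom x)
    (colimit.w (CostructuredArrow.proj (taut R) V ⋙ G) (overHom h (g' := g) rfl))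

theorem map_incl {P : ProjCat R} (f : V ⟶ W) (g : P.P →ₗ[R] V) (x : G.obj P) :
    ((extendTo G).map f).hom (incl G g x) = incl G (f.hom ∘ₗ g) x :=
  have h : colimit.ι (CostructuredArrow.proj (taut R) V ⋙ G) (overMk g) ≫ (extendTo G).map f =
      colimit.ι (CostructuredArrow.proj (taut R) W ⋙ G) (overMk (f.hom ∘ₗ g)) :=
    colimit.ι_desc _ _
  congrArg (fun f => f.hom x) h

theorem preservesColimitsOfShape_forget (J : Type u) [SmallCategory J] [IsFiltered J] :
    PreservesColimitsOfShape J (forget (ModuleCat.{u} S)) :=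
  inferInstanceAs (PreservesColimitsOfShape J
    (forget₂ (ModuleCat.{u} S) AddCommGrpCat.{u} ⋙ forget AddCommGrpCat.{u}))

/-- A filtered colimit of modules is computed on underlying sets. Together with
`exists_map_eq_zero`, this reduces statements about G(V) to statements about G(P). -/
theorem exists_incl (hV : IsEquationallyFlat R V) (y : (extendTo G).obj V) :
    ∃ (P : ProjCat R) (g : P.P →ₗ[R] V) (x : G.obj P), incl G g x = y := by
  have := hV.isFiltered
  have := preservesColimitsOfShape_forget (S := S) (CostructuredArrow (taut R) V)
  obtain ⟨j, x, hx⟩ := Concrete.colimit_exists_rep (CostructuredArrow.proj (taut R) V ⋙ G) y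
  exact ⟨j.left, j.hom.hom, x, hx⟩

/-- In a filtered colimit, an element that becomes zero is already zero at a later stage of the
diagram. -/
theorem exists_map_eq_zero (hV : IsEquationallyFlat R V) {P : ProjCat R} (g : P.P →ₗ[R] V)
    (x : G.obj P) (hx : incl G g x = 0) :
    ∃ (Q : ProjCat R) (h : P ⟶ Q) (g' : Q.P →ₗ[R] V),
      g' ∘ₗ ProjCat.lin h = g ∧ (G.map h).hom x = 0 := by
  have := hV.isFiltered
  have := preservesColimitsOfShape_forget (S := S) (CostructuredArrow (taut R) V)
  obtain ⟨k, f, hf⟩ := (IsColimit.eq_iff' (colimit.isColimit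
    (CostructuredArrow.proj (taut R) V ⋙ G)) (i := overMk g) x 0).1 (hx.trans (map_zero _).symm)
  exact ⟨k.left, f.left, k.hom.hom, congrArg ModuleCat.Hom.hom (CostructuredArrow.w f),
    hf.trans (map_zero ((CostructuredArrow.proj (taut R) V ⋙ G).map f).hom)⟩

/-- Additive maps out of `G(V)`. -/
def extendDesc {N : Type u} [AddCommGroup N]
    (t : ∀ (P : ProjCat R), (P.P →ₗ[R] V) → (G.obj P →+ N))
    (ht : ∀ (P Q : ProjCat R) (h : P ⟶ Q) (g : Q.P →ₗ[R] V) (x : G.obj P),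
      t Q g ((G.map h).hom x) = t P (g ∘ₗ ProjCat.lin h) x) : (extendTo G).obj V →+ N :=
  ((isColimitOfPreserves (forget₂ (ModuleCat.{u} S) AddCommGrpCat.{u})
    (colimit.isColimit (CostructuredArrow.proj (taut R) V ⋙ G))).desc
    { pt := AddCommGrpCat.of N
      ι :=
        { app := fun j => AddCommGrpCat.ofHom (t j.left j.hom.hom)
          naturality := fun j k f => by
            ext x
            refine (ht _ _ f.left k.hom.hom x).trans ?_
            exact congrArg (fun g => t j.left g x)
              (congrArg ModuleCat.Hom.hom (CostructuredArrow.w f)) } }).hom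

@[simp]
theorem extendDesc_incl {N : Type u} [AddCommGroup N]
    (t : ∀ (P : ProjCat R), (P.P →ₗ[R] V) → (G.obj P →+ N))
    (ht : ∀ (P Q : ProjCat R) (h : P ⟶ Q) (g : Q.P →ₗ[R] V) (x : G.obj P),
      t Q g ((G.map h).hom x) = t P (g ∘ₗ ProjCat.lin h) x)
    {P : ProjCat R} (g : P.P →ₗ[R] V) (x : G.obj P) :
    extendDesc G t ht (incl G g x) = t P g x :=
  have h : (forget₂ (ModuleCat.{u} S) AddCommGrpCat.{u}).map
      (colimit.ι (CostructuredArrow.proj (taut R) V ⋙ G) (overMk g)) ≫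
      AddCommGrpCat.ofHom (extendDesc G t ht) = AddCommGrpCat.ofHom (t P g) :=
    (isColimitOfPreserves (forget₂ (ModuleCat.{u} S) AddCommGrpCat.{u})
      (colimit.isColimit (CostructuredArrow.proj (taut R) V ⋙ G))).fac _ (overMk g)
  congrArg (fun f => f.hom x) h

end

end Extend

section Extend

variable {R : Type u} [Ring R]

theorem extendTo_addHom_ext {S : Type v} [Ring S] {G : ProjCat R ⥤ ModuleCat.{u} S}
    {V : ModuleCat.{u} R} {N : Type u} [AddCommGroup N] {f f' : (extendTo G).obj V →+ N}
    (h : ∀ (P : ProjCat R) (g : P.P →ₗ[R] V) (x : G.obj P), f (incl G g x) = f' (incl G g x)) :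
    f = f' := by
  have : AddCommGrpCat.ofHom f = AddCommGrpCat.ofHom f' :=
    (isColimitOfPreserves (forget₂ (ModuleCat.{u} S) AddCommGrpCat.{u})
      (colimit.isColimit (CostructuredArrow.proj (taut R) V ⋙ G))).hom_ext fun j =>
        AddCommGrpCat.hom_ext (AddMonoidHom.ext fun x => h j.left j.hom.hom x)
  exact congrArg AddCommGrpCat.Hom.hom this

/-! ### Tensor products commute with the extension -/

section Tensor

variable (B : Type v) [Ring B] (A : Type u) [AddCommGroup A] [Module B A] [Module Rᵐᵒᵖ A]

/-- The functor `V ↦ A ⊗_R V` for a `(B, R)`-bimodule `A`. -/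
def tensorTo : ModuleCat.{u} R ⥤ ModuleCat.{u} B where
  obj V := ModuleCat.of B (BalTensor R B A V)
  map f := ModuleCat.ofHom (BalTensor.mapRight R B A f.hom)
  map_id V := by
    ext : 1
    ext v
    simp [BalTensor.mapRight]
  map_comp f g := by
    ext : 1
    ext v
    simp [BalTensor.mapRight]

variable {V : ModuleCat.{u} R}

/-- The structure maps of the extension of `P ↦ A ⊗_R P`. -/
def tensorIncl {P : ProjCat R} (g : P.P →ₗ[R] V) :
    BalTensor R B A P.P →+ (extendTo (taut R ⋙ tensorTo B A)).obj V :=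
  (incl (taut R ⋙ tensorTo B A) g).toAddMonoidHom

theorem tensorIncl_map {P Q : ProjCat R} (h : P ⟶ Q) (g : Q.P →ₗ[R] V) (x : BalTensor R B A P.P) :
    tensorIncl B A g (BalTensor.mapRight R B A (ProjCat.lin h) x) =
      tensorIncl B A (g ∘ₗ ProjCat.lin h) x :=
  incl_map (taut R ⋙ tensorTo B A) h g x

/-- Naturality for the map R → P that hits p: the class of a pure tensor depends only on a and g p,
and is visible on the free module of rank one. -/
theorem tensorIncl_tmul {P : ProjCat R} (g : P.P →ₗ[R] V) (a : A) (p : P.P) :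
    tensorIncl B A g (BalTensor.tmul R B a p) =
      tensorIncl B A (ProjCat.freeMap fun _ : Fin 1 => g p)
        (BalTensor.tmul R B a (ProjCat.basis 0)) := by
  have h : g ∘ₗ ProjCat.lin (ProjCat.freeHom fun _ : Fin 1 => p) =
      ProjCat.freeMap fun _ => g p :=
    ProjCat.free_hom_ext fun i => by simp [ProjCat.freeHom]
  rw [← h, ← tensorIncl_map, BalTensor.mapRight_tmul]
  simp [ProjCat.freeHom]

/-- The inverse of the canonical map from the extension of `P ↦ A ⊗_R P` to `A ⊗_R V`. -/
def tensorInv [SMulCommClass B Rᵐᵒᵖ A] :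
    BalTensor R B A V →+ (extendTo (taut R ⋙ tensorTo B A)).obj V :=
  BalTensor.lift
    (AddMonoidHom.mk'
      (fun a => AddMonoidHom.mk' (fun v : V =>
          tensorIncl B A (ProjCat.freeMap fun _ : Fin 1 => v)
            (BalTensor.tmul R B a (ProjCat.basis 0)))
        fun v w => by
          -- Additivity in the vector is checked on R², where v, w and v + w are the images of e₀,
          -- e₁ and e₀ + e₁.
          have h := tensorIncl_tmul B A (ProjCat.freeMap (R := R) ![v, w]) a
          have h2 := h (ProjCat.basis 0 + ProjCat.basis 1)
          rw [BalTensor.tmul_add, map_add, h, h] at h2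
          simpa using h2.symm)
      fun a a' => by
        ext v
        simp only [AddMonoidHom.mk'_apply, BalTensor.add_tmul, AddMonoidHom.add_apply, map_add])
    (fun r a v => by
      have h := tensorIncl_tmul B A (ProjCat.freeMap (R := R) fun _ : Fin 1 => v) a
        (r • ProjCat.basis 0)
      simp only [AddMonoidHom.mk'_apply, BalTensor.op_smul_tmul]
      simpa using h)

/-- The inverse sends a ⊗ v to the class of a ⊗ e₀ for the map R → V with e₀ ↦ v. This works for
every module V, flat or not. -/
theorem bijective_of_incl_tensor [SMulCommClass B Rᵐᵒᵖ A]
    (F : (extendTo (taut R ⋙ tensorTo B A)).obj V →+ BalTensor R B A V)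
    (hF : ∀ (P : ProjCat R) (g : P.P →ₗ[R] V) (x : BalTensor R B A P.P),
      F (tensorIncl B A g x) = BalTensor.mapRight R B A g x) :
    Function.Bijective F := by
  have h1 : F.comp (tensorInv B A) = AddMonoidHom.id _ := BalTensor.addHom_ext fun a v => by
    refine (hF _ _ _).trans ?_
    rw [BalTensor.mapRight_tmul, ProjCat.freeMap_basis]
    rfl
  have h2 : (tensorInv B A).comp F = AddMonoidHom.id _ := extendTo_addHom_ext fun P g x => by
    refine (congrArg (tensorInv B A) (hF P g x)).trans ?_
    change BalTensor R B A P.P at x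
    change _ = tensorIncl B A g x
    induction x using BalTensor.induction with
    | tmul a p => exact (tensorIncl_tmul B A g a p).symm
    | add x y hx hy => rw [map_add, map_add, hx, hy, map_add]
  exact ⟨Function.LeftInverse.injective (DFunLike.congr_fun h2),
    Function.RightInverse.surjective (DFunLike.congr_fun h1)⟩

/-- The canonical map from the extension of `P ↦ A ⊗_R P` to `A ⊗_R V`. -/
def tensorDesc : (extendTo (taut R ⋙ tensorTo B A)).obj V →+ BalTensor R B A V :=
  extendDesc _ (fun _ g => (BalTensor.mapRight R B A g).toAddMonoidHom) fun _ _ h g x =>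
    (BalTensor.mapRight_comp (ProjCat.lin h) g x).symm

theorem tensorDesc_tensorIncl {P : ProjCat R} (g : P.P →ₗ[R] V) (x : BalTensor R B A P.P) :
    tensorDesc B A (tensorIncl B A g x) = BalTensor.mapRight R B A g x :=
  extendDesc_incl _ _ _ _ _

theorem bijective_tensorDesc [SMulCommClass B Rᵐᵒᵖ A] :
    Function.Bijective (tensorDesc B A (V := V)) :=
  bijective_of_incl_tensor B A _ fun _ _ _ => tensorDesc_tensorIncl B A _ _

variable {B A}

theorem exists_mapRight_eq [SMulCommClass B Rᵐᵒᵖ A] (hV : IsEquationallyFlat R V)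
    (t : BalTensor R B A V) : ∃ (P : ProjCat R) (g : P.P →ₗ[R] V) (x : BalTensor R B A P.P),
      BalTensor.mapRight R B A g x = t := by
  obtain ⟨y, rfl⟩ := (bijective_tensorDesc B A).2 t
  obtain ⟨P, g, x, rfl⟩ := exists_incl _ hV y
  exact ⟨P, g, x, (tensorDesc_tensorIncl B A g x).symm⟩

theorem exists_mapRight_eq_zero [SMulCommClass B Rᵐᵒᵖ A] (hV : IsEquationallyFlat R V)
    {P : ProjCat R} (g : P.P →ₗ[R] V) (x : BalTensor R B A P.P)
    (hx : BalTensor.mapRight R B A g x = 0) :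
    ∃ (Q : ProjCat R) (h : P ⟶ Q) (g' : Q.P →ₗ[R] V),
      g' ∘ₗ ProjCat.lin h = g ∧ BalTensor.mapRight R B A (ProjCat.lin h) x = 0 := by
  rw [← tensorDesc_tensorIncl] at hx
  exact exists_map_eq_zero (taut R ⋙ tensorTo B A) hV g x
    ((bijective_tensorDesc B A).1 (hx.trans (map_zero _).symm))

end Tensor

/-- A tensor over V comes from some P. If its image under f vanishes over V, it already vanishes
over some Q receiving a map from P, and Q is flat because it is finitely generated projective. -/
theorem IsEquationallyFlat.isFlat {V : Type u} [AddCommGroup V] [Module R V]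
    (hV : IsEquationallyFlat R V) : IsFlat R V := by
  intro M N _ _ _ _ f hf
  rw [injective_iff_map_eq_zero]
  intro t ht
  obtain ⟨P, g, x, rfl⟩ := exists_mapRight_eq (V := ModuleCat.of R V) hV t
  rw [← BalTensor.mapRight_mapLeft] at ht
  obtain ⟨Q, h, g', rfl, h0⟩ := exists_mapRight_eq_zero (V := ModuleCat.of R V) hV g _ ht
  rw [BalTensor.mapRight_mapLeft] at h0
  rw [BalTensor.mapRight_comp, isFlat_of_finite_projective Q.P M N f hf (h0.trans (map_zero _).symm),
    map_zero]

/-! ### The canonical maps from I(V) to V and from I(M)(V) to M ⊗ V -/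

section Canonical

variable {V : ModuleCat.{u} R}

theorem fromTaut_incl {P : ProjCat R} (g : P.P →ₗ[R] V) (x : P.P) :
    (fromTaut R V).hom (incl (taut R) g x) = g x := by
  have h : colimit.ι (CostructuredArrow.proj (taut R) V ⋙ taut R) (overMk g) ≫ fromTaut R V =
      ModuleCat.ofHom g := colimit.ι_desc _ _
  exact congrArg (fun f => f.hom x) h

/-- Maps from R give surjectivity. For injectivity, the class of x in P depends only on g x, since
it comes from the composite R → P → V; when g x = 0 it is the class of 0. -/
theorem bijective_fromTaut (hV : IsEquationallyFlat R V) :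
    Function.Bijective (fromTaut R V).hom := by
  constructor
  · rw [injective_iff_map_eq_zero]
    intro y hy
    obtain ⟨P, g, x, rfl⟩ := exists_incl _ hV y
    change P.P at x
    replace hy : g x = 0 := (fromTaut_incl g x).symm.trans hy
    have h1 : ∀ z : P.P, incl (taut R) g z = incl (taut R)
        (g ∘ₗ ProjCat.lin (ProjCat.freeHom fun _ : Fin 1 => z)) (ProjCat.basis 0) := fun z => by
      rw [← incl_map]
      exact congrArg _ (ProjCat.freeMap_basis (R := R) (fun _ => z) 0).symm
    have h2 : g ∘ₗ ProjCat.lin (ProjCat.freeHom fun _ : Fin 1 => x) =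
        g ∘ₗ ProjCat.lin (ProjCat.freeHom fun _ : Fin 1 => 0) :=
      ProjCat.free_hom_ext fun i => by simp [ProjCat.freeHom, hy]
    rw [h1, h2, ← h1]
    exact map_zero _
  · intro v
    refine ⟨incl (taut R) (ProjCat.freeMap fun _ : Fin 1 => v) (ProjCat.basis 0), ?_⟩
    rw [fromTaut_incl]
    simp

variable (M : Type u) [AddCommGroup M] [Module R M] [Module Rᵐᵒᵖ M]

theorem fromTautTensor_incl {P : ProjCat R} (g : P.P →ₗ[R] V) (x : BalTensor R R M P.P) :
    (fromTautTensor M V).hom (incl (tautTensor R M) g x) = BalTensor.mapRight R R M g x := by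
  have h : colimit.ι (CostructuredArrow.proj (taut R) V ⋙ tautTensor R M) (overMk g) ≫
      fromTautTensor M V = (tensorFunctor R M).map (ModuleCat.ofHom g) := colimit.ι_desc _ _
  exact congrArg (fun f => f.hom x) h

instance [SMulCommClass R Rᵐᵒᵖ M] : IsIso (fromTautTensor M V) :=
  (ConcreteCategory.isIso_iff_bijective _).2
    (bijective_of_incl_tensor R M (fromTautTensor M V).hom.toAddMonoidHom
      fun _ g x => fromTautTensor_incl M g x)

variable {G H : ProjCat R ⥤ ModuleCat.{u} R}

theorem extendMap_incl (τ : G ⟶ H) {P : ProjCat R} (g : P.P →ₗ[R] V) (x : G.obj P) :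
    (extendMap τ V).hom (incl G g x) = incl H g ((τ.app P).hom x) := by
  have h : colimit.ι (CostructuredArrow.proj (taut R) V ⋙ G) (overMk g) ≫ extendMap τ V =
      τ.app P ≫ colimit.ι (CostructuredArrow.proj (taut R) V ⋙ H) (overMk g) :=
    ι_colimMap _ _
  exact congrArg (fun f => f.hom x) h

end Canonical

end Extend

/-! ### Splittings in terms of exact sequences -/

section Abelian

variable {E : Type w} [Category.{v} E] [Abelian E] {B C₁ C₀ A : E} {b : B ⟶ C₁} {d : C₁ ⟶ C₀}
  {a : C₀ ⟶ A}

/-- A splitting of `d` with cokernel `a` is an extension of `A` by `C₁` that maps onto `C₀`. -/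
theorem IsElementaryExtension.isPullback_iff (h : IsElementaryExtension b d a) {X : E}
    {c₁ : C₁ ⟶ X} {c₀ : X ⟶ C₀} :
    IsPullback c₁ (factorThruImage d) c₀ (image.ι d) ↔
      c₁ ≫ c₀ = d ∧ Mono c₁ ∧ ∀ w : c₁ ≫ c₀ ≫ a = 0, (ShortComplex.mk c₁ (c₀ ≫ a) w).Exact := by
  have hι : image.ι d ≫ a = 0 := by
    rw [← cancel_epi (factorThruImage d), ← Category.assoc, image.fac, h.d_a, comp_zero]
  -- Exactness at C₀ identifies Im d with Ker a, so the fibre product of X and Im d over C₀ is the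
  -- kernel of X → A. Both directions below rest on this.
  have hex : (ShortComplex.mk (image.ι d) a hι).Exact := by
    have := h.exact₀
    refine (ShortComplex.exact_iff_of_epi_of_isIso_of_mono
      (S₁ := ShortComplex.mk d a h.d_a) (S₂ := ShortComplex.mk (image.ι d) a hι)
      { τ₁ := factorThruImage d, τ₂ := 𝟙 _, τ₃ := 𝟙 _ }).1 this
  constructor
  · intro hp
    refine ⟨by rw [hp.w, image.fac], ?_, fun w => ?_⟩
    · exact hp.mono_fst_of_mono
    · have : Mono c₁ := hp.mono_fst_of_mono
      refine ShortComplex.exact_of_f_is_kernel _ ?_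
      refine KernelFork.IsLimit.ofι' _ _ fun {T} k hk => ?_
      have hk' : (k ≫ c₀) ≫ a = 0 := by simpa using hk
      refine ⟨hp.lift k (hex.lift (k ≫ c₀) hk') (hex.lift_f _ _).symm, hp.lift_fst _ _ _⟩
  · rintro ⟨rfl, hm, hE⟩
    have w : c₁ ≫ c₀ ≫ a = 0 := by rw [← Category.assoc, h.d_a]
    have := hE w
    refine IsPullback.of_isLimit' ⟨(image.fac _).symm⟩ ?_
    refine PullbackCone.IsLimit.mk _ (fun s => this.lift s.fst ?_) (fun s => this.lift_f _ _)
      (fun s => ?_) (fun s m h1 _ => ?_)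
    · change s.fst ≫ c₀ ≫ a = 0
      rw [← Category.assoc, s.condition, Category.assoc, hι, comp_zero]
    · rw [← cancel_mono (image.ι (c₁ ≫ c₀)), Category.assoc, image.fac, ← Category.assoc,
        this.lift_f, s.condition]
    · rw [← cancel_mono c₁, h1, this.lift_f]

end Abelian

/-! ### Exactness and splittings of functors, tested objectwise -/

section Pointwise

/-- Evaluation functors preserve homology, and a functor with zero values is zero. -/
theorem exact_of_forall_app {J : Type u} [Category.{v} J] {E : Type w} [Category.{v} E] [Abelian E]
    (T : ShortComplex (J ⥤ E)) (h : ∀ j, (T.map ((evaluation J E).obj j)).Exact) : T.Exact := by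
  rw [ShortComplex.exact_iff_isZero_homology]
  refine Functor.isZero _ fun j => ?_
  exact ((ShortComplex.exact_iff_isZero_homology _).1 (h j)).of_iso
    (T.mapHomologyIso ((evaluation J E).obj j)).symm

variable {R : Type u} [Ring R] {M : Type u} [AddCommGroup M] [Module R M] [Module Rᵐᵒᵖ M]

theorem isElementaryExtension_iff {S : Type v} [Ring S] {B C₁ C₀ A : ModuleCat.{u} S}
    {b : B ⟶ C₁} {d : C₁ ⟶ C₀} {a : C₀ ⟶ A} :
    IsElementaryExtension b d a ↔ Function.Injective b.hom ∧
      Function.Exact b.hom d.hom ∧ Function.Exact d.hom a.hom ∧ Function.Surjective a.hom := by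
  constructor
  · intro h
    refine ⟨(ModuleCat.mono_iff_injective _).1 h.mono_b, ?_, ?_,
      (ModuleCat.epi_iff_surjective _).1 h.epi_a⟩
    · exact (ShortComplex.ShortExact.moduleCat_exact_iff_function_exact _).1 h.exact₁
    · exact (ShortComplex.ShortExact.moduleCat_exact_iff_function_exact _).1 h.exact₀
  · rintro ⟨h1, h2, h3, h4⟩
    exact
    { mono_b := (ModuleCat.mono_iff_injective _).2 h1
      b_d := by ext x; exact h2.apply_apply_eq_zero x
      d_a := by ext x; exact h3.apply_apply_eq_zero x
      exact₁ := (ShortComplex.ShortExact.moduleCat_exact_iff_function_exact _).2 h2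
      exact₀ := (ShortComplex.ShortExact.moduleCat_exact_iff_function_exact _).2 h3
      epi_a := (ModuleCat.epi_iff_surjective _).2 h4 }

/-- Splittings of a complex of modules, in terms of elements. -/
theorem isPullback_iff_of_modules {S : Type v} [Ring S] {B C₁ C₀ A : ModuleCat.{u} S}
    {b : B ⟶ C₁} {d : C₁ ⟶ C₀} {a : C₀ ⟶ A} (h : IsElementaryExtension b d a)
    {X : ModuleCat.{u} S} {c₁ : C₁ ⟶ X} {c₀ : X ⟶ C₀} :
    IsPullback c₁ (factorThruImage d) c₀ (image.ι d) ↔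
      (∀ y, c₀.hom (c₁.hom y) = d.hom y) ∧ Function.Injective c₁.hom ∧
        ∀ z, a.hom (c₀.hom z) = 0 ↔ ∃ y, c₁.hom y = z := by
  rw [h.isPullback_iff, ModuleCat.mono_iff_injective]
  constructor
  · rintro ⟨h1, h2, h3⟩
    refine ⟨fun y => congrArg (fun f => f.hom y) h1, h2, ?_⟩
    exact (ShortComplex.ShortExact.moduleCat_exact_iff_function_exact _).1
      (h3 (by rw [← Category.assoc, h1, h.d_a]))
  · rintro ⟨h1, h2, h3⟩
    refine ⟨by ext y; exact h1 y, h2, fun w => ?_⟩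
    exact (ShortComplex.ShortExact.moduleCat_exact_iff_function_exact _).2 h3

variable (φ : RingExtension R M)

theorem RingExtension.app (P : ProjCat R) :
    IsElementaryExtension (φ.b.app P) (φ.d.app P) (φ.a.app P) where
  mono_b := by
    have := φ.isElementaryExtension.mono_b
    infer_instance
  b_d := congrArg (fun τ => τ.app P) φ.isElementaryExtension.b_d
  d_a := congrArg (fun τ => τ.app P) φ.isElementaryExtension.d_a
  exact₁ := φ.isElementaryExtension.exact₁.map ((evaluation _ _).obj P)
  exact₀ := φ.isElementaryExtension.exact₀.map ((evaluation _ _).obj P)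
  epi_a := by
    have := φ.isElementaryExtension.epi_a
    infer_instance

theorem RingExtension.exact_app (P : ProjCat R) :
    Function.Injective (φ.b.app P).hom ∧ Function.Exact (φ.b.app P).hom (φ.d.app P).hom ∧
      Function.Exact (φ.d.app P).hom (φ.a.app P).hom ∧ Function.Surjective (φ.a.app P).hom :=
  isElementaryExtension_iff.1 (φ.app P)

theorem RingExtension.isElementaryExtension_forget :
    IsElementaryExtension (forgetMap φ.b) (forgetMap φ.d) (forgetMap φ.a) where
  mono_b := by
    have (P : ProjCat R) : Mono ((forgetMap φ.b).app P) :=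
      (AddCommGrpCat.mono_iff_injective _).2 (φ.exact_app P).1
    exact NatTrans.mono_of_mono_app _
  b_d := by
    ext P x
    exact (φ.exact_app P).2.1.apply_apply_eq_zero x
  d_a := by
    ext P x
    exact (φ.exact_app P).2.2.1.apply_apply_eq_zero x
  exact₁ := exact_of_forall_app _ fun P =>
    (ShortComplex.ab_exact_iff_function_exact _).2 (φ.exact_app P).2.1
  exact₀ := exact_of_forall_app _ fun P =>
    (ShortComplex.ab_exact_iff_function_exact _).2 (φ.exact_app P).2.2.1
  epi_a := by
    have (P : ProjCat R) : Epi ((forgetMap φ.a).app P) :=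
      (AddCommGrpCat.epi_iff_surjective _).2 (φ.exact_app P).2.2.2
    exact NatTrans.epi_of_epi_app _

/-- Splittings of the underlying extension of functors to abelian groups, in terms of elements. -/
theorem RingExtension.isPullback_iff {X : ProjCat R ⥤ AddCommGrpCat.{u}}
    {c₁ : forgetFun R φ.C₁ ⟶ X} {c₀ : X ⟶ forgetFun R φ.C₀} :
    IsPullback c₁ (factorThruImage (forgetMap φ.d)) c₀ (image.ι (forgetMap φ.d)) ↔
      ∀ P, (∀ y : φ.C₁.obj P, (c₀.app P).hom ((c₁.app P).hom y) = (φ.d.app P).hom y) ∧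
        Function.Injective (c₁.app P).hom ∧
        ∀ z, (φ.a.app P).hom ((c₀.app P).hom z) = 0 ↔ ∃ y, (c₁.app P).hom y = z := by
  rw [φ.isElementaryExtension_forget.isPullback_iff]
  constructor
  · rintro ⟨h1, h2, h3⟩ P
    have := h3 (by rw [← Category.assoc, h1, φ.isElementaryExtension_forget.d_a])
    exact ⟨fun y => congrArg (fun τ => (τ.app P).hom y) h1,
      (AddCommGrpCat.mono_iff_injective _).1 inferInstance,
      (ShortComplex.ab_exact_iff_function_exact _).1 (this.map ((evaluation _ _).obj P))⟩
  · intro h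
    refine ⟨?_, ?_, fun w => ?_⟩
    · ext P y
      exact (h P).1 y
    · have (P : ProjCat R) : Mono (c₁.app P) :=
        (AddCommGrpCat.mono_iff_injective _).2 (h P).2.1
      exact NatTrans.mono_of_mono_app _
    · exact exact_of_forall_app _ fun P =>
        (ShortComplex.ab_exact_iff_function_exact _).2 (h P).2.2

end Pointwise

variable {R : Type u} [Ring R]

/-! ### Natural elements of functors -/

section Elements

/-- The value at `v₁, …, vₙ : P` of the natural map `Pⁿ ⟶ X(P)` given by an element of `X(Rⁿ)`. -/
def elt {X : ProjCat R ⥤ AddCommGrpCat.{u}} {n : ℕ} (x : X.obj (ProjCat.free R n)) {P : ProjCat R}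
    (v : Fin n → P.P) : X.obj P :=
  (X.map (ProjCat.freeHom v)).hom x

variable {X Y : ProjCat R ⥤ AddCommGrpCat.{u}} {n : ℕ} (x y : X.obj (ProjCat.free R n))
  {P Q : ProjCat R}

theorem map_elt (f : P ⟶ Q) (v : Fin n → P.P) :
    (X.map f).hom (elt x v) = elt x fun i => ProjCat.lin f (v i) := by
  simp only [elt, ← ProjCat.freeHom_comp, X.map_comp]
  rfl

/-- The zero tuple is the image of a tuple in the zero module, where X vanishes. This is how
pointedness enters the argument. -/
theorem elt_zero (h : ∀ z : X.obj (ProjCat.free R 0), z = 0) : elt x (fun _ => (0 : P.P)) = 0 := by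
  have : (fun _ : Fin n => (0 : P.P)) = fun i => ProjCat.lin (ProjCat.ofLin (P := ProjCat.free R 0) 0)
      ((fun _ : Fin n => (0 : (ProjCat.free R 0).P)) i) := by simp
  rw [this, ← map_elt, h (elt x _), map_zero]

theorem IsPointed.forget_eq_zero {F : ProjCat R ⥤ ModuleCat.{u} R} (hF : IsPointed R F)
    (z : F.obj (ProjCat.free R 0)) : z = 0 := by
  have := ModuleCat.subsingleton_of_isZero (hF _ ProjCat.isZero_free_zero)
  exact Subsingleton.elim _ _

variable {M : Type u} [AddCommGroup M] [Module R M] [Module Rᵐᵒᵖ M]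

/-- Natural maps in at least two variables with values in an additive functor vanish, if they vanish
whenever one of the variables does. -/
theorem eq_zero_of_crossEffect (κ : ∀ P : ProjCat R, BalTensor R R M P.P →+ X.obj P)
    (hnat : ∀ (P Q : ProjCat R) (f : P ⟶ Q) (t : BalTensor R R M P.P),
      (X.map f).hom (κ P t) = κ Q (BalTensor.mapRight R R M (ProjCat.lin f) t))
    (hκ : ∀ P, Function.Injective (κ P)) (hn : 2 ≤ n)
    (τ : ∀ P : ProjCat R, (Fin n → P.P) → X.obj P)
    (hτ : ∀ (P Q : ProjCat R) (f : P ⟶ Q) (v : Fin n → P.P),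
      (X.map f).hom (τ P v) = τ Q fun i => ProjCat.lin f (v i))
    (hrange : ∀ P v, ∃ t, κ P t = τ P v)
    (hzero : ∀ P v i, v i = 0 → τ P v = 0) (P : ProjCat R) (v : Fin n → P.P) : τ P v = 0 := by
  -- By naturality, the standard basis of Rⁿ is the universal n-tuple.
  suffices h : τ (ProjCat.free R n) ProjCat.basis = 0 by
    have h1 := hτ _ _ (ProjCat.freeHom v) ProjCat.basis
    rw [h, map_zero] at h1
    rw [h1]
    congr 1
    ext i : 1
    exact (ProjCat.freeMap_basis v i).symm
  obtain ⟨t, ht⟩ := hrange _ (ProjCat.basis (R := R) (n := n))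
  -- These are the coordinate projectors of Rⁿ. As n ≥ 2, each of them sends some basis vector to
  -- zero, so it kills τ of the basis and hence t. Their sum is the identity and M ⊗ - is additive,
  -- so t is the sum of its projections, which is zero.
  let ε (k : Fin n) : ProjCat.free R n ⟶ ProjCat.free R n :=
    ProjCat.freeHom (Pi.single k (ProjCat.basis k))
  have hε : ∀ k i, ProjCat.lin (ε k) (ProjCat.basis i) =
      (Pi.single k (ProjCat.basis k) : Fin n → (ProjCat.free R n).P) i :=
    fun k i => ProjCat.freeMap_basis _ i
  have h1 : ∀ k, BalTensor.mapRight R R M (ProjCat.lin (ε k)) t = 0 := by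
    intro k
    apply hκ
    rw [map_zero, ← hnat, ht, hτ]
    have : Nontrivial (Fin n) := Fin.nontrivial_iff_two_le.2 hn
    obtain ⟨i, hi⟩ := exists_ne k
    exact hzero _ _ i (by rw [hε, Pi.single_eq_of_ne hi])
  have h2 : ∑ k, ProjCat.lin (ε k) = LinearMap.id := by
    refine ProjCat.free_hom_ext fun i => ?_
    simp only [LinearMap.sum_apply, hε, LinearMap.id_apply]
    rw [Finset.sum_eq_single i]
    · simp
    · intro k _ hk
      rw [Pi.single_eq_of_ne hk.symm]
    · simp
  have h3 : ∀ t : BalTensor R R M (ProjCat.free R n).P,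
      ∑ k, BalTensor.mapRight R R M (ProjCat.lin (ε k)) t = t := by
    intro t
    induction t using BalTensor.induction with
    | tmul m p =>
      simp only [BalTensor.mapRight_tmul]
      rw [← BalTensor.tmul_sum, ← LinearMap.sum_apply, h2, LinearMap.id_apply]
    | add x y hx hy => simp only [map_add, Finset.sum_add_distrib, hx, hy]
  have h4 : t = 0 := by
    rw [← h3 t]
    exact Finset.sum_eq_zero fun k _ => h1 k
  rw [← ht, h4, map_zero]

end Elements

/-! ### Extensions of abelian groups by symmetric cocycles -/

section Cocycle

/-- A normalized symmetric `2`-cocycle. -/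
structure SymmCocycle (A P : Type*) [AddCommGroup A] [AddCommGroup P] where
  c : P → P → A
  zero_left : ∀ p, c 0 p = 0
  symm : ∀ p q, c p q = c q p
  cocycle : ∀ p q r, c p q + c (p + q) r = c q r + c p (q + r)

/-- The extension of `P` by `A` defined by a cocycle. -/
@[ext]
structure SymmCocycle.Ext {A P : Type*} [AddCommGroup A] [AddCommGroup P]
    (c : SymmCocycle A P) where
  fst : A
  snd : P

namespace SymmCocycle.Ext

variable {A P : Type*} [AddCommGroup A] [AddCommGroup P] {c : SymmCocycle A P}

/-- The minus sign makes (x, p) ↦ d x + s p additive when d (c p q) = s (p + q) - s p - s q. -/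
instance : Add c.Ext := ⟨fun x y => ⟨x.fst + y.fst - c.c x.snd y.snd, x.snd + y.snd⟩⟩
instance : Zero c.Ext := ⟨⟨0, 0⟩⟩
instance : Neg c.Ext := ⟨fun x => ⟨-x.fst + c.c x.snd (-x.snd), -x.snd⟩⟩

@[simp] theorem add_fst (x y : c.Ext) : (x + y).fst = x.fst + y.fst - c.c x.snd y.snd := rfl
@[simp] theorem add_snd (x y : c.Ext) : (x + y).snd = x.snd + y.snd := rfl
@[simp] theorem zero_fst : (0 : c.Ext).fst = 0 := rfl
@[simp] theorem zero_snd : (0 : c.Ext).snd = 0 := rfl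
@[simp] theorem neg_fst (x : c.Ext) : (-x).fst = -x.fst + c.c x.snd (-x.snd) := rfl
@[simp] theorem neg_snd (x : c.Ext) : (-x).snd = -x.snd := rfl

instance : AddCommGroup c.Ext :=
  { AddGroup.ofLeftAxioms (G := c.Ext)
      (fun x y z => by
        ext
        · have := c.cocycle x.snd y.snd z.snd
          simp only [add_fst, add_snd]
          rw [← sub_eq_zero] at this ⊢
          rw [← neg_eq_zero, ← this]
          abel
        · simp [add_assoc])
      (fun x => by ext <;> simp [c.zero_left])
      (fun x => by
        ext
        · simp [c.symm (-x.snd)]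
        · simp) with
    add_comm := fun x y => by
      ext
      · simp [c.symm x.snd, add_comm]
      · simp [add_comm] }

end SymmCocycle.Ext

end Cocycle

/-! ### The maps of an elementary extension in terms of elements -/

variable {M : Type u} [AddCommGroup M] [Module R M] [Module Rᵐᵒᵖ M]

namespace RingExtension

variable (φ : RingExtension R M)

/-- The map `b : M ⊗_R P ⟶ C₁(P)`. -/
def bHom (P : ProjCat R) : BalTensor R R M P.P →ₗ[R] φ.C₁.obj P := (φ.b.app P).hom

/-- The map `d : C₁(P) ⟶ C₀(P)`. -/
def dHom (P : ProjCat R) : φ.C₁.obj P →ₗ[R] φ.C₀.obj P := (φ.d.app P).hom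

/-- The map `a : C₀(P) ⟶ P`. -/
def aHom (P : ProjCat R) : φ.C₀.obj P →ₗ[R] P.P := (φ.a.app P).hom

variable {φ} {P Q : ProjCat R}

theorem bHom_injective : Function.Injective (φ.bHom P) := (φ.exact_app P).1

theorem exact_bHom_dHom : Function.Exact (φ.bHom P) (φ.dHom P) := (φ.exact_app P).2.1

theorem exact_dHom_aHom : Function.Exact (φ.dHom P) (φ.aHom P) := (φ.exact_app P).2.2.1

theorem aHom_surjective : Function.Surjective (φ.aHom P) := (φ.exact_app P).2.2.2

@[simp]
theorem dHom_bHom (t : BalTensor R R M P.P) : φ.dHom P (φ.bHom P t) = 0 :=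
  exact_bHom_dHom.apply_apply_eq_zero t

@[simp]
theorem aHom_dHom (y : φ.C₁.obj P) : φ.aHom P (φ.dHom P y) = 0 :=
  exact_dHom_aHom.apply_apply_eq_zero y

theorem map_bHom (f : P ⟶ Q) (t : BalTensor R R M P.P) :
    (φ.C₁.map f).hom (φ.bHom P t) = φ.bHom Q (BalTensor.mapRight R R M (ProjCat.lin f) t) :=
  (congrArg (fun g => g.hom t) (φ.b.naturality f)).symm

theorem map_dHom (f : P ⟶ Q) (y : φ.C₁.obj P) :
    (φ.C₀.map f).hom (φ.dHom P y) = φ.dHom Q ((φ.C₁.map f).hom y) :=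
  (congrArg (fun g => g.hom y) (φ.d.naturality f)).symm

theorem aHom_map (f : P ⟶ Q) (y : φ.C₀.obj P) :
    φ.aHom Q ((φ.C₀.map f).hom y) = ProjCat.lin f (φ.aHom P y) :=
  congrArg (fun g => g.hom y) (φ.a.naturality f)

theorem aHom_elt {n : ℕ} (x : φ.C₀.obj (ProjCat.free R n)) (v : Fin n → P.P) :
    φ.aHom P (elt (X := forgetFun R φ.C₀) x v) = ProjCat.freeMap v (φ.aHom _ x) :=
  aHom_map _ _

end RingExtension

/-! ### Existence of splittings of abelian-group-valued functors -/

section Existence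

open RingExtension

variable (φ : RingExtension R M)

/-- A natural normalized symmetric cocycle with values in `C₁` together with a natural section of
`a : C₀ ⟶ I` whose coboundary it lifts. -/
structure NaturalCocycle where
  s : ∀ P : ProjCat R, P.P → φ.C₀.obj P
  map_s : ∀ (P Q : ProjCat R) (f : P ⟶ Q) (p : P.P),
    (φ.C₀.map f).hom (s P p) = s Q (ProjCat.lin f p)
  aHom_s : ∀ (P : ProjCat R) (p : P.P), φ.aHom P (s P p) = p
  s_zero : ∀ P : ProjCat R, s P 0 = 0
  c : ∀ P : ProjCat R, SymmCocycle (φ.C₁.obj P) P.P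
  map_c : ∀ (P Q : ProjCat R) (f : P ⟶ Q) (p q : P.P),
    (φ.C₁.map f).hom ((c P).c p q) = (c Q).c (ProjCat.lin f p) (ProjCat.lin f q)
  dHom_c : ∀ (P : ProjCat R) (p q : P.P), φ.dHom P ((c P).c p q) = s P (p + q) - s P p - s P q

/-- Everything is chosen once on a universal tuple in a free module and transported by naturality.
The identities of a symmetric cocycle then hold because their defects are cross effects with values
in I(M). -/
theorem exists_naturalCocycle : Nonempty (NaturalCocycle φ) := by
  obtain ⟨x, hx⟩ := aHom_surjective (φ := φ) (ProjCat.basis (R := R) (n := 1) 0)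
  let s (P : ProjCat R) (p : P.P) : φ.C₀.obj P := elt (X := forgetFun R φ.C₀) x fun _ => p
  have map_s : ∀ (P Q : ProjCat R) (f : P ⟶ Q) (p : P.P),
      (φ.C₀.map f).hom (s P p) = s Q (ProjCat.lin f p) := fun P Q f p =>
    map_elt (X := forgetFun R φ.C₀) x f fun _ => p
  have aHom_s : ∀ (P : ProjCat R) (p : P.P), φ.aHom P (s P p) = p := fun P p => by
    simp only [s, aHom_elt, hx, ProjCat.freeMap_basis]
  have s_zero : ∀ P : ProjCat R, s P 0 = 0 := fun P =>
    elt_zero (X := forgetFun R φ.C₀) x φ.pointed₀.forget_eq_zero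
  -- The defect of s on the universal pair (e₀, e₁) is killed by a, which is additive and splits s,
  -- so it lifts along d.
  obtain ⟨g, hg⟩ := (exact_dHom_aHom (φ := φ) (P := ProjCat.free R 2)
    (s _ (ProjCat.basis 0 + ProjCat.basis 1) - s _ (ProjCat.basis 0) - s _ (ProjCat.basis 1))).1 (by
      simp [aHom_s])
  let γ (P : ProjCat R) (p q : P.P) : φ.C₁.obj P := elt (X := forgetFun R φ.C₁) g ![p, q]
  have map_γ : ∀ (P Q : ProjCat R) (f : P ⟶ Q) (p q : P.P),
      (φ.C₁.map f).hom (γ P p q) = γ Q (ProjCat.lin f p) (ProjCat.lin f q) := fun P Q f p q => by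
    refine (map_elt (X := forgetFun R φ.C₁) g f ![p, q]).trans ?_
    congr 1
    ext i : 1
    fin_cases i <;> rfl
  have dHom_γ : ∀ (P : ProjCat R) (p q : P.P),
      φ.dHom P (γ P p q) = s P (p + q) - s P p - s P q := fun P p q => by
    have h := (map_dHom (ProjCat.freeHom ![p, q]) g).symm
    rw [hg, map_sub, map_sub, map_s, map_s, map_s, map_add] at h
    have h0 : ProjCat.lin (ProjCat.freeHom ![p, q]) (ProjCat.basis 0) = p :=
      ProjCat.freeMap_basis _ 0
    have h1 : ProjCat.lin (ProjCat.freeHom ![p, q]) (ProjCat.basis 1) = q :=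
      ProjCat.freeMap_basis _ 1
    rw [h0, h1] at h
    exact h
  have γ_zero : ∀ P : ProjCat R, γ P 0 0 = 0 := fun P => by
    have := elt_zero (X := forgetFun R φ.C₁) g φ.pointed₁.forget_eq_zero (P := P)
    rw [← this]
    simp only [γ]
    congr 1
    ext i : 1
    fin_cases i <;> rfl
  -- Normalization does not change the image under d, because s 0 = 0 makes the subtracted terms lie
  -- in Ker d. The result vanishes when either variable is zero, because γ 0 0 = 0.
  let c (P : ProjCat R) (p q : P.P) : φ.C₁.obj P := γ P p q - γ P p 0 - γ P 0 q
  have map_c : ∀ (P Q : ProjCat R) (f : P ⟶ Q) (p q : P.P),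
      (φ.C₁.map f).hom (c P p q) = c Q (ProjCat.lin f p) (ProjCat.lin f q) := fun P Q f p q => by
    simp only [c, map_sub, map_γ, map_zero]
  have dHom_c : ∀ (P : ProjCat R) (p q : P.P),
      φ.dHom P (c P p q) = s P (p + q) - s P p - s P q := fun P p q => by
    simp [c, dHom_γ, s_zero]
  have zero_c : ∀ (P : ProjCat R) (p : P.P), c P 0 p = 0 := fun P p => by simp [c, γ_zero]
  have c_zero : ∀ (P : ProjCat R) (p : P.P), c P p 0 = 0 := fun P p => by simp [c, γ_zero]
  clear_value c
  -- Used with two variables for symmetry and with three for the cocycle identity. In both cases d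
  -- kills the defect, as the expressions in s cancel.
  have vanish := fun {n : ℕ} (hn : 2 ≤ n) τ => eq_zero_of_crossEffect (X := forgetFun R φ.C₁)
    (fun P => (φ.bHom P).toAddMonoidHom) (fun _ _ f t => map_bHom f t) (fun P => bHom_injective) hn τ
  have symm : ∀ (P : ProjCat R) (p q : P.P), c P p q = c P q p := fun P p q => by
    refine sub_eq_zero.1 (vanish le_rfl (fun P v => (c P (v 0) (v 1) - c P (v 1) (v 0) : φ.C₁.obj P))
      ?_ ?_ ?_ P ![p, q])
    · intro P Q f v
      refine (map_sub (φ.C₁.map f).hom _ _).trans ?_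
      rw [map_c, map_c]
    · intro P v
      refine (exact_bHom_dHom (φ := φ) _).1 ?_
      rw [map_sub, dHom_c, dHom_c, add_comm (v 0)]
      abel
    · intro P v i hi
      fin_cases i
      · have h : v 0 = 0 := hi
        simp only [h, zero_c, c_zero, sub_zero]
      · have h : v 1 = 0 := hi
        simp only [h, zero_c, c_zero, sub_zero]
  have cocycle : ∀ (P : ProjCat R) (p q r : P.P),
      c P p q + c P (p + q) r = c P q r + c P p (q + r) := fun P p q r => by
    refine sub_eq_zero.1 (vanish (n := 3) (by norm_num)
      (fun P v => (c P (v 0) (v 1) + c P (v 0 + v 1) (v 2) -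
        (c P (v 1) (v 2) + c P (v 0) (v 1 + v 2)) : φ.C₁.obj P)) ?_ ?_ ?_ P ![p, q, r])
    · intro P Q f v
      refine (map_sub (φ.C₁.map f).hom _ _).trans ?_
      simp only [map_add, map_c]
    · intro P v
      refine (exact_bHom_dHom (φ := φ) _).1 ?_
      simp only [map_sub, map_add, dHom_c, add_assoc]
      abel
    · intro P v i hi
      fin_cases i
      · have h : v 0 = 0 := hi
        simp only [h, zero_c, zero_add, add_zero, sub_self]
      · have h : v 1 = 0 := hi
        simp only [h, zero_c, c_zero, zero_add, add_zero, sub_self]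
      · have h : v 2 = 0 := hi
        simp only [h, c_zero, zero_add, add_zero, sub_self]
  exact ⟨⟨s, map_s, aHom_s, s_zero, fun P => ⟨c P, zero_c P, symm P, cocycle P⟩, map_c, dHom_c⟩⟩

variable {φ}

/-- The functor to abelian groups defined by a natural cocycle. -/
def NaturalCocycle.functor (κ : NaturalCocycle φ) : ProjCat R ⥤ AddCommGrpCat.{u} where
  obj P := AddCommGrpCat.of (κ.c P).Ext
  map {P Q} f := AddCommGrpCat.ofHom (AddMonoidHom.mk'
    (fun x => (⟨(φ.C₁.map f).hom x.fst, ProjCat.lin f x.snd⟩ : (κ.c Q).Ext)) fun x y => by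
      ext
      · simp [κ.map_c]
      · simp)
  map_id P := by
    ext x
    · exact congrArg (fun f => f.hom (SymmCocycle.Ext.fst x)) (φ.C₁.map_id P)
    · rfl
  map_comp {P Q T} f g := by
    ext x
    · exact congrArg (fun h => h.hom (SymmCocycle.Ext.fst x)) (φ.C₁.map_comp f g)
    · rfl

/-- The map to `C₀` from the functor defined by a natural cocycle. -/
def NaturalCocycle.toC₀ (κ : NaturalCocycle φ) (P : ProjCat R) : (κ.c P).Ext →+ φ.C₀.obj P :=
  AddMonoidHom.mk' (fun x => φ.dHom P x.fst + κ.s P x.snd) fun x y => by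
    simp only [SymmCocycle.Ext.add_fst, SymmCocycle.Ext.add_snd, map_sub, map_add, κ.dHom_c]
    abel

theorem NaturalCocycle.toC₀_surjective (κ : NaturalCocycle φ) (P : ProjCat R) :
    Function.Surjective (κ.toC₀ P) := fun x => by
  obtain ⟨y, hy⟩ := (exact_dHom_aHom (x - κ.s P (φ.aHom P x))).1 (by
    rw [map_sub, κ.aHom_s, sub_self])
  exact ⟨⟨y, φ.aHom P x⟩, by simp [toC₀, hy]⟩

/-- The splitting defined by a natural cocycle. -/
def NaturalCocycle.splitting (κ : NaturalCocycle φ) : φ.AbSplitting where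
  obj := κ.functor
  c₁ :=
    { app := fun P => AddCommGrpCat.ofHom (AddMonoidHom.mk'
        (fun y : φ.C₁.obj P => (⟨y, 0⟩ : (κ.c P).Ext)) fun y z => by
          ext <;> simp [(κ.c P).zero_left])
      naturality := fun P Q f => by
        ext y
        exact SymmCocycle.Ext.ext rfl (map_zero (ProjCat.lin f)).symm }
  c₀ :=
    { app := fun P => AddCommGrpCat.ofHom (κ.toC₀ P)
      naturality := fun P Q f => by
        ext x
        change φ.dHom Q ((φ.C₁.map f).hom x.fst) + κ.s Q (ProjCat.lin f x.snd) =
          (φ.C₀.map f).hom (φ.dHom P x.fst + κ.s P x.snd)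
        rw [map_add, map_dHom, κ.map_s] }
  isPullback := by
    refine φ.isPullback_iff.2 fun P => ⟨fun y => ?_, fun y z h => ?_, fun x => ⟨fun h => ?_, ?_⟩⟩
    · change φ.dHom P y + κ.s P 0 = φ.dHom P y
      rw [κ.s_zero, add_zero]
    · exact congrArg (fun x : (κ.c P).Ext => x.fst) h
    · change (κ.c P).Ext at x
      change φ.aHom P (φ.dHom P x.fst + κ.s P x.snd) = 0 at h
      rw [map_add, aHom_dHom, zero_add, κ.aHom_s] at h
      exact ⟨x.fst, SymmCocycle.Ext.ext rfl h.symm⟩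
    · rintro ⟨y, rfl⟩
      change φ.aHom P (φ.dHom P y + κ.s P 0) = 0
      rw [κ.s_zero, add_zero, aHom_dHom]
  epi_c₀ := by
    have (P : ProjCat R) :=
      (AddCommGrpCat.epi_iff_surjective (AddCommGrpCat.ofHom (κ.toC₀ P))).2 (κ.toC₀_surjective P)
    exact (NatTrans.epi_iff_epi_app _).2 this

theorem nonempty_abSplitting (φ : RingExtension R M) : Nonempty φ.AbSplitting :=
  (exists_naturalCocycle φ).map fun κ => κ.splitting

end Existence

variable {R : Type u} [Ring R] {M : Type u} [AddCommGroup M] [Module R M] [Module Rᵐᵒᵖ M]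

namespace RingExtension

variable {φ : RingExtension R M} (σ : φ.AbSplitting)

/-! ### Splittings in terms of elements -/

/-- The map `c₁ : C₁(P) ⟶ C₀₁(P)`. -/
def c₁Hom (P : ProjCat R) : φ.C₁.obj P →+ σ.obj.obj P := (σ.c₁.app P).hom

/-- The map `c₀ : C₀₁(P) ⟶ C₀(P)`. -/
def c₀Hom (P : ProjCat R) : σ.obj.obj P →+ φ.C₀.obj P := (σ.c₀.app P).hom

/-- The map `C₀₁(P) ⟶ P`. -/
def augHom (P : ProjCat R) : σ.obj.obj P →+ P.P := (φ.aHom P).toAddMonoidHom.comp (c₀Hom σ P)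

variable {σ} {P Q : ProjCat R}

theorem aHom_c₀Hom (z : σ.obj.obj P) : φ.aHom P (c₀Hom σ P z) = augHom σ P z := rfl

@[simp]
theorem c₀Hom_c₁Hom (y : φ.C₁.obj P) : c₀Hom σ P (c₁Hom σ P y) = φ.dHom P y :=
  (φ.isPullback_iff.1 σ.isPullback P).1 y

theorem c₁Hom_injective : Function.Injective (c₁Hom σ P) :=
  (φ.isPullback_iff.1 σ.isPullback P).2.1

theorem augHom_eq_zero_iff (z : σ.obj.obj P) : augHom σ P z = 0 ↔ ∃ y, c₁Hom σ P y = z :=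
  (φ.isPullback_iff.1 σ.isPullback P).2.2 z

@[simp]
theorem augHom_c₁Hom (y : φ.C₁.obj P) : augHom σ P (c₁Hom σ P y) = 0 :=
  (augHom_eq_zero_iff _).2 ⟨y, rfl⟩

theorem c₀Hom_surjective : Function.Surjective (c₀Hom σ P) := by
  have := σ.epi_c₀
  exact (AddCommGrpCat.epi_iff_surjective (σ.c₀.app P)).1 inferInstance

theorem augHom_surjective : Function.Surjective (augHom σ P) :=
  aHom_surjective.comp c₀Hom_surjective

theorem c₀Hom_eq_zero {z : σ.obj.obj P} (hz : c₀Hom σ P z = 0) :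
    ∃ t, c₁Hom σ P (φ.bHom P t) = z := by
  obtain ⟨y, rfl⟩ := (augHom_eq_zero_iff z).1 (by rw [← aHom_c₀Hom, hz, map_zero])
  rw [c₀Hom_c₁Hom] at hz
  obtain ⟨t, rfl⟩ := (exact_bHom_dHom y).1 hz
  exact ⟨t, rfl⟩

theorem map_c₁Hom (f : P ⟶ Q) (y : φ.C₁.obj P) :
    (σ.obj.map f).hom (c₁Hom σ P y) = c₁Hom σ Q ((φ.C₁.map f).hom y) :=
  (congrArg (fun g => g.hom y) (σ.c₁.naturality f)).symm

theorem map_c₀Hom (f : P ⟶ Q) (z : σ.obj.obj P) :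
    (φ.C₀.map f).hom (c₀Hom σ P z) = c₀Hom σ Q ((σ.obj.map f).hom z) :=
  (congrArg (fun g => g.hom z) (σ.c₀.naturality f)).symm

theorem augHom_map (f : P ⟶ Q) (z : σ.obj.obj P) :
    augHom σ Q ((σ.obj.map f).hom z) = ProjCat.lin f (augHom σ P z) := by
  rw [← aHom_c₀Hom, ← map_c₀Hom, aHom_map, aHom_c₀Hom]

theorem eq_zero_of_free_zero (z : σ.obj.obj (ProjCat.free R 0)) : z = 0 := by
  obtain ⟨y, rfl⟩ := (augHom_eq_zero_iff z).1 (by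
    have h : c₀Hom σ _ z = 0 := φ.pointed₀.forget_eq_zero _
    rw [← aHom_c₀Hom, h, map_zero])
  rw [φ.pointed₁.forget_eq_zero y, map_zero]

theorem augHom_elt {n : ℕ} (z : σ.obj.obj (ProjCat.free R n)) (v : Fin n → P.P) :
    augHom σ P (elt z v) = ProjCat.freeMap v (augHom σ _ z) := augHom_map _ _

theorem map_c₁Hom_bHom (f : P ⟶ Q) (t : BalTensor R R M P.P) :
    (σ.obj.map f).hom (c₁Hom σ P (φ.bHom P t)) =
      c₁Hom σ Q (φ.bHom Q (BalTensor.mapRight R R M (ProjCat.lin f) t)) := by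
  rw [map_c₁Hom, map_bHom]

/-- Every element of `C₀₁(P)` differs from a value of a natural section by an element of `C₁(P)`. -/
theorem exists_eq_add_elt {z₀ : σ.obj.obj (ProjCat.free R 1)}
    (hz₀ : augHom σ _ z₀ = ProjCat.basis 0) (z : σ.obj.obj P) :
    ∃ y, z = c₁Hom σ P y + elt z₀ fun _ => augHom σ P z := by
  obtain ⟨y, hy⟩ := (augHom_eq_zero_iff (z - elt z₀ fun _ => augHom σ P z)).1 (by
    rw [map_sub, augHom_elt, hz₀, ProjCat.freeMap_basis, sub_self])
  exact ⟨y, by rw [hy, sub_add_cancel]⟩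

/-! ### Regular endomorphisms in terms of elements -/

variable (σ) in
/-- The action of an endomorphism on the elements of `C₀₁(P)`. -/
def endHom (x : End σ.obj) (P : ProjCat R) : σ.obj.obj P →+ σ.obj.obj P := (x.app P).hom

theorem endHom_ext {x y : End σ.obj} (h : ∀ P z, endHom σ x P z = endHom σ y P z) : x = y :=
  NatTrans.ext (funext fun P => AddCommGrpCat.hom_ext (AddMonoidHom.ext (h P)))

theorem endHom_map (x : End σ.obj) (f : P ⟶ Q) (z : σ.obj.obj P) :
    (σ.obj.map f).hom (endHom σ x P z) = endHom σ x Q ((σ.obj.map f).hom z) :=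
  (congrArg (fun g => g.hom z) (x.naturality f)).symm

theorem isRegularOver_iff {x : End σ.obj} {r : R} : IsRegularOver σ x r ↔
    ∀ P, (∀ y, endHom σ x P (c₁Hom σ P y) = c₁Hom σ P (r • y)) ∧
      ∀ z, c₀Hom σ P (endHom σ x P z) = r • c₀Hom σ P z := by
  constructor
  · rintro ⟨h1, h2⟩ P
    exact ⟨fun y => congrArg (fun τ => (τ.app P).hom y) h1,
      fun z => congrArg (fun τ => (τ.app P).hom z) h2⟩
  · intro h
    constructor
    · ext P y
      exact (h P).1 y
    · ext P z
      exact (h P).2 z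

theorem endHom_c₁Hom (x : regularEnd σ) (y : φ.C₁.obj P) :
    endHom σ x P (c₁Hom σ P y) = c₁Hom σ P (proj σ x • y) :=
  (isRegularOver_iff.1 (isRegularOver_proj σ x) P).1 y

theorem c₀Hom_endHom (x : regularEnd σ) (z : σ.obj.obj P) :
    c₀Hom σ P (endHom σ x P z) = proj σ x • c₀Hom σ P z :=
  (isRegularOver_iff.1 (isRegularOver_proj σ x) P).2 z

theorem augHom_endHom (x : regularEnd σ) (z : σ.obj.obj P) :
    augHom σ P (endHom σ x P z) = proj σ x • augHom σ P z := by
  rw [← aHom_c₀Hom, c₀Hom_endHom, map_smul, aHom_c₀Hom]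

theorem proj_eq {x : regularEnd σ} {r : R} (h : IsRegularOver σ (x : End σ.obj) r) :
    proj σ x = r := (isRegularOver_proj σ x).unique h

/-! ### The square-zero extension -/

variable (σ) in
/-- The endomorphism of `C₀₁` given by an element of `M`. -/
def ofBimodule (m : M) : End σ.obj :=
  σ.c₀ ≫ forgetMap φ.a ≫ tensorElement R m ≫ forgetMap φ.b ≫ σ.c₁

theorem endHom_ofBimodule (m : M) (z : σ.obj.obj P) :
    endHom σ (ofBimodule σ m) P z =
      c₁Hom σ P (φ.bHom P (BalTensor.tmul R R m (augHom σ P z))) := rfl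

theorem isRegularOver_ofBimodule (m : M) : IsRegularOver σ (ofBimodule σ m) 0 := by
  refine isRegularOver_iff.2 fun P => ⟨fun y => ?_, fun z => ?_⟩
  · rw [endHom_ofBimodule, augHom_c₁Hom, BalTensor.tmul_zero, map_zero, zero_smul]
  · rw [endHom_ofBimodule, c₀Hom_c₁Hom, dHom_bHom, zero_smul]

variable (σ) in
/-- The inclusion `i : M ⟶ R'`. -/
def inclusion : M →+ regularEnd σ :=
  AddMonoidHom.mk' (fun m => ⟨ofBimodule σ m, 0, isRegularOver_ofBimodule m⟩) fun m m' => by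
    refine Subtype.ext (endHom_ext fun P z => ?_)
    refine (endHom_ofBimodule (m + m') z).trans ?_
    rw [BalTensor.add_tmul, map_add, map_add]
    rfl

theorem endHom_inclusion (m : M) (z : σ.obj.obj P) :
    endHom σ (inclusion σ m) P z =
      c₁Hom σ P (φ.bHom P (BalTensor.tmul R R m (augHom σ P z))) := rfl

theorem proj_inclusion (m : M) : proj σ (inclusion σ m) = 0 :=
  proj_eq (isRegularOver_ofBimodule m)

theorem exists_tmul_basis (t : BalTensor R R M (ProjCat.free R 1).P) :
    ∃ m, t = BalTensor.tmul R R m (ProjCat.basis 0) := by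
  induction t using BalTensor.induction with
  | tmul m p =>
    refine ⟨op (ProjCat.freeEquiv R 1 p 0) • m, ?_⟩
    rw [BalTensor.op_smul_tmul]
    congr 1
    apply (ProjCat.freeEquiv R 1).injective
    ext i
    rw [Subsingleton.elim i 0]
    simp [ProjCat.basis]
  | add x y hx hy =>
    obtain ⟨m, rfl⟩ := hx
    obtain ⟨m', rfl⟩ := hy
    exact ⟨m + m', (BalTensor.add_tmul _ _ _).symm⟩

theorem tmul_basis_injective [SMulCommClass R Rᵐᵒᵖ M] {m : M}
    (h : BalTensor.tmul R R m (ProjCat.basis (R := R) (n := 1) 0) = 0) : m = 0 := by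
  let f : BalTensor R R M (ProjCat.free R 1).P →+ M := BalTensor.lift
    (AddMonoidHom.mk' (fun m => AddMonoidHom.mk' (fun c => op (ProjCat.freeEquiv R 1 c 0) • m)
      fun c c' => by simp [add_smul]) fun m m' => by
      ext
      simp)
    (fun r m c => by simp [mul_smul])
  have := congrArg f h
  simpa [f, ProjCat.basis] using this

/-- On a lift to C₀₁(R) of the generator of R, the endomorphism given by m takes the value m ⊗ e₀,
seen through the injective maps b and c₁. -/
theorem inclusion_injective [SMulCommClass R Rᵐᵒᵖ M] : Function.Injective (inclusion σ) := by
  rw [injective_iff_map_eq_zero]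
  intro m hm
  obtain ⟨z, hz⟩ := augHom_surjective (σ := σ) (ProjCat.basis (R := R) (n := 1) 0)
  have h := endHom_inclusion (σ := σ) m z
  rw [hm, hz] at h
  refine tmul_basis_injective (bHom_injective (c₁Hom_injective (h.symm.trans ?_)))
  rw [map_zero, map_zero]
  rfl

/-- An endomorphism over 0 kills C₁, so it is determined by its value on a lift z₀ of the generator
of R. That value is killed by c₀, so it lies in M ⊗ R and has the form m ⊗ e₀. -/
theorem exists_inclusion_eq {x : regularEnd σ} (hx : proj σ x = 0) : ∃ m, inclusion σ m = x := by
  obtain ⟨z₀, hz₀⟩ := augHom_surjective (σ := σ) (ProjCat.basis (R := R) (n := 1) 0)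
  obtain ⟨t, ht⟩ := c₀Hom_eq_zero (z := endHom σ x _ z₀) (by rw [c₀Hom_endHom, hx, zero_smul])
  obtain ⟨m, rfl⟩ := exists_tmul_basis t
  refine ⟨m, Subtype.ext (endHom_ext fun P z => ?_)⟩
  rw [endHom_inclusion]
  obtain ⟨y, hy⟩ := exists_eq_add_elt hz₀ z
  conv_rhs => rw [hy]
  rw [map_add, endHom_c₁Hom, hx, zero_smul, map_zero, zero_add, elt, ← endHom_map, ← ht,
    map_c₁Hom_bHom, BalTensor.mapRight_tmul]
  congr 3
  exact (ProjCat.freeMap_basis (R := R) (fun _ => augHom σ P z) 0).symm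

/-- The endomorphism must be r on C₁, so only its values on a natural section s of C₀₁ → I remain to
be chosen. Any natural choice t compatible with c₀ turns out to be additive, again by the vanishing
of cross effects. -/
theorem exists_isRegularOver (r : R) : ∃ x : End σ.obj, IsRegularOver σ x r := by
  obtain ⟨z₀, hz₀⟩ := augHom_surjective (σ := σ) (ProjCat.basis (R := R) (n := 1) 0)
  -- Here t₀ is the value prescribed on z₀; that c₀ is an epimorphism is what allows it.
  obtain ⟨t₀, ht₀⟩ := c₀Hom_surjective (σ := σ) (r • c₀Hom σ _ z₀)
  let s (P : ProjCat R) (p : P.P) : σ.obj.obj P := elt z₀ fun _ => p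
  let t (P : ProjCat R) (p : P.P) : σ.obj.obj P := elt t₀ fun _ => p
  have map_s : ∀ (P Q : ProjCat R) (f : P ⟶ Q) (p : P.P),
      (σ.obj.map f).hom (s P p) = s Q (ProjCat.lin f p) := fun P Q f p => map_elt z₀ f fun _ => p
  have map_t : ∀ (P Q : ProjCat R) (f : P ⟶ Q) (p : P.P),
      (σ.obj.map f).hom (t P p) = t Q (ProjCat.lin f p) := fun P Q f p => map_elt t₀ f fun _ => p
  have aug_s : ∀ (P : ProjCat R) (p : P.P), augHom σ P (s P p) = p := fun P p => by
    rw [augHom_elt, hz₀, ProjCat.freeMap_basis]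
  have s_zero : ∀ P : ProjCat R, s P 0 = 0 := fun P => elt_zero z₀ eq_zero_of_free_zero
  have t_zero : ∀ P : ProjCat R, t P 0 = 0 := fun P => elt_zero t₀ eq_zero_of_free_zero
  have c₀_t : ∀ (P : ProjCat R) (p : P.P), c₀Hom σ P (t P p) = r • c₀Hom σ P (s P p) :=
    fun P p => by
      simp only [s, t, elt]
      rw [← map_c₀Hom, ← map_c₀Hom, ht₀, map_smul]
  have hy : ∀ (P : ProjCat R) (z : σ.obj.obj P),
      ∃ y, z = c₁Hom σ P y + s P (augHom σ P z) := fun P z => exists_eq_add_elt hz₀ z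
  clear_value s t
  have hγ : ∀ (P : ProjCat R) (v : Fin 2 → P.P),
      ∃ y, c₁Hom σ P y = s P (v 0) + s P (v 1) - s P (v 0 + v 1) := fun P v =>
    (augHom_eq_zero_iff _).1 (by simp [aug_s])
  choose γ hγ using hγ
  -- The additivity defect of t is r times that of s. The difference of the two is killed by c₀, so
  -- it lies in M ⊗ P, and it vanishes when either variable is zero.
  have key : ∀ (P : ProjCat R) (v : Fin 2 → P.P),
      c₁Hom σ P (r • γ P v) - (t P (v 0) + t P (v 1) - t P (v 0 + v 1)) = 0 := by
    refine eq_zero_of_crossEffect (X := σ.obj)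
      (fun P => (c₁Hom σ P).comp (φ.bHom P).toAddMonoidHom) (fun _ _ f t => map_c₁Hom_bHom f t)
      (fun P => c₁Hom_injective.comp bHom_injective) le_rfl _ ?_ ?_ ?_
    · intro P Q f v
      have h : (φ.C₁.map f).hom (γ P v) = γ Q fun i => ProjCat.lin f (v i) := by
        apply c₁Hom_injective (σ := σ)
        rw [← map_c₁Hom, hγ, hγ]
        simp only [map_sub, map_add, map_s]
      rw [map_sub, map_c₁Hom, map_smul, h]
      simp only [map_sub, map_add, map_t]
    · intro P v
      refine c₀Hom_eq_zero ?_
      have h := congrArg (c₀Hom σ P) (hγ P v)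
      rw [c₀Hom_c₁Hom] at h
      rw [map_sub, c₀Hom_c₁Hom, map_smul, h]
      simp only [map_sub, map_add, c₀_t, smul_sub, smul_add, sub_self]
    · intro P v i hi
      have h : γ P v = 0 := by
        apply c₁Hom_injective (σ := σ)
        rw [hγ, map_zero]
        fin_cases i
        · have h : v 0 = 0 := hi
          rw [h, s_zero, zero_add, zero_add, sub_self]
        · have h : v 1 = 0 := hi
          rw [h, s_zero, add_zero, add_zero, sub_self]
      rw [h, smul_zero, map_zero, zero_sub, neg_eq_zero]
      fin_cases i
      · have h : v 0 = 0 := hi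
        rw [h, t_zero, zero_add, zero_add, sub_self]
      · have h : v 1 = 0 := hi
        rw [h, t_zero, add_zero, add_zero, sub_self]
  choose y hy using hy
  -- The element y P z is the component in C₁ of z relative to s. It is additive up to the defect γ,
  -- and `key` matches that defect with the one of t.
  let f (P : ProjCat R) : σ.obj.obj P →+ σ.obj.obj P :=
    AddMonoidHom.mk' (fun z => c₁Hom σ P (r • y P z) + t P (augHom σ P z)) fun z z' => by
      have h : y P (z + z') = y P z + y P z' + γ P ![augHom σ P z, augHom σ P z'] := by
        apply c₁Hom_injective (σ := σ)
        have h1 := hy P (z + z')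
        conv_lhs at h1 => rw [hy P z, hy P z']
        rw [map_add, map_add, hγ, ← sub_eq_zero]
        rw [← sub_eq_zero] at h1
        rw [← neg_eq_zero, ← h1]
        simp only [map_add, Matrix.cons_val_zero, Matrix.cons_val_one]
        abel
      have h2 := key P ![augHom σ P z, augHom σ P z']
      simp only [Matrix.cons_val_zero, Matrix.cons_val_one] at h2
      rw [h, smul_add, smul_add, map_add, map_add, sub_eq_zero.1 h2, map_add]
      abel
  refine ⟨{ app := fun P => AddCommGrpCat.ofHom (f P), naturality := fun P Q g => ?_ },
    isRegularOver_iff.2 fun P => ⟨fun w => ?_, fun z => ?_⟩⟩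
  · ext z
    change c₁Hom σ Q (r • y Q ((σ.obj.map g).hom z)) + t Q (augHom σ Q ((σ.obj.map g).hom z)) =
      (σ.obj.map g).hom (c₁Hom σ P (r • y P z) + t P (augHom σ P z))
    have h : y Q ((σ.obj.map g).hom z) = (φ.C₁.map g).hom (y P z) := by
      apply c₁Hom_injective (σ := σ)
      have h1 := hy Q ((σ.obj.map g).hom z)
      conv_lhs at h1 => rw [hy P z]
      rw [map_add, map_c₁Hom, map_s, augHom_map] at h1
      exact (add_right_cancel h1).symm
    rw [h, map_add, map_c₁Hom, map_t, map_smul (φ.C₁.map g).hom, augHom_map]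
  · change c₁Hom σ P (r • y P (c₁Hom σ P w)) + t P (augHom σ P (c₁Hom σ P w)) = _
    have h : y P (c₁Hom σ P w) = w := by
      apply c₁Hom_injective (σ := σ)
      have h1 := hy P (c₁Hom σ P w)
      rw [augHom_c₁Hom, s_zero, add_zero] at h1
      exact h1.symm
    rw [h, augHom_c₁Hom, t_zero, add_zero]
  · change c₀Hom σ P (c₁Hom σ P (r • y P z) + t P (augHom σ P z)) = _
    have h1 := congrArg (c₀Hom σ P) (hy P z)
    rw [map_add, c₀Hom_c₁Hom] at h1
    refine (map_add _ _ _).trans ((congrArg₂ _ (c₀Hom_c₁Hom _) (c₀_t P _)).trans ?_)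
    exact (congrArg₂ _ ((φ.dHom P).map_smul r (y P z)) rfl).trans
      ((smul_add r _ _).symm.trans (congrArg _ h1.symm))

theorem isSquareZeroExtension [SMulCommClass R Rᵐᵒᵖ M] :
    IsSquareZeroExtension M (inclusion σ) (proj σ) where
  injective := inclusion_injective
  exact x := ⟨exists_inclusion_eq, by
    rintro ⟨m, rfl⟩
    exact proj_inclusion m⟩
  surjective r := by
    obtain ⟨x, hx⟩ := exists_isRegularOver (σ := σ) r
    exact ⟨⟨x, r, hx⟩, proj_eq hx⟩
  mul_right m x := Subtype.ext (endHom_ext fun P z => by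
    rw [endHom_inclusion, BalTensor.op_smul_tmul, ← augHom_endHom]
    rfl)
  mul_left x m := Subtype.ext (endHom_ext fun P z => by
    rw [endHom_inclusion, ← BalTensor.smul_tmul_left, map_smul, ← endHom_c₁Hom]
    rfl)
  mul_zero m m' := Subtype.ext (endHom_ext fun P z => by
    have h : endHom σ ((inclusion σ m * inclusion σ m' : regularEnd σ)) P z =
      endHom σ (inclusion σ m) P (endHom σ (inclusion σ m') P z) := rfl
    rw [h, endHom_inclusion, endHom_inclusion, augHom_c₁Hom, BalTensor.tmul_zero, map_zero,
      map_zero]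
    rfl)

end RingExtension

/-! ### Extension of scalars along a surjection -/

section ExtendScalars

variable {S R : Type u} [Ring S] [Ring R] (q : S →+* R) {V W : Type u} [AddCommGroup V]
  [Module S V] [AddCommGroup W] [Module R W]

namespace ExtendScalars

/-- The map `v ↦ 1 ⊗ v`. -/
def unit : V →+ ExtendScalars q V :=
  AddMonoidHom.mk' (fun v => (Submodule.Quotient.mk ((1 : R) ⊗ₜ[ℤ] v) : ExtendScalars q V)) fun v w => by
    simp only [TensorProduct.tmul_add]
    rfl

theorem smul_unit (r : R) (v : V) :
    r • unit q v = (Submodule.Quotient.mk (r ⊗ₜ[ℤ] v) : ExtendScalars q V) := by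
  change (Submodule.Quotient.mk (r • ((1 : R) ⊗ₜ[ℤ] v)) : ExtendScalars q V) = _
  rw [TensorProduct.smul_tmul', smul_eq_mul, mul_one]

theorem unit_smul (s : S) (v : V) : unit q (s • v) = q s • unit q v := by
  rw [smul_unit]
  have h : q s ⊗ₜ[ℤ] v - (1 : R) ⊗ₜ[ℤ] (s • v) ∈ Submodule.span R
      {t : R ⊗[ℤ] V | ∃ (x : R) (s : S) (v : V), t = (x * q s) ⊗ₜ[ℤ] v - x ⊗ₜ[ℤ] (s • v)} :=
    Submodule.subset_span ⟨1, s, v, by rw [one_mul]⟩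
  exact ((Submodule.Quotient.eq _).2 h).symm

@[elab_as_elim]
theorem induction {P : ExtendScalars q V → Prop} (smul : ∀ (r : R) (v : V), P (r • unit q v))
    (add : ∀ x y, P x → P y → P (x + y)) (x : ExtendScalars q V) : P x := by
  obtain ⟨x, rfl⟩ := Submodule.Quotient.mk_surjective _ x
  induction x using TensorProduct.induction_on with
  | zero =>
    have h := smul 0 0
    rw [map_zero, smul_zero] at h
    exact h
  | tmul r v => exact smul_unit q r v ▸ smul r v
  | add x y hx hy => exact add _ _ hx hy

/-- If r = q s, then r ⊗ v = 1 ⊗ s v. -/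
theorem unit_surjective (hq : Function.Surjective q) :
    Function.Surjective (unit q : V →+ ExtendScalars q V) := by
  intro x
  induction x using ExtendScalars.induction with
  | smul r v =>
    obtain ⟨s, rfl⟩ := hq r
    exact ⟨s • v, unit_smul q s v⟩
  | add x y hx hy =>
    obtain ⟨v, rfl⟩ := hx
    obtain ⟨w, rfl⟩ := hy
    exact ⟨v + w, map_add _ _ _⟩

theorem hom_ext {f g : ExtendScalars q V →ₗ[R] W} (h : ∀ v, f (unit q v) = g (unit q v)) :
    f = g := by
  refine LinearMap.ext fun x => ?_
  induction x using ExtendScalars.induction with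
  | smul r v => rw [map_smul, map_smul, h]
  | add x y hx hy => rw [map_add, map_add, hx, hy]

/-- Linear maps out of `R ⊗_S V` from semilinear maps. -/
def lift (f : V →+ W) (hf : ∀ (s : S) v, f (s • v) = q s • f v) : ExtendScalars q V →ₗ[R] W :=
  Submodule.liftQ _
    (TensorProduct.AlgebraTensorModule.lift (LinearMap.toSpanSingleton R _ f.toIntLinearMap)) (by
      rw [Submodule.span_le]
      rintro _ ⟨x, s, v, rfl⟩
      simp [hf, mul_smul])

@[simp]
theorem lift_unit (f : V →+ W) (hf : ∀ (s : S) v, f (s • v) = q s • f v) (v : V) :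
    lift q f hf (unit q v) = f v := by
  change (1 : R) • f v = f v
  exact one_smul R _

end ExtendScalars

/-- A module killed by the kernel of a surjection `q : S ⟶ R` is an `R`-module. -/
abbrev descendModule {q : S →+* R} (hq : Function.Surjective q)
    (h : ∀ (s : S) (v : V), q s = 0 → s • v = 0) : Module R V :=
  letI : SMul R V := ⟨fun r v => Function.surjInv hq r • v⟩
  Function.Surjective.moduleLeft q hq fun s v => by
    change Function.surjInv hq (q s) • v = s • v
    rw [← sub_eq_zero, ← sub_smul]
    exact h _ _ (by rw [map_sub, Function.surjInv_eq hq, sub_self])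

theorem descendModule_smul {q : S →+* R} (hq : Function.Surjective q)
    (h : ∀ (s : S) (v : V), q s = 0 → s • v = 0) (s : S) (v : V) :
    letI := descendModule hq h
    q s • v = s • v := by
  change Function.surjInv hq (q s) • v = s • v
  rw [← sub_eq_zero, ← sub_smul]
  exact h _ _ (by rw [map_sub, Function.surjInv_eq hq, sub_self])

end ExtendScalars

/-! ### Liftings along a square-zero extension -/

section LiftData

variable {S R : Type u} [Ring S] [Ring R] {M : Type u} [AddCommGroup M] [Module R M]
  [Module Rᵐᵒᵖ M] (i : M →+ S) (q : S →+* R)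

/-- An extension `0 ⟶ M ⊗_R V ⟶ V' ⟶ V ⟶ 0` of modules over a square-zero extension. -/
structure LiftData (V' V : Type u) [AddCommGroup V'] [Module S V'] [AddCommGroup V]
    [Module R V] where
  p : V' →+ V
  p_smul : ∀ (s : S) (v : V'), p (s • v) = q s • p v
  p_surjective : Function.Surjective p
  j : BalTensor R R M V →+ V'
  j_injective : Function.Injective j
  j_tmul : ∀ (m : M) (v : V'), j (BalTensor.tmul R R m (p v)) = i m • v
  p_eq_zero_iff : ∀ v, p v = 0 ↔ ∃ t, j t = v

variable {i q} {V' V : Type u} [AddCommGroup V'] [Module S V'] [AddCommGroup V] [Module R V]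

namespace LiftData

variable (hS : IsSquareZeroExtension M i q) (D : LiftData i q V' V)

include hS in
theorem j_smul (s : S) (t : BalTensor R R M V) : D.j (q s • t) = s • D.j t := by
  induction t using BalTensor.induction with
  | tmul m v =>
    obtain ⟨v, rfl⟩ := D.p_surjective v
    rw [BalTensor.smul_tmul_left, D.j_tmul, D.j_tmul, ← hS.mul_left, mul_smul]
  | add x y hx hy => rw [smul_add, map_add, map_add, smul_add, hx, hy]

include hS in
/-- Decompositions of the images in `V` of finitely many elements of `V'` lift to `V'`. -/
theorem exists_lift_decomposition {n k : ℕ} (v : Fin n → V') (a : Fin n → Fin k → R)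
    (y : Fin k → V) (h : ∀ l, D.p (v l) = ∑ j, a l j • y j) :
    ∃ (k' : ℕ) (a' : Fin n → Fin k' → S) (y' : Fin k' → V'), (∀ l, v l = ∑ j, a' l j • y' j) ∧
      ∀ j, (∃ j₀, ∀ l, q (a' l j) = a l j₀) ∨ ∀ l, q (a' l j) = 0 := by
  choose a₁ ha₁ using fun l j => hS.surjective (a l j)
  choose y₁ hy₁ using fun j => D.p_surjective (y j)
  -- With arbitrary lifts of coefficients and vectors, the error in row l lies in Ker p = M ⊗ V, so
  -- it is a sum of terms i m • w.
  have h1 : ∀ l, ∃ (N : ℕ) (m : Fin N → M) (w : Fin N → V'),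
      v l - ∑ j, a₁ l j • y₁ j = ∑ x, i (m x) • w x := by
    intro l
    obtain ⟨t, ht⟩ := (D.p_eq_zero_iff (v l - ∑ j, a₁ l j • y₁ j)).1 (by
      simp [map_sub, h, D.p_smul, ha₁, hy₁])
    obtain ⟨N, m, w, rfl⟩ := BalTensor.exists_sum t
    choose w' hw' using fun x => D.p_surjective (w x)
    refine ⟨N, m, w', ht.symm.trans ?_⟩
    simp only [map_sum, ← hw', D.j_tmul]
  choose N m w hw using h1
  let κ := Fin k ⊕ (Σ l, Fin (N l))
  -- The error terms of row l become new columns with coefficients in i M, nonzero at most in row l.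
  -- Each new column therefore reduces to zero under q.
  let a₂ (l : Fin n) : κ → S := Sum.elim (a₁ l) fun x => if x.1 = l then i (m x.1 x.2) else 0
  let y₂ : κ → V' := Sum.elim y₁ fun x => w x.1 x.2
  let e : κ ≃ Fin (Fintype.card κ) := Fintype.equivFin κ
  refine ⟨Fintype.card κ, fun l j => a₂ l (e.symm j), fun j => y₂ (e.symm j), fun l => ?_,
    fun j => ?_⟩
  · rw [e.symm.sum_comp fun x => a₂ l x • y₂ x, Fintype.sum_sum_type, Fintype.sum_sigma,
      Finset.sum_eq_single l]
    · simp only [a₂, y₂, Sum.elim_inl, Sum.elim_inr, if_true]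
      rw [← hw l, add_sub_cancel]
    · intro l' _ hl'
      simp [a₂, hl']
    · simp
  · beta_reduce
    rcases e.symm j with j₀ | x
    · exact Or.inl ⟨j₀, fun l => ha₁ l j₀⟩
    · refine Or.inr fun l => ?_
      simp only [a₂, Sum.elim_inr]
      split_ifs
      · exact (hS.exact _).2 ⟨_, rfl⟩
      · exact map_zero q

-- The equational criterion is verified in two rounds. Trivializing a relation modulo M leaves
-- coefficients i (m j) with ∑ m j ⊗ p (y₁ j) = 0 in M ⊗ V. Flatness of V trivializes this tensor as
-- well, and the product of the two coefficient matrices trivializes the original relation.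
include hS D in
theorem isFlat [SMulCommClass R Rᵐᵒᵖ M] (hV : IsFlat R V) : IsFlat S V' := by
  refine IsEquationallyFlat.isFlat fun n r v h => ?_
  obtain ⟨k, a, y, hv, ha⟩ := hV.isEquationallyFlat n (fun l => q (r l)) (fun l => D.p (v l)) (by
    simp only [← D.p_smul, ← map_sum, h, map_zero])
  obtain ⟨k₁, a₁, y₁, hv₁, ha₁⟩ := D.exists_lift_decomposition hS v a y hv
  have h1 : ∀ j, ∃ m, i m = ∑ l, r l * a₁ l j := fun j => by
    refine (hS.exact _).1 ?_
    simp only [map_sum, map_mul]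
    rcases ha₁ j with ⟨j₀, hj⟩ | hj
    · simp only [hj, ha]
    · simp only [hj, mul_zero, Finset.sum_const_zero]
  choose m hm using h1
  have h2 : ∑ j, BalTensor.tmul R R (m j) (D.p (y₁ j)) = 0 := by
    apply D.j_injective
    simp only [map_sum, D.j_tmul, hm, map_zero, Finset.sum_smul, mul_smul]
    rw [Finset.sum_comm]
    simp only [← Finset.smul_sum, ← hv₁, h]
  -- The two forms of M ⊗ V divide by an R-submodule and by a subgroup. Commuting actions give the
  -- comparison map needed here.
  have h3 : ∑ j, BalTensor.tmul R ℤ (m j) (D.p (y₁ j)) = 0 := by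
    let f : BalTensor R R M V →+ BalTensor R ℤ M V :=
      BalTensor.lift (BalTensor.mkHom R ℤ) fun r m v => BalTensor.op_smul_tmul r m v
    simpa [f, BalTensor.mkHom] using congrArg f h2
  obtain ⟨k₂, b, z, hz, hb⟩ := hV.vanishes_trivially m _ h3
  obtain ⟨k₃, b₁, z₁, hz₁, hb₁⟩ := D.exists_lift_decomposition hS y₁ b z hz
  refine ⟨k₃, fun l x => ∑ j, a₁ l j * b₁ j x, z₁, fun l => ?_, fun x => ?_⟩
  · rw [hv₁ l]
    simp only [hz₁, Finset.smul_sum, Finset.sum_smul, mul_smul]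
    rw [Finset.sum_comm]
  -- The right action of S on i M factors through q, so only the reductions of the second lifted
  -- coefficients matter.
  · have h4 : ∑ l, r l * ∑ j, a₁ l j * b₁ j x = i (∑ j, op (q (b₁ j x)) • m j) := by
      simp only [map_sum, ← hS.mul_right, hm, Finset.mul_sum, Finset.sum_mul, mul_assoc]
      rw [Finset.sum_comm]
    rw [h4]
    rcases hb₁ x with ⟨x₀, hx⟩ | hx
    · simp only [hx, hb, map_zero]
    · simp only [hx, MulOpposite.op_zero, zero_smul, Finset.sum_const_zero, map_zero]

/-- The isomorphism `q^* V' ≅ V`. -/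
def iso : ExtendScalars q V' ≃ₗ[R] V :=
  LinearEquiv.ofBijective (ExtendScalars.lift q D.p D.p_smul) <| by
    constructor
    · rw [injective_iff_map_eq_zero]
      intro x hx
      obtain ⟨v, rfl⟩ := ExtendScalars.unit_surjective q hS.surjective x
      rw [ExtendScalars.lift_unit] at hx
      obtain ⟨t, rfl⟩ := (D.p_eq_zero_iff v).1 hx
      clear hx
      induction t using BalTensor.induction with
      | tmul m v =>
        obtain ⟨v, rfl⟩ := D.p_surjective v
        rw [D.j_tmul, ExtendScalars.unit_smul, (hS.exact _).2 ⟨m, rfl⟩, zero_smul]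
      | add x y hx hy => rw [map_add, map_add, hx, hy, add_zero]
    · intro v
      obtain ⟨v, rfl⟩ := D.p_surjective v
      exact ⟨ExtendScalars.unit q v, ExtendScalars.lift_unit q _ _ v⟩

@[simp]
theorem iso_unit (v : V') : D.iso hS (ExtendScalars.unit q v) = D.p v :=
  ExtendScalars.lift_unit q D.p D.p_smul v

end LiftData

end LiftData

/-! ### The extension attached to a lifting -/

section Lifting

variable {S R : Type u} [Ring S] [Ring R] {M : Type u} [AddCommGroup M] [Module R M]
  [Module Rᵐᵒᵖ M] {i : M →+ S} {q : S →+* R}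
  (hS : IsSquareZeroExtension M i q)

namespace Lifting

variable {V W : ModuleCat.{u} R} (X : Lifting q V) (Y : Lifting q W)

/-- The projection `V' ⟶ V` of a lifting. -/
def p : X.V' →+ V := X.iso.toLinearMap.toAddMonoidHom.comp (ExtendScalars.unit q)

theorem p_apply (v : X.V') : X.p v = X.iso (ExtendScalars.unit q v) := rfl

theorem p_smul (s : S) (v : X.V') : X.p (s • v) = q s • X.p v := by
  rw [p_apply, ExtendScalars.unit_smul, map_smul, p_apply]

include hS in
theorem p_surjective : Function.Surjective X.p :=
  X.iso.surjective.comp (ExtendScalars.unit_surjective q hS.surjective)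

/-- A linear map commutes with the identifications of `q^* V'` with `V` if and only if it commutes
with the projections to `V`. -/
theorem comp_map_eq_iff {f : V ⟶ W} {g : X.V' →ₗ[S] Y.V'} :
    Y.iso.toLinearMap ∘ₗ ExtendScalars.map q g = f.hom ∘ₗ X.iso.toLinearMap ↔
      ∀ v, Y.p (g v) = f.hom (X.p v) := by
  constructor
  · intro h v
    exact LinearMap.congr_fun h (ExtendScalars.unit q v)
  · intro h
    exact ExtendScalars.hom_ext q h

-- The quotient of V' by i(M)V' is killed by Ker q, hence is an R-module. So V' → V' / i(M)V'
-- factors through q^* V' ≅ V.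
include hS in
theorem p_eq_zero {v : X.V'} (hv : X.p v = 0) :
    v ∈ AddSubgroup.closure {w | ∃ (m : M) (v : X.V'), w = i m • v} := by
  let N : Submodule S X.V' :=
    { AddSubgroup.closure {w : X.V' | ∃ (m : M) (v : X.V'), w = i m • v} with
      smul_mem' := fun s w hw => by
        refine (AddSubgroup.closure_le ((AddSubgroup.closure
          {w : X.V' | ∃ (m : M) (v : X.V'), w = i m • v}).comap
            (DistribSMul.toAddMonoidHom X.V' s))).2 ?_ hw
        rintro _ ⟨m, v, rfl⟩
        exact AddSubgroup.subset_closure ⟨q s • m, v, by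
          rw [← hS.mul_left, mul_smul]
          rfl⟩ }
  have hN : ∀ (s : S) (w : X.V' ⧸ N), q s = 0 → s • w = 0 := by
    intro s w hs
    obtain ⟨m, rfl⟩ := (hS.exact s).1 hs
    obtain ⟨w, rfl⟩ := N.mkQ_surjective w
    exact (Submodule.Quotient.mk_eq_zero N).2 (AddSubgroup.subset_closure ⟨m, w, rfl⟩)
  let _ := descendModule hS.surjective hN
  let f : ExtendScalars q X.V' →ₗ[R] X.V' ⧸ N := ExtendScalars.lift q N.mkQ.toAddMonoidHom
    fun s w => (descendModule_smul hS.surjective hN s (N.mkQ w)).symm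
  have h1 : ExtendScalars.unit q v = 0 := X.iso.injective (hv.trans (map_zero _).symm)
  have h2 : f (ExtendScalars.unit q v) = N.mkQ v := ExtendScalars.lift_unit q _ _ v
  rw [h1, map_zero] at h2
  exact (Submodule.Quotient.mk_eq_zero N).1 h2.symm

-- By `p_eq_zero` it suffices to treat elements of i(M)V', and these are annihilated because i(M)
-- has square zero.
include hS in
theorem inclusion_smul_eq_zero (m : M) {v : X.V'} (hv : X.p v = 0) : i m • v = 0 := by
  refine (AddSubgroup.closure_le (AddMonoidHom.ker
    (DistribSMul.toAddMonoidHom X.V' (i m)))).2 ?_ (X.p_eq_zero hS hv)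
  rintro _ ⟨m', v, rfl⟩
  change i m • i m' • v = 0
  rw [smul_smul, hS.mul_zero, zero_smul]

variable [SMulCommClass R Rᵐᵒᵖ M]

/-- The inclusion `M ⊗_R V ⟶ V'` for a lifting `V'` of `V`. -/
def j : BalTensor R R M V →+ X.V' :=
  -- Multiplication by i m depends only on the image in V, so an arbitrary set-theoretic section of
  -- p can be used.
  have key : ∀ (m : M) (v w : X.V'), X.p v = X.p w → i m • v = i m • w := fun m v w h => by
    rw [← sub_eq_zero, ← smul_sub]
    exact X.inclusion_smul_eq_zero hS m (by rw [map_sub, h, sub_self])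
  have hinv := Function.surjInv_eq (X.p_surjective hS)
  BalTensor.lift
    (AddMonoidHom.mk' (fun m => AddMonoidHom.mk'
      (fun v => i m • Function.surjInv (X.p_surjective hS) v) fun v w => by
        rw [← smul_add]
        exact key _ _ _ (by rw [map_add, hinv, hinv, hinv])) fun m m' => by
      ext v
      simp [add_smul])
    (fun r m v => by
      obtain ⟨s, rfl⟩ := hS.surjective r
      simp only [AddMonoidHom.mk'_apply]
      rw [← hS.mul_right, mul_smul]
      exact key _ _ _ (by rw [X.p_smul, hinv, hinv]))

theorem j_tmul (m : M) (v : X.V') : X.j hS (BalTensor.tmul R R m (X.p v)) = i m • v := by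
  rw [← sub_eq_zero]
  refine Eq.trans (smul_sub (i m) (Function.surjInv (X.p_surjective hS) (X.p v)) v).symm ?_
  refine X.inclusion_smul_eq_zero hS m ?_
  rw [map_sub, Function.surjInv_eq (X.p_surjective hS), sub_self]

/-- Flatness of V' is used here, for the right S-linear injection M → S: it embeds M ⊗_S V' in S ⊗_S
V', which multiplication embeds in V'. This embedding factors through the surjection M ⊗_S V' → M
⊗_R V followed by j, so j is injective. -/
theorem j_injective : Function.Injective (X.j hS) := by
  let _ : Module Sᵐᵒᵖ M := Module.compHom M q.op
  have hsmul : ∀ (s : S) (m : M), op s • m = op (q s) • m := fun _ _ => rfl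
  let i' : M →ₗ[Sᵐᵒᵖ] S :=
    { i with
      map_smul' := fun s m => (hS.mul_right m s.unop).symm }
  have hi' : Function.Injective i' := hS.injective
  let θ : BalTensor S ℤ M X.V' →+ BalTensor R R M V := BalTensor.lift
    (AddMonoidHom.mk' (fun m => (BalTensor.mkHom R R m).comp X.p) fun m m' => by
      ext v
      exact BalTensor.add_tmul _ _ _)
    (fun s m v => by
      change BalTensor.tmul R R (op (q s) • m) (X.p v) = BalTensor.tmul R R m (X.p (s • v))
      rw [BalTensor.op_smul_tmul, X.p_smul])
  have hθ : Function.Surjective θ := fun t => by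
    induction t using BalTensor.induction with
    | tmul m v =>
      obtain ⟨v, rfl⟩ := X.p_surjective hS v
      exact ⟨BalTensor.tmul S ℤ m v, rfl⟩
    | add x y hx hy =>
      obtain ⟨x, rfl⟩ := hx
      obtain ⟨y, rfl⟩ := hy
      exact ⟨x + y, map_add _ _ _⟩
  have hj : ∀ t, X.j hS (θ t) = BalTensor.selfHom S X.V' (BalTensor.mapLeft S i' X.V' t) :=
    fun t => by
      induction t using BalTensor.induction with
      | tmul m v => exact X.j_tmul hS m v
      | add x y hx hy => simp only [map_add, hx, hy]
  rw [injective_iff_map_eq_zero]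
  intro t ht
  obtain ⟨t, rfl⟩ := hθ t
  rw [hj] at ht
  have h1 := BalTensor.selfHom_injective (ht.trans (map_zero _).symm)
  rw [X.flat M S i' hi' (h1.trans (map_zero _).symm), map_zero]

/-- The extension `0 ⟶ M ⊗_R V ⟶ V' ⟶ V ⟶ 0` attached to a lifting of `V`. -/
def liftData : LiftData i q X.V' V where
  p := X.p
  p_smul := X.p_smul
  p_surjective := X.p_surjective hS
  j := X.j hS
  j_injective := X.j_injective hS
  j_tmul := X.j_tmul hS
  p_eq_zero_iff v := by
    constructor
    · intro hv
      refine (AddSubgroup.closure_le (X.j hS).range).2 ?_ (X.p_eq_zero hS hv)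
      rintro _ ⟨m, v, rfl⟩
      exact ⟨_, X.j_tmul hS m v⟩
    · rintro ⟨t, rfl⟩
      induction t using BalTensor.induction with
      | tmul m v =>
        obtain ⟨v, rfl⟩ := X.p_surjective hS v
        rw [X.j_tmul, X.p_smul, (hS.exact _).2 ⟨m, rfl⟩, zero_smul]
      | add x y hx hy => rw [map_add, map_add, hx, hy, add_zero]

/-- The lifting defined by an extension of modules. -/
def ofLiftData (hV : IsFlat R V) {V' : Type u} [AddCommGroup V'] [Module S V']
    (D : LiftData i q V' V) : Lifting q V where
  V' := ModuleCat.of S V'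
  flat := D.isFlat hS hV
  iso := D.iso hS

theorem ofLiftData_p (hV : IsFlat R V) {V' : Type u} [AddCommGroup V'] [Module S V']
    (D : LiftData i q V' V) (v : V') : (ofLiftData hS hV D).p v = D.p v := D.iso_unit hS v

end Lifting

end Lifting

/-! ### Passing between liftings and splittings, for modules -/

section Core

variable {S R : Type u} [Ring S] [Ring R] {M : Type u} [AddCommGroup M] [Module R M]
  [Module Rᵐᵒᵖ M] (i : M →+ S) (q : S →+* R)

/-- An elementary extension `0 ⟶ M ⊗_R V ⟶ D₁ ⟶ D₀ ⟶ V ⟶ 0` of `R`-modules with a splitting `E`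
by an `S`-module, on which `M ⊆ S` acts in the standard way. -/
structure TwistedSplitting (V D₁ D₀ E : Type u) [AddCommGroup V] [Module R V] [AddCommGroup D₁]
    [Module R D₁] [AddCommGroup D₀] [Module R D₀] [AddCommGroup E] [Module S E] where
  β : BalTensor R R M V →ₗ[R] D₁
  d : D₁ →ₗ[R] D₀
  α : D₀ →ₗ[R] V
  c₁ : D₁ →+ E
  c₀ : E →+ D₀
  c₁_smul : ∀ (s : S) y, c₁ (q s • y) = s • c₁ y
  c₀_smul : ∀ (s : S) z, c₀ (s • z) = q s • c₀ z
  c₀_c₁ : ∀ y, c₀ (c₁ y) = d y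
  c₁_injective : Function.Injective c₁
  c₀_surjective : Function.Surjective c₀
  β_injective : Function.Injective β
  d_eq_zero_iff : ∀ y, d y = 0 ↔ ∃ t, β t = y
  α_surjective : Function.Surjective α
  aug_eq_zero_iff : ∀ z, α (c₀ z) = 0 ↔ ∃ y, c₁ y = z
  inclusion_smul : ∀ (m : M) z, i m • z = c₁ (β (BalTensor.tmul R R m (α (c₀ z))))

/-- A splitting of an elementary extension of modules. -/
structure ModuleSplitting {V D₁ D₀ : Type u} [AddCommGroup V] [Module R V] [AddCommGroup D₁]
    [Module R D₁] [AddCommGroup D₀] [Module R D₀] (d : D₁ →ₗ[R] D₀) (α : D₀ →ₗ[R] V)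
    (X : Type u) [AddCommGroup X] [Module R X] where
  k₁ : D₁ →ₗ[R] X
  k₀ : X →ₗ[R] D₀
  k₀_k₁ : ∀ y, k₀ (k₁ y) = d y
  k₁_injective : Function.Injective k₁
  k₀_surjective : Function.Surjective k₀
  aug_eq_zero_iff : ∀ x, α (k₀ x) = 0 ↔ ∃ y, k₁ y = x

variable {i q}
variable (hS : IsSquareZeroExtension M i q)
variable {V D₁ D₀ E : Type u} [AddCommGroup V] [Module R V] [AddCommGroup D₁] [Module R D₁]
  [AddCommGroup D₀] [Module R D₀] [AddCommGroup E] [Module S E]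
  (C : TwistedSplitting i q V D₁ D₀ E)

namespace TwistedSplitting

theorem α_d (y : D₁) : C.α (C.d y) = 0 := by
  rw [← C.c₀_c₁]
  exact (C.aug_eq_zero_iff _).2 ⟨y, rfl⟩

theorem d_β (t : BalTensor R R M V) : C.d (C.β t) = 0 := (C.d_eq_zero_iff _).2 ⟨t, rfl⟩

/-- An element killed by c₀ goes to zero in V, so it comes from D₁, where d kills it. -/
theorem c₀_eq_zero_iff (z : E) : C.c₀ z = 0 ↔ ∃ t, C.c₁ (C.β t) = z := by
  constructor
  · intro h
    obtain ⟨y, rfl⟩ := (C.aug_eq_zero_iff z).1 (by rw [h, map_zero])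
    rw [C.c₀_c₁] at h
    obtain ⟨t, rfl⟩ := (C.d_eq_zero_iff y).1 h
    exact ⟨t, rfl⟩
  · rintro ⟨t, rfl⟩
    rw [C.c₀_c₁, C.d_β]

/-! ### The splitting built from a lifting -/

section Tot

variable {V' : Type u} [AddCommGroup V'] [Module S V'] (D : LiftData i q V' V)

/-- The fibre product `E ×_V V'`. -/
def fiber : Submodule S (E × V') where
  carrier := {x | C.α (C.c₀ x.1) = D.p x.2}
  add_mem' {x y} hx hy := by
    change C.α (C.c₀ (x.1 + y.1)) = D.p (x.2 + y.2)
    rw [map_add, map_add, map_add, hx, hy]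
  zero_mem' := by
    change C.α (C.c₀ 0) = D.p 0
    rw [map_zero, map_zero, map_zero]
  smul_mem' s x hx := by
    change C.α (C.c₀ (s • x.1)) = D.p (s • x.2)
    rw [C.c₀_smul, D.p_smul, map_smul, hx]

/-- The diagonal image of `M ⊗_R V` in `E ×_V V'`. -/
def diagonal : Submodule S (C.fiber D) where
  carrier := {x | ∃ t, C.c₁ (C.β t) = x.1.1 ∧ D.j t = x.1.2}
  add_mem' := by
    rintro x y ⟨t, ht⟩ ⟨t', ht'⟩
    refine ⟨t + t', ?_, ?_⟩
    · rw [map_add, map_add, ht.1, ht'.1]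
      rfl
    · rw [map_add, ht.2, ht'.2]
      rfl
  zero_mem' := ⟨0, by rw [map_zero, map_zero]; rfl, by rw [map_zero]; rfl⟩
  smul_mem' := by
    rintro s x ⟨t, ht⟩
    refine ⟨q s • t, ?_, ?_⟩
    · rw [map_smul, C.c₁_smul, ht.1]
      rfl
    · rw [D.j_smul hS, ht.2]
      rfl

/-- The splitting `E ×_V V' / M ⊗_R V` defined by a lifting `V'`. -/
abbrev Tot := C.fiber D ⧸ C.diagonal hS D

/-- The class of a pair. -/
def cls (z : E) (v : V') (h : C.α (C.c₀ z) = D.p v) : C.Tot hS D :=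
  Submodule.Quotient.mk ⟨(z, v), h⟩

theorem exists_cls (x : C.Tot hS D) : ∃ z v h, C.cls hS D z v h = x := by
  obtain ⟨⟨⟨z, v⟩, h⟩, rfl⟩ := Submodule.Quotient.mk_surjective _ x
  exact ⟨z, v, h, rfl⟩

variable {hS C D}

theorem cls_eq_cls_iff {z z' : E} {v v' : V'} {h : C.α (C.c₀ z) = D.p v}
    {h' : C.α (C.c₀ z') = D.p v'} : C.cls hS D z v h = C.cls hS D z' v' h' ↔
      ∃ t, C.c₁ (C.β t) = z - z' ∧ D.j t = v - v' :=
  Submodule.Quotient.eq _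

theorem cls_add {z z' : E} {v v' : V'} (h : C.α (C.c₀ z) = D.p v)
    (h' : C.α (C.c₀ z') = D.p v') : C.cls hS D z v h + C.cls hS D z' v' h' =
      C.cls hS D (z + z') (v + v') (by rw [map_add, map_add, map_add, h, h']) := rfl

/-- On a pair (z, v), i m acts in both components through the same tensor m ⊗ p v, so the result is
diagonal. This cancellation makes the quotient an R-module. -/
theorem kernel_smul_tot (s : S) (x : C.Tot hS D) (hs : q s = 0) : s • x = 0 := by
  obtain ⟨m, rfl⟩ := (hS.exact s).1 hs
  obtain ⟨z, v, h, rfl⟩ := C.exists_cls hS D x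
  refine (Submodule.Quotient.mk_eq_zero _).2 ⟨BalTensor.tmul R R m (D.p v), ?_, D.j_tmul m v⟩
  rw [← h]
  exact (C.inclusion_smul m z).symm

instance : Module R (C.Tot hS D) := descendModule hS.surjective kernel_smul_tot

theorem smul_tot (s : S) (x : C.Tot hS D) : q s • x = s • x :=
  descendModule_smul hS.surjective kernel_smul_tot s x

theorem smul_cls (s : S) {z : E} {v : V'} (h : C.α (C.c₀ z) = D.p v) :
    q s • C.cls hS D z v h =
      C.cls hS D (s • z) (s • v) (by rw [C.c₀_smul, D.p_smul, map_smul, h]) := by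
  rw [smul_tot]
  rfl

variable (hS C D) in
/-- The inclusion `D₁ ⟶ Tot`. -/
def k₁ : D₁ →ₗ[R] C.Tot hS D where
  toFun y := C.cls hS D (C.c₁ y) 0 (by rw [C.c₀_c₁, C.α_d, map_zero])
  map_add' y y' := by
    rw [cls_add, cls_eq_cls_iff]
    exact ⟨0, by simp, by simp⟩
  map_smul' r y := by
    obtain ⟨s, rfl⟩ := hS.surjective r
    rw [RingHom.id_apply, smul_cls, cls_eq_cls_iff]
    exact ⟨0, by simp [C.c₁_smul], by simp⟩

variable (hS C D) in
/-- The projection `Tot ⟶ D₀`. -/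
def k₀ : C.Tot hS D →ₗ[R] D₀ where
  toFun := QuotientAddGroup.lift (C.diagonal hS D).toAddSubgroup
    (C.c₀.comp ((AddMonoidHom.fst E V').comp (C.fiber D).subtype.toAddMonoidHom)) (by
      rintro x ⟨t, ht, -⟩
      exact (C.c₀_eq_zero_iff _).2 ⟨t, ht⟩)
  map_add' x y := map_add _ x y
  map_smul' r x := by
    obtain ⟨s, rfl⟩ := hS.surjective r
    obtain ⟨z, v, h, rfl⟩ := C.exists_cls hS D x
    rw [smul_cls]
    exact C.c₀_smul s z

theorem k₁_apply (y : D₁) :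
    C.k₁ hS D y = C.cls hS D (C.c₁ y) 0 (by rw [C.c₀_c₁, C.α_d, map_zero]) := rfl

@[simp]
theorem k₀_cls {z : E} {v : V'} (h : C.α (C.c₀ z) = D.p v) : C.k₀ hS D (C.cls hS D z v h) = C.c₀ z :=
  rfl

variable (hS C D) in
/-- The splitting of an elementary extension of modules defined by a lifting. -/
def splitting : ModuleSplitting C.d C.α (C.Tot hS D) where
  k₁ := C.k₁ hS D
  k₀ := C.k₀ hS D
  k₀_k₁ y := C.c₀_c₁ y
  k₁_injective y y' h := by
    obtain ⟨t, h1, h2⟩ := cls_eq_cls_iff.1 h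
    rw [sub_self] at h2
    rw [D.j_injective (h2.trans (map_zero _).symm), map_zero, map_zero] at h1
    exact C.c₁_injective (sub_eq_zero.1 h1.symm)
  k₀_surjective x := by
    obtain ⟨z, rfl⟩ := C.c₀_surjective x
    obtain ⟨v, hv⟩ := D.p_surjective (C.α (C.c₀ z))
    exact ⟨C.cls hS D z v hv.symm, rfl⟩
  aug_eq_zero_iff x := by
    constructor
    · intro hx
      obtain ⟨z, v, h, rfl⟩ := C.exists_cls hS D x
      rw [k₀_cls] at hx
      obtain ⟨y, rfl⟩ := (C.aug_eq_zero_iff z).1 hx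
      obtain ⟨t, rfl⟩ := (D.p_eq_zero_iff v).1 (h.symm.trans hx)
      -- Subtracting the diagonal element given by t clears the second component.
      refine ⟨y - C.β t, cls_eq_cls_iff.2 ⟨-t, ?_, ?_⟩⟩
      · simp
      · simp
    · rintro ⟨y, rfl⟩
      exact (congrArg C.α (C.c₀_c₁ y)).trans (C.α_d y)

/-- A diagonal element with first component zero is zero, since c₁ and β are injective. -/
theorem cls_right_injective {z : E} {v v' : V'} {h : C.α (C.c₀ z) = D.p v}
    {h' : C.α (C.c₀ z) = D.p v'} (he : C.cls hS D z v h = C.cls hS D z v' h') : v = v' := by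
  obtain ⟨t, h1, h2⟩ := cls_eq_cls_iff.1 he
  rw [sub_self] at h1
  have h3 : C.β t = 0 := C.c₁_injective (h1.trans (map_zero _).symm)
  rw [C.β_injective (h3.trans (map_zero _).symm), map_zero] at h2
  exact sub_eq_zero.1 h2.symm

/-- The first component of any representative differs from z by an element of M ⊗ V, and a diagonal
shift removes the difference. -/
theorem exists_cls_eq {x : C.Tot hS D} {z : E} (hx : C.k₀ hS D x = C.c₀ z) :
    ∃ v h, C.cls hS D z v h = x := by
  obtain ⟨z', v, h, rfl⟩ := C.exists_cls hS D x
  rw [k₀_cls] at hx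
  obtain ⟨t, ht⟩ := (C.c₀_eq_zero_iff (z' - z)).1 (by rw [map_sub, hx, sub_self])
  refine ⟨v - D.j t, ?_, cls_eq_cls_iff.2 ⟨-t, ?_, ?_⟩⟩
  · rw [map_sub, (D.p_eq_zero_iff _).2 ⟨t, rfl⟩, sub_zero, ← h, hx]
  · rw [map_neg, map_neg, ht, neg_sub]
  · rw [map_neg]
    abel

end Tot

/-! ### Maps -/

section Hom

variable {W D₁' D₀' E' : Type u} [AddCommGroup W] [Module R W] [AddCommGroup D₁'] [Module R D₁']
  [AddCommGroup D₀'] [Module R D₀'] [AddCommGroup E'] [Module S E']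
  {C} {C' : TwistedSplitting i q W D₁' D₀' E'}

variable (C C') in
/-- Maps between elementary extensions of modules with splittings by `S`-modules. -/
structure Hom where
  f : V →ₗ[R] W
  f₁ : D₁ →ₗ[R] D₁'
  f₀ : D₀ →ₗ[R] D₀'
  fE : E →ₗ[S] E'
  f₁_β : ∀ t, f₁ (C.β t) = C'.β (BalTensor.mapRight R R M f t)
  α_f₀ : ∀ x, C'.α (f₀ x) = f (C.α x)
  fE_c₁ : ∀ y, fE (C.c₁ y) = C'.c₁ (f₁ y)
  c₀_fE : ∀ z, C'.c₀ (fE z) = f₀ (C.c₀ z)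

variable {V' W' : Type u} [AddCommGroup V'] [Module S V'] [AddCommGroup W'] [Module S W']
  {D : LiftData i q V' V} {D' : LiftData i q W' W} (F : Hom C C')

theorem Hom.map_mem {z : E} {v : V'} (h : C.α (C.c₀ z) = D.p v) {w : W'}
    (hw : D'.p w = F.f (D.p v)) : C'.α (C'.c₀ (F.fE z)) = D'.p w := by
  rw [F.c₀_fE, F.α_f₀, h, hw]

/-- The map j is determined by the action of i M, so S-linearity already gives compatibility with
it. -/
theorem map_j {f : V →ₗ[R] W} {g : V' →ₗ[S] W'} (hg : ∀ v, D'.p (g v) = f (D.p v))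
    (t : BalTensor R R M V) : g (D.j t) = D'.j (BalTensor.mapRight R R M f t) := by
  induction t using BalTensor.induction with
  | tmul m v =>
    obtain ⟨v, rfl⟩ := D.p_surjective v
    rw [D.j_tmul, BalTensor.mapRight_tmul, ← hg, D'.j_tmul, map_smul]
  | add x y hx hy => simp only [map_add, hx, hy]

/-- The map of splittings induced by a map of liftings. -/
def Hom.map (g : V' →ₗ[S] W') (hg : ∀ v, D'.p (g v) = F.f (D.p v)) :
    C.Tot hS D →ₗ[R] C'.Tot hS D' where
  toFun := QuotientAddGroup.map (C.diagonal hS D).toAddSubgroup (C'.diagonal hS D').toAddSubgroup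
    (AddMonoidHom.mk' (fun x : C.fiber D => (⟨(F.fE x.1.1, g x.1.2),
        F.map_mem x.2 (hg x.1.2)⟩ : C'.fiber D')) fun x y =>
      Subtype.ext (Prod.ext (map_add F.fE _ _) (map_add g _ _))) (by
    rintro x ⟨t, h1, h2⟩
    refine ⟨BalTensor.mapRight R R M F.f t, ?_, ?_⟩
    · rw [← F.f₁_β, ← F.fE_c₁, h1]
      rfl
    · rw [← map_j hg, h2]
      rfl)
  map_add' x y := map_add _ x y
  map_smul' r x := by
    obtain ⟨s, rfl⟩ := hS.surjective r
    obtain ⟨z, v, h, rfl⟩ := C.exists_cls hS D x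
    rw [smul_cls]
    change C'.cls hS D' (F.fE (s • z)) (g (s • v)) _ = q s • C'.cls hS D' (F.fE z) (g v) _
    rw [smul_cls, cls_eq_cls_iff]
    exact ⟨0, by simp, by simp⟩

theorem Hom.map_cls (g : V' →ₗ[S] W') (hg : ∀ v, D'.p (g v) = F.f (D.p v)) {z : E} {v : V'}
    (h : C.α (C.c₀ z) = D.p v) : F.map hS g hg (C.cls hS D z v h) =
      C'.cls hS D' (F.fE z) (g v) (F.map_mem h (hg v)) := rfl

theorem Hom.map_k₁ (g : V' →ₗ[S] W') (hg : ∀ v, D'.p (g v) = F.f (D.p v)) (y : D₁) :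
    F.map hS g hg (C.k₁ hS D y) = C'.k₁ hS D' (F.f₁ y) := by
  rw [k₁_apply, k₁_apply, F.map_cls, cls_eq_cls_iff]
  exact ⟨0, by simp [F.fE_c₁], by simp⟩

theorem Hom.k₀_map (g : V' →ₗ[S] W') (hg : ∀ v, D'.p (g v) = F.f (D.p v)) (x : C.Tot hS D) :
    C'.k₀ hS D' (F.map hS g hg x) = F.f₀ (C.k₀ hS D x) := by
  obtain ⟨z, v, h, rfl⟩ := C.exists_cls hS D x
  rw [F.map_cls, k₀_cls, k₀_cls, F.c₀_fE]

theorem Hom.map_injective {g g' : V' →ₗ[S] W'} {hg : ∀ v, D'.p (g v) = F.f (D.p v)}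
    {hg' : ∀ v, D'.p (g' v) = F.f (D.p v)} (h : F.map hS g hg = F.map hS g' hg') : g = g' := by
  ext v
  obtain ⟨x, hx⟩ := C.α_surjective (D.p v)
  obtain ⟨z, rfl⟩ := C.c₀_surjective x
  exact cls_right_injective (LinearMap.congr_fun h (C.cls hS D z v hx))

/-- Maps of splittings are induced by maps of liftings. -/
theorem Hom.exists_map_eq (h : C.Tot hS D →ₗ[R] C'.Tot hS D')
    (h₁ : ∀ y, h (C.k₁ hS D y) = C'.k₁ hS D' (F.f₁ y))
    (h₀ : ∀ x, C'.k₀ hS D' (h x) = F.f₀ (C.k₀ hS D x)) :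
    ∃ (g : V' →ₗ[S] W') (hg : ∀ v, D'.p (g v) = F.f (D.p v)), F.map hS g hg = h := by
  -- The value of g at v is the second component of h (z, v) once the first is normalized to `F.fE
  -- z`. It does not depend on z: two choices differ by some c₁ y, and h is prescribed on D₁.
  have key : ∀ v : V', ∃ w : W', ∀ (z : E) (hz : C.α (C.c₀ z) = D.p v),
      ∃ hw, h (C.cls hS D z v hz) = C'.cls hS D' (F.fE z) w hw := by
    intro v
    obtain ⟨x, hx⟩ := C.α_surjective (D.p v)
    obtain ⟨z, rfl⟩ := C.c₀_surjective x
    obtain ⟨w, hw, hcls⟩ := exists_cls_eq (x := h (C.cls hS D z v hx)) (z := F.fE z) (by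
      rw [h₀, k₀_cls, F.c₀_fE])
    refine ⟨w, fun z' hz' => ?_⟩
    obtain ⟨y, hy⟩ := (C.aug_eq_zero_iff (z' - z)).1 (by
      rw [map_sub, map_sub, hx, hz', sub_self])
    have e1 : C.cls hS D z' v hz' = C.cls hS D z v hx + C.k₁ hS D y := by
      rw [k₁_apply, cls_add, cls_eq_cls_iff]
      exact ⟨0, by simp [hy], by simp⟩
    refine ⟨?_, ?_⟩
    · rw [← hw, F.c₀_fE, F.c₀_fE, F.α_f₀, F.α_f₀, hz', hx]
    · rw [e1, map_add, ← hcls, h₁, k₁_apply, cls_add, cls_eq_cls_iff]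
      exact ⟨0, by simp [← F.fE_c₁, hy], by simp⟩
  choose g hgz hgcls using key
  have exists_z : ∀ v : V', ∃ z, C.α (C.c₀ z) = D.p v := fun v => by
    obtain ⟨x, hx⟩ := C.α_surjective (D.p v)
    obtain ⟨z, rfl⟩ := C.c₀_surjective x
    exact ⟨z, hx⟩
  let G : V' →ₗ[S] W' :=
    { toFun := g
      map_add' := fun v v' => by
        obtain ⟨z, hz⟩ := exists_z v
        obtain ⟨z', hz'⟩ := exists_z v'
        have h1 := congrArg h (cls_add (hS := hS) hz hz')
        rw [map_add, hgcls, hgcls, hgcls, cls_add] at h1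
        -- The first components agree because `F.fE` is additive. So the diagonal discrepancy t is
        -- zero, and the second components agree too.
        obtain ⟨t, ht, ht'⟩ := cls_eq_cls_iff.1 h1
        rw [map_add, sub_self] at ht
        have ht0 : C'.β t = 0 := C'.c₁_injective (ht.trans (map_zero _).symm)
        rw [C'.β_injective (ht0.trans (map_zero _).symm), map_zero] at ht'
        exact (sub_eq_zero.1 ht'.symm).symm
      map_smul' := fun s v => by
        obtain ⟨z, hz⟩ := exists_z v
        have h1 := congrArg h (smul_cls (hS := hS) s hz)
        rw [map_smul, hgcls, hgcls, smul_cls] at h1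
        obtain ⟨t, ht, ht'⟩ := cls_eq_cls_iff.1 h1
        rw [map_smul, sub_self] at ht
        have ht0 : C'.β t = 0 := C'.c₁_injective (ht.trans (map_zero _).symm)
        rw [C'.β_injective (ht0.trans (map_zero _).symm), map_zero] at ht'
        exact (sub_eq_zero.1 ht'.symm).symm }
  refine ⟨G, fun v => ?_, ?_⟩
  · obtain ⟨z, hz⟩ := exists_z v
    have := hgz v z hz
    change D'.p (g v) = F.f (D.p v)
    rw [← this, F.c₀_fE, F.α_f₀, hz]
  · refine LinearMap.ext fun x => ?_
    obtain ⟨z, v, hz, rfl⟩ := C.exists_cls hS D x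
    exact (hgcls v z hz).symm

end Hom

end TwistedSplitting

end Core

/-! ### The lifting defined by a splitting -/

section Core

variable {S R : Type u} [Ring S] [Ring R] {M : Type u} [AddCommGroup M] [Module R M]
  [Module Rᵐᵒᵖ M] {i : M →+ S} {q : S →+* R}
  {V D₁ D₀ E : Type u} [AddCommGroup V] [Module R V] [AddCommGroup D₁] [Module R D₁]
  [AddCommGroup D₀] [Module R D₀] [AddCommGroup E] [Module S E]

/-- Maps of extensions of modules over the identity are bijective. -/
theorem LiftData.bijective {V' W' : Type u} [AddCommGroup V'] [Module S V'] [AddCommGroup W']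
    [Module S W'] (D : LiftData i q V' V) (D' : LiftData i q W' V) (g : V' →ₗ[S] W')
    (hg : ∀ v, D'.p (g v) = D.p v) : Function.Bijective g := by
  have hj : ∀ t, g (D.j t) = D'.j t := fun t => by
    induction t using BalTensor.induction with
    | tmul m v =>
      obtain ⟨v, rfl⟩ := D.p_surjective v
      rw [D.j_tmul, map_smul, ← hg, D'.j_tmul]
    | add x y hx hy => simp only [map_add, hx, hy]
  constructor
  · rw [injective_iff_map_eq_zero]
    intro v hv
    obtain ⟨t, rfl⟩ := (D.p_eq_zero_iff v).1 (by rw [← hg, hv, map_zero])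
    rw [hj] at hv
    rw [D'.j_injective (hv.trans (map_zero _).symm), map_zero]
  · intro w
    obtain ⟨v, hv⟩ := D.p_surjective (D'.p w)
    obtain ⟨t, ht⟩ := (D'.p_eq_zero_iff (w - g v)).1 (by rw [map_sub, hg, hv, sub_self])
    exact ⟨v + D.j t, by rw [map_add, hj, ht, add_sub_cancel]⟩

namespace ModuleSplitting

section

variable {d : D₁ →ₗ[R] D₀} {α : D₀ →ₗ[R] V} {X X' : Type u} [AddCommGroup X] [Module R X]
  [AddCommGroup X'] [Module R X']

/-- Maps of splittings are bijective. -/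
theorem bijective (Y : ModuleSplitting d α X) (Y' : ModuleSplitting d α X') (f : X →ₗ[R] X')
    (h₁ : ∀ y, f (Y.k₁ y) = Y'.k₁ y) (h₀ : ∀ x, Y'.k₀ (f x) = Y.k₀ x) : Function.Bijective f := by
  constructor
  · rw [injective_iff_map_eq_zero]
    intro x hx
    obtain ⟨y, rfl⟩ := (Y.aug_eq_zero_iff x).1 (by rw [← h₀, hx, map_zero, map_zero])
    rw [h₁] at hx
    rw [Y'.k₁_injective (hx.trans (map_zero _).symm), map_zero]
  · intro x'
    obtain ⟨x, hx⟩ := Y.k₀_surjective (Y'.k₀ x')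
    obtain ⟨y, hy⟩ := (Y'.aug_eq_zero_iff (x' - f x)).1 (by
      rw [map_sub, h₀, hx, sub_self, map_zero])
    exact ⟨x + Y.k₁ y, by rw [map_add, h₁, hy, add_sub_cancel]⟩

end

variable (C : TwistedSplitting i q V D₁ D₀ E) {X : Type u} [AddCommGroup X] [Module R X]
  [Module S X] (Y : ModuleSplitting C.d C.α X) (hX : ∀ (s : S) (x : X), s • x = q s • x)

/-- The fibre product `E ×_{D₀} X`. -/
def fiber : Submodule S (E × X) where
  carrier := {x | C.c₀ x.1 = Y.k₀ x.2}
  add_mem' {x y} hx hy := by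
    change C.c₀ (x.1 + y.1) = Y.k₀ (x.2 + y.2)
    rw [map_add, map_add, hx, hy]
  zero_mem' := by
    change C.c₀ 0 = Y.k₀ 0
    rw [map_zero, map_zero]
  smul_mem' s x hx := by
    change C.c₀ (s • x.1) = Y.k₀ (s • x.2)
    rw [C.c₀_smul, hX, map_smul, hx]

/-- The diagonal image of `D₁` in `E ×_{D₀} X`. -/
def diagonal : Submodule S (fiber C Y hX) where
  carrier := {x | ∃ y, C.c₁ y = x.1.1 ∧ Y.k₁ y = x.1.2}
  add_mem' := by
    rintro x x' ⟨y, hy⟩ ⟨y', hy'⟩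
    refine ⟨y + y', ?_, ?_⟩
    · rw [map_add, hy.1, hy'.1]
      rfl
    · rw [map_add, hy.2, hy'.2]
      rfl
  zero_mem' := ⟨0, by rw [map_zero]; rfl, by rw [map_zero]; rfl⟩
  smul_mem' := by
    rintro s x ⟨y, hy⟩
    refine ⟨q s • y, ?_, ?_⟩
    · rw [C.c₁_smul, hy.1]
      rfl
    · rw [map_smul, hy.2, ← hX]
      rfl

/-- The lifting `E ×_{D₀} X / D₁` defined by a splitting `X`. -/
abbrev Lift := fiber C Y hX ⧸ diagonal C Y hX

/-- The class of a pair. -/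
def cls (z : E) (x : X) (h : C.c₀ z = Y.k₀ x) : Lift C Y hX :=
  Submodule.Quotient.mk ⟨(z, x), h⟩

theorem exists_cls (v : Lift C Y hX) : ∃ z x h, cls C Y hX z x h = v := by
  obtain ⟨⟨⟨z, x⟩, h⟩, rfl⟩ := Submodule.Quotient.mk_surjective _ v
  exact ⟨z, x, h, rfl⟩

variable {C Y hX}

theorem cls_eq_cls_iff {z z' : E} {x x' : X} {h : C.c₀ z = Y.k₀ x} {h' : C.c₀ z' = Y.k₀ x'} :
    cls C Y hX z x h = cls C Y hX z' x' h' ↔ ∃ y, C.c₁ y = z - z' ∧ Y.k₁ y = x - x' :=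
  Submodule.Quotient.eq _

theorem cls_add {z z' : E} {x x' : X} (h : C.c₀ z = Y.k₀ x) (h' : C.c₀ z' = Y.k₀ x') :
    cls C Y hX z x h + cls C Y hX z' x' h' =
      cls C Y hX (z + z') (x + x') (by rw [map_add, map_add, h, h']) := rfl

theorem smul_cls (s : S) {z : E} {x : X} (h : C.c₀ z = Y.k₀ x) :
    s • cls C Y hX z x h =
      cls C Y hX (s • z) (s • x) (by rw [C.c₀_smul, hX, map_smul, h]) := rfl

/-- Both z and x come from D₁, from elements y and y' with the same image under d. A diagonal shift
by y' leaves c₁ (y - y') and 0, and y - y' comes from M ⊗ V. -/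
theorem exists_cls_of_aug_eq_zero {z : E} {x : X} (h : C.c₀ z = Y.k₀ x) (hz : C.α (C.c₀ z) = 0) :
    ∃ t h', cls C Y hX z x h = cls C Y hX (C.c₁ (C.β t)) 0 h' := by
  obtain ⟨y, rfl⟩ := (C.aug_eq_zero_iff z).1 hz
  obtain ⟨y', rfl⟩ := (Y.aug_eq_zero_iff x).1 (by rw [← h, hz])
  rw [C.c₀_c₁, Y.k₀_k₁, ← sub_eq_zero, ← map_sub] at h
  obtain ⟨t, ht⟩ := (C.d_eq_zero_iff _).1 h
  refine ⟨t, by rw [C.c₀_c₁, C.d_β, map_zero], cls_eq_cls_iff.2 ⟨y', ?_, by rw [sub_zero]⟩⟩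
  rw [ht, ← map_sub, sub_sub_cancel]

variable (C Y hX) in
/-- The extension of modules defined by a splitting. -/
def liftData (hS : IsSquareZeroExtension M i q) : LiftData i q (Lift C Y hX) V where
  p := QuotientAddGroup.lift (diagonal C Y hX).toAddSubgroup
    (C.α.toAddMonoidHom.comp
      (C.c₀.comp ((AddMonoidHom.fst E X).comp (fiber C Y hX).subtype.toAddMonoidHom))) (by
      rintro x ⟨y, hy, -⟩
      exact (C.aug_eq_zero_iff _).2 ⟨y, hy⟩)
  p_smul s v := by
    obtain ⟨z, x, h, rfl⟩ := exists_cls C Y hX v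
    change C.α (C.c₀ (s • z)) = q s • C.α (C.c₀ z)
    rw [C.c₀_smul, map_smul]
  p_surjective v := by
    obtain ⟨x, rfl⟩ := C.α_surjective v
    obtain ⟨z, rfl⟩ := C.c₀_surjective x
    obtain ⟨x, hx⟩ := Y.k₀_surjective (C.c₀ z)
    exact ⟨cls C Y hX z x hx.symm, rfl⟩
  j := AddMonoidHom.mk' (fun t => cls C Y hX (C.c₁ (C.β t)) 0 (by
      rw [C.c₀_c₁, C.d_β, map_zero])) fun t t' => by
    rw [cls_add, cls_eq_cls_iff]
    exact ⟨0, by simp, by simp⟩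
  j_injective := by
    rw [injective_iff_map_eq_zero]
    intro t ht
    obtain ⟨y, h1, h2⟩ := (Submodule.Quotient.mk_eq_zero _).1 ht
    have hy : y = 0 := Y.k₁_injective (h2.trans (map_zero _).symm)
    rw [hy] at h1
    have h3 := C.c₁_injective h1
    exact C.β_injective (h3.symm.trans (map_zero _).symm)
  j_tmul m v := by
    obtain ⟨z, x, h, rfl⟩ := exists_cls C Y hX v
    rw [smul_cls]
    refine cls_eq_cls_iff.2 ⟨0, ?_, ?_⟩
    · rw [C.inclusion_smul, map_zero]
      exact (sub_self _).symm
    · rw [hX, (hS.exact _).2 ⟨m, rfl⟩, zero_smul, sub_zero, map_zero]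
  p_eq_zero_iff v := by
    constructor
    · intro hv
      obtain ⟨z, x, h, rfl⟩ := exists_cls C Y hX v
      obtain ⟨t, _, ht⟩ := exists_cls_of_aug_eq_zero (hX := hX) h hv
      exact ⟨t, ht.symm⟩
    · rintro ⟨t, rfl⟩
      change C.α (C.c₀ (C.c₁ (C.β t))) = 0
      rw [C.c₀_c₁, C.α_d]

/-- Every splitting is isomorphic to the one defined by its lifting. -/
theorem exists_map_tot (hS : IsSquareZeroExtension M i q) :
    ∃ f : X →ₗ[R] C.Tot hS (liftData C Y hX hS), (∀ y, f (Y.k₁ y) = C.k₁ hS _ y) ∧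
      ∀ x, C.k₀ hS _ (f x) = Y.k₀ x := by
  choose z hz using fun x => C.c₀_surjective (Y.k₀ x)
  -- The comparison map sends x to the class of (z, [z, x]) for any z with the same image in D₀.
  -- Another z differs by an element of M ⊗ V, which moves both entries diagonally.
  let F (z : E) (x : X) (h : C.c₀ z = Y.k₀ x) : C.Tot hS (liftData C Y hX hS) :=
    C.cls hS (liftData C Y hX hS) z (cls C Y hX z x h) rfl
  have hF : ∀ (z z' : E) (x : X) (h : C.c₀ z = Y.k₀ x) (h' : C.c₀ z' = Y.k₀ x),
      F z x h = F z' x h' := by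
    intro z z' x h h'
    obtain ⟨t, ht⟩ := (C.c₀_eq_zero_iff (z - z')).1 (by rw [map_sub, h, h', sub_self])
    refine TwistedSplitting.cls_eq_cls_iff.2 ⟨t, ht, ?_⟩
    refine (Submodule.Quotient.eq _).2 ?_ |>.trans (Submodule.Quotient.mk_sub _)
    exact ⟨0, by simp [ht], by simp⟩
  refine ⟨{
    toFun := fun x => F (z x) x (hz x)
    map_add' := fun x x' => ?_
    map_smul' := fun r x => ?_ }, fun y => ?_, fun x => hz x⟩
  · exact hF _ (z x + z x') _ _ (by rw [map_add, map_add, hz, hz])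
  · obtain ⟨s, rfl⟩ := hS.surjective r
    refine (hF _ (s • z x) _ _ (by rw [C.c₀_smul, map_smul, hz])).trans ?_
    refine (TwistedSplitting.cls_eq_cls_iff.2 ⟨0, by simp, ?_⟩).trans
      (TwistedSplitting.smul_cls (hS := hS) (D := liftData C Y hX hS) s _).symm
    rw [smul_cls, map_zero, eq_comm, sub_eq_zero, cls_eq_cls_iff]
    exact ⟨0, by simp, by simp [hX]⟩
  · refine (hF _ (C.c₁ y) _ _ (by rw [C.c₀_c₁, Y.k₀_k₁])).trans ?_
    rw [TwistedSplitting.k₁_apply]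
    refine TwistedSplitting.cls_eq_cls_iff.2 ⟨0, by simp, ?_⟩
    rw [sub_zero, map_zero, eq_comm]
    exact (Submodule.Quotient.mk_eq_zero _).2 ⟨y, rfl, rfl⟩

end ModuleSplitting

end Core

variable {R : Type u} [Ring R] {M : Type u} [AddCommGroup M] [Module R M] [Module Rᵐᵒᵖ M]

namespace RingExtension

/-! ### The values of an elementary extension at flat modules -/

section Extend

variable (φ : RingExtension R M) (V : ModuleCat.{u} R)

/-- The map `M ⊗_R V ⟶ C₁(V)`. -/
def extendB [SMulCommClass R Rᵐᵒᵖ M] : BalTensor R R M V →ₗ[R] (extend φ.C₁).obj V :=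
  (inv (fromTautTensor M V) ≫ extendMap φ.b V).hom

/-- The map `C₁(V) ⟶ C₀(V)`. -/
def extendD : (extend φ.C₁).obj V →ₗ[R] (extend φ.C₀).obj V := (extendMap φ.d V).hom

/-- The map `C₀(V) ⟶ V`. -/
def extendA : (extend φ.C₀).obj V →ₗ[R] V := (extendMap φ.a V ≫ fromTaut R V).hom

variable {φ V} {P : ProjCat R}

theorem extendB_mapRight [SMulCommClass R Rᵐᵒᵖ M] (g : P.P →ₗ[R] V) (t : BalTensor R R M P.P) :
    extendB φ V (BalTensor.mapRight R R M g t) = incl φ.C₁ g (φ.bHom P t) := by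
  rw [← fromTautTensor_incl]
  have h : fromTautTensor M V ≫ inv (fromTautTensor M V) ≫ extendMap φ.b V = extendMap φ.b V :=
    IsIso.hom_inv_id_assoc _ _
  exact (congrArg (fun f => f.hom (incl (tautTensor R M) g t)) h).trans (extendMap_incl φ.b g t)

theorem extendD_incl (g : P.P →ₗ[R] V) (y : φ.C₁.obj P) :
    extendD φ V (incl φ.C₁ g y) = incl φ.C₀ g (φ.dHom P y) := extendMap_incl φ.d g y

theorem extendA_incl (g : P.P →ₗ[R] V) (x : φ.C₀.obj P) :
    extendA φ V (incl φ.C₀ g x) = g (φ.aHom P x) :=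
  (congrArg (fromTaut R V).hom (extendMap_incl φ.a g x)).trans (fromTaut_incl g (φ.aHom P x))

theorem exists_lin_eq_zero (hV : IsEquationallyFlat R V) (g : P.P →ₗ[R] V) (p : P.P)
    (hp : g p = 0) : ∃ (Q : ProjCat R) (h : P ⟶ Q) (g' : Q.P →ₗ[R] V),
      g' ∘ₗ ProjCat.lin h = g ∧ ProjCat.lin h p = 0 :=
  exists_map_eq_zero (taut R) hV g p ((bijective_fromTaut hV).1
    (((fromTaut_incl g p).trans hp).trans (map_zero _).symm))

variable (hV : IsEquationallyFlat R V)
include hV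

/-- The pattern for all exactness statements over V: represent the element over some P, pass to a Q
where the vanishing holds, apply exactness at Q and map back to V. -/
theorem extendB_injective [SMulCommClass R Rᵐᵒᵖ M] : Function.Injective (extendB φ V) := by
  rw [injective_iff_map_eq_zero]
  intro t ht
  obtain ⟨P, g, x, rfl⟩ := exists_mapRight_eq hV t
  rw [extendB_mapRight] at ht
  obtain ⟨Q, h, g', rfl, h0⟩ := exists_map_eq_zero φ.C₁ hV g _ ht
  rw [map_bHom] at h0
  rw [BalTensor.mapRight_comp, bHom_injective (h0.trans (map_zero _).symm), map_zero]

theorem exact_extendB_extendD [SMulCommClass R Rᵐᵒᵖ M] : Function.Exact (extendB φ V) (extendD φ V) := by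
  intro y
  constructor
  · intro hy
    obtain ⟨P, g, y, rfl⟩ := exists_incl _ hV y
    rw [extendD_incl] at hy
    obtain ⟨Q, h, g', rfl, h0⟩ := exists_map_eq_zero φ.C₀ hV g _ hy
    rw [map_dHom] at h0
    obtain ⟨t, ht⟩ := (exact_bHom_dHom _).1 h0
    exact ⟨BalTensor.mapRight R R M g' t, by rw [extendB_mapRight, ht, incl_map]⟩
  · rintro ⟨t, rfl⟩
    obtain ⟨P, g, x, rfl⟩ := exists_mapRight_eq hV t
    rw [extendB_mapRight, extendD_incl, dHom_bHom, map_zero]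

theorem exact_extendD_extendA : Function.Exact (extendD φ V) (extendA φ V) := by
  intro y
  constructor
  · intro hy
    obtain ⟨P, g, x, rfl⟩ := exists_incl _ hV y
    rw [extendA_incl] at hy
    obtain ⟨Q, h, g', rfl, h0⟩ := exists_lin_eq_zero hV g _ hy
    rw [← aHom_map] at h0
    obtain ⟨y, hy⟩ := (exact_dHom_aHom _).1 h0
    exact ⟨incl φ.C₁ g' y, by rw [extendD_incl, hy, incl_map]⟩
  · rintro ⟨y, rfl⟩
    obtain ⟨P, g, y, rfl⟩ := exists_incl _ hV y
    rw [extendD_incl, extendA_incl, aHom_dHom, map_zero]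

theorem extendA_surjective : Function.Surjective (extendA φ V) := by
  intro v
  obtain ⟨y, rfl⟩ := (bijective_fromTaut hV).2 v
  obtain ⟨P, g, p, rfl⟩ := exists_incl _ hV y
  obtain ⟨x, hx⟩ := aHom_surjective (φ := φ) (P := P) p
  exact ⟨incl φ.C₀ g x, by rw [extendA_incl, hx]; exact (fromTaut_incl g p).symm⟩

theorem isElementaryExtension_extend [SMulCommClass R Rᵐᵒᵖ M] :
    IsElementaryExtension (inv (fromTautTensor M V) ≫ extendMap φ.b V) (extendMap φ.d V)
      (extendMap φ.a V ≫ fromTaut R V) :=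
  isElementaryExtension_iff.2 ⟨extendB_injective hV, exact_extendB_extendD hV,
    exact_extendD_extendA hV, extendA_surjective hV⟩

end Extend

/-! ### The extension of `C₀₁` to flat modules -/

section Twisted

variable {φ : RingExtension R M}

/-- An action of a ring on `C₀₁` by regular endomorphisms, with the standard action of `M`. -/
structure RegularAction (σ : φ.AbSplitting) {S : Type u} [Ring S] (i : M →+ S) (q : S →+* R) where
  ρ : S →+* End σ.obj
  isRegularOver : ∀ s, IsRegularOver σ (ρ s) (q s)
  map_inclusion : ∀ m, ρ (i m) = ofBimodule σ m

variable {σ : φ.AbSplitting} {S : Type u} [Ring S] {i : M →+ S} {q : S →+* R}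
  (A : RegularAction σ i q)

namespace RegularAction

/-- The module `C₀₁(P)`. -/
@[nolint unusedArguments]
def Carrier (_ : RegularAction σ i q) (P : ProjCat R) : Type u := σ.obj.obj P

instance (P : ProjCat R) : AddCommGroup (A.Carrier P) :=
  inferInstanceAs (AddCommGroup (σ.obj.obj P))

instance (P : ProjCat R) : Module S (A.Carrier P) where
  smul s z := endHom σ (A.ρ s) P z
  one_smul z := by
    change endHom σ (A.ρ 1) P z = z
    rw [map_one]
    rfl
  mul_smul s t z := by
    change endHom σ (A.ρ (s * t)) P z = endHom σ (A.ρ s) P (endHom σ (A.ρ t) P z)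
    rw [map_mul]
    rfl
  smul_zero s := map_zero (endHom σ (A.ρ s) P)
  smul_add s := map_add (endHom σ (A.ρ s) P)
  add_smul s t z := by
    change endHom σ (A.ρ (s + t)) P z = endHom σ (A.ρ s) P z + endHom σ (A.ρ t) P z
    rw [map_add]
    rfl
  zero_smul z := by
    change endHom σ (A.ρ 0) P z = 0
    rw [map_zero]
    rfl

theorem smul_def {P : ProjCat R} (s : S) (z : A.Carrier P) : s • z = endHom σ (A.ρ s) P z := rfl

/-- The functor `C₀₁`, with values in modules over a ring acting by regular endomorphisms. -/
def functor : ProjCat R ⥤ ModuleCat.{u} S where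
  obj P := ModuleCat.of S (A.Carrier P)
  map {P Q} f := ModuleCat.ofHom
    { toFun := fun z : A.Carrier P => ((σ.obj.map f).hom z : A.Carrier Q)
      map_add' := map_add (σ.obj.map f).hom
      map_smul' := fun s z => (congrArg (σ.obj.map f).hom (A.smul_def s z)).trans
        ((endHom_map (A.ρ s) f z).trans (A.smul_def s _).symm) }
  map_id P := by
    ext z
    exact congrArg (fun g => g.hom z) (σ.obj.map_id P)
  map_comp f g := by
    ext z
    exact congrArg (fun h => h.hom z) (σ.obj.map_comp f g)

variable {V : ModuleCat.{u} R}

/-- The structure map `C₀₁(P) ⟶ C₀₁(V)` for a map `P ⟶ V`. -/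
def twistedIncl {P : ProjCat R} (g : P.P →ₗ[R] V) : σ.obj.obj P →+ (extendTo A.functor).obj V :=
  (incl A.functor g).toAddMonoidHom

variable {P Q : ProjCat R}

theorem endHom_c₁Hom (s : S) (y : φ.C₁.obj P) :
    endHom σ (A.ρ s) P (c₁Hom σ P y) = c₁Hom σ P (q s • y) :=
  (isRegularOver_iff.1 (A.isRegularOver s) P).1 y

theorem c₀Hom_endHom (s : S) (z : σ.obj.obj P) :
    c₀Hom σ P (endHom σ (A.ρ s) P z) = q s • c₀Hom σ P z :=
  (isRegularOver_iff.1 (A.isRegularOver s) P).2 z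

variable {A}

theorem smul_twistedIncl (x : S) (g : P.P →ₗ[R] V) (z : σ.obj.obj P) :
    x • A.twistedIncl g z = A.twistedIncl g (endHom σ (A.ρ x) P z) :=
  ((incl A.functor g).map_smul x z).symm.trans (congrArg (incl A.functor g) (A.smul_def x z))

theorem twistedIncl_map (h : P ⟶ Q) (g : Q.P →ₗ[R] V) (z : σ.obj.obj P) :
    A.twistedIncl g ((σ.obj.map h).hom z) = A.twistedIncl (g ∘ₗ ProjCat.lin h) z :=
  incl_map A.functor h g z

theorem exists_twistedIncl (hV : IsEquationallyFlat R V) (z : (extendTo A.functor).obj V) :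
    ∃ (P : ProjCat R) (g : P.P →ₗ[R] V) (x : σ.obj.obj P), A.twistedIncl g x = z :=
  exists_incl A.functor hV z

theorem exists_map_eq_zero_of_twistedIncl (hV : IsEquationallyFlat R V) (g : P.P →ₗ[R] V)
    (z : σ.obj.obj P) (hz : A.twistedIncl g z = 0) :
    ∃ (Q : ProjCat R) (h : P ⟶ Q) (g' : Q.P →ₗ[R] V),
      g' ∘ₗ ProjCat.lin h = g ∧ (σ.obj.map h).hom z = 0 :=
  exists_map_eq_zero A.functor hV g z hz

variable (A V) in
/-- The map `c₁ : C₁(V) ⟶ C₀₁(V)`. -/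
def extendC₁ : (extend φ.C₁).obj V →+ (extendTo A.functor).obj V :=
  extendDesc φ.C₁ (fun P g => (A.twistedIncl g).comp (c₁Hom σ P)) fun P _ h g y => by
    refine Eq.trans ?_ (twistedIncl_map h g (c₁Hom σ P y))
    rw [map_c₁Hom]
    rfl

variable (A V) in
/-- The map `c₀ : C₀₁(V) ⟶ C₀(V)`. -/
def extendC₀ : (extendTo A.functor).obj V →+ (extend φ.C₀).obj V :=
  extendDesc A.functor (fun P g => (incl φ.C₀ g).toAddMonoidHom.comp (c₀Hom σ P))
    fun _ _ h g z => (congrArg (incl φ.C₀ g) (map_c₀Hom h z).symm).trans (incl_map φ.C₀ h g _)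

theorem extendC₁_incl (g : P.P →ₗ[R] V) (y : φ.C₁.obj P) :
    A.extendC₁ V (incl φ.C₁ g y) = A.twistedIncl g (c₁Hom σ P y) :=
  extendDesc_incl φ.C₁ _ _ g y

theorem extendC₀_twistedIncl (g : P.P →ₗ[R] V) (z : σ.obj.obj P) :
    A.extendC₀ V (A.twistedIncl g z) = incl φ.C₀ g (c₀Hom σ P z) :=
  extendDesc_incl A.functor _ _ g z

theorem extendC₁_smul (hV : IsEquationallyFlat R V) (x : S) (y : (extend φ.C₁).obj V) :
    A.extendC₁ V (q x • y) = x • A.extendC₁ V y := by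
  obtain ⟨P, g, y, rfl⟩ := exists_incl _ hV y
  rw [extendC₁_incl, smul_twistedIncl, A.endHom_c₁Hom, ← extendC₁_incl]
  exact congrArg (A.extendC₁ V) ((incl φ.C₁ g).map_smul (q x) y).symm

theorem extendC₀_smul (hV : IsEquationallyFlat R V) (x : S)
    (z : (extendTo A.functor).obj V) :
    A.extendC₀ V (x • z) = q x • A.extendC₀ V z := by
  obtain ⟨P, g, z, rfl⟩ := exists_twistedIncl hV z
  rw [extendC₀_twistedIncl, smul_twistedIncl, extendC₀_twistedIncl, A.c₀Hom_endHom]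
  exact (incl φ.C₀ g).map_smul (q x) (c₀Hom σ P z)

variable [SMulCommClass R Rᵐᵒᵖ M]

variable (A) in
/-- The elementary extension of modules obtained from a flat module. -/
def twistedSplitting (hV : IsEquationallyFlat R V) :
    TwistedSplitting i q V ((extend φ.C₁).obj V) ((extend φ.C₀).obj V)
      ((extendTo A.functor).obj V) where
  β := extendB φ V
  d := extendD φ V
  α := extendA φ V
  c₁ := A.extendC₁ V
  c₀ := A.extendC₀ V
  c₁_smul := extendC₁_smul hV
  c₀_smul := extendC₀_smul hV
  c₀_c₁ y := by
    obtain ⟨P, g, y, rfl⟩ := exists_incl _ hV y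
    rw [extendC₁_incl, extendC₀_twistedIncl, c₀Hom_c₁Hom, extendD_incl]
  c₁_injective := by
    rw [injective_iff_map_eq_zero]
    intro y hy
    obtain ⟨P, g, y, rfl⟩ := exists_incl _ hV y
    rw [extendC₁_incl] at hy
    obtain ⟨Q, h, g', rfl, h0⟩ := exists_map_eq_zero_of_twistedIncl hV g _ hy
    rw [map_c₁Hom] at h0
    rw [← incl_map, c₁Hom_injective (h0.trans (map_zero _).symm), map_zero]
  c₀_surjective x := by
    obtain ⟨P, g, x, rfl⟩ := exists_incl _ hV x
    obtain ⟨z, rfl⟩ := c₀Hom_surjective (σ := σ) x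
    exact ⟨A.twistedIncl g z, extendC₀_twistedIncl g z⟩
  β_injective := extendB_injective hV
  d_eq_zero_iff := exact_extendB_extendD hV
  α_surjective := extendA_surjective hV
  aug_eq_zero_iff z := by
    constructor
    · intro hz
      obtain ⟨P, g, z, rfl⟩ := exists_twistedIncl hV z
      rw [extendC₀_twistedIncl, extendA_incl, aHom_c₀Hom] at hz
      obtain ⟨Q, h, g', rfl, h0⟩ := exists_lin_eq_zero hV g _ hz
      rw [← augHom_map] at h0
      obtain ⟨y, hy⟩ := (augHom_eq_zero_iff _).1 h0
      exact ⟨incl φ.C₁ g' y, by rw [extendC₁_incl, hy, twistedIncl_map]⟩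
    · rintro ⟨y, rfl⟩
      obtain ⟨P, g, y, rfl⟩ := exists_incl _ hV y
      rw [extendC₁_incl, extendC₀_twistedIncl, extendA_incl, aHom_c₀Hom, augHom_c₁Hom, map_zero]
  inclusion_smul m z := by
    obtain ⟨P, g, z, rfl⟩ := exists_twistedIncl hV z
    rw [smul_twistedIncl, A.map_inclusion, endHom_ofBimodule, extendC₀_twistedIncl, extendA_incl, aHom_c₀Hom,
      ← BalTensor.mapRight_tmul, extendB_mapRight, extendC₁_incl]

variable {W : ModuleCat.{u} R}

variable (A) in
/-- Functoriality of `twistedSplitting`. -/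
def twistedHom (hV : IsEquationallyFlat R V) (hW : IsEquationallyFlat R W) (f : V ⟶ W) :
    TwistedSplitting.Hom (A.twistedSplitting hV) (A.twistedSplitting hW) where
  f := f.hom
  f₁ := ((extend φ.C₁).map f).hom
  f₀ := ((extend φ.C₀).map f).hom
  fE := ((extendTo A.functor).map f).hom
  f₁_β t := by
    obtain ⟨P, g, t, rfl⟩ := exists_mapRight_eq hV t
    change ((extend φ.C₁).map f).hom (extendB φ V _) = extendB φ W _
    rw [extendB_mapRight, ← BalTensor.mapRight_comp, extendB_mapRight]
    exact map_incl φ.C₁ f g _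
  α_f₀ x := by
    obtain ⟨P, g, x, rfl⟩ := exists_incl _ hV x
    change extendA φ W (((extend φ.C₀).map f).hom _) = f.hom (extendA φ V _)
    rw [extendA_incl]
    exact (congrArg _ (map_incl φ.C₀ f g x)).trans (extendA_incl _ x)
  fE_c₁ y := by
    obtain ⟨P, g, y, rfl⟩ := exists_incl _ hV y
    change ((extendTo A.functor).map f).hom (A.extendC₁ V _) =
      A.extendC₁ W (((extend φ.C₁).map f).hom _)
    rw [extendC₁_incl]
    exact (map_incl A.functor f g _).trans ((extendC₁_incl _ y).symm.trans
      (congrArg (A.extendC₁ W) (map_incl φ.C₁ f g y).symm))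
  c₀_fE z := by
    obtain ⟨P, g, z, rfl⟩ := exists_twistedIncl hV z
    change A.extendC₀ W (((extendTo A.functor).map f).hom _) =
      ((extend φ.C₀).map f).hom (A.extendC₀ V _)
    rw [extendC₀_twistedIncl]
    exact (congrArg _ (map_incl A.functor f g z)).trans ((extendC₀_twistedIncl _ z).trans
      (map_incl φ.C₀ f g _).symm)

end RegularAction

end Twisted

end RingExtension

/-! ### Liftings and splittings -/

section

variable {R : Type u} [Ring R] {V : ModuleCat.{u} R} {B D₁ D₀ : ModuleCat.{u} R} {b : B ⟶ D₁}
  {d : D₁ ⟶ D₀} {a : D₀ ⟶ V}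

/-- Splittings in the category of modules from splittings in terms of elements. -/
def ModuleSplitting.toSplitting (h : IsElementaryExtension b d a) {X : Type u} [AddCommGroup X]
    [Module R X] (Y : ModuleSplitting d.hom a.hom X) : Splitting d where
  obj := ModuleCat.of R X
  c₁ := ModuleCat.ofHom Y.k₁
  c₀ := ModuleCat.ofHom Y.k₀
  isPullback := (isPullback_iff_of_modules h).2 ⟨Y.k₀_k₁, Y.k₁_injective, Y.aug_eq_zero_iff⟩
  epi_c₀ := (ModuleCat.epi_iff_surjective _).2 Y.k₀_surjective

/-- Splittings in the category of modules in terms of elements. -/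
def Splitting.toModuleSplitting (h : IsElementaryExtension b d a) (Z : Splitting d) :
    ModuleSplitting d.hom a.hom Z.obj where
  k₁ := Z.c₁.hom
  k₀ := Z.c₀.hom
  k₀_k₁ := ((isPullback_iff_of_modules h).1 Z.isPullback).1
  k₁_injective := ((isPullback_iff_of_modules h).1 Z.isPullback).2.1
  k₀_surjective := (ModuleCat.epi_iff_surjective _).1 Z.epi_c₀
  aug_eq_zero_iff := ((isPullback_iff_of_modules h).1 Z.isPullback).2.2

/-- A map of splittings of modules is an isomorphism. -/
theorem Splitting.nonempty_iso (h : IsElementaryExtension b d a) {Z Z' : Splitting d}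
    (f : Z.obj →ₗ[R] Z'.obj) (h₁ : ∀ y, f (Z.c₁.hom y) = Z'.c₁.hom y)
    (h₀ : ∀ x, Z'.c₀.hom (f x) = Z.c₀.hom x) : Nonempty (Z ≅ Z') := by
  let F : Z.obj ≃ₗ[R] Z'.obj := LinearEquiv.ofBijective f
    ((Z.toModuleSplitting h).bijective (Z'.toModuleSplitting h) f h₁ h₀)
  have hF : ∀ x, F (F.symm x) = x := F.apply_symm_apply
  refine ⟨{
    hom := (⟨ModuleCat.ofHom f, ?_, ?_⟩ : Splitting.Hom Z Z')
    inv := (⟨ModuleCat.ofHom F.symm.toLinearMap, ?_, ?_⟩ : Splitting.Hom Z' Z)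
    hom_inv_id := Splitting.Hom.ext (ModuleCat.hom_ext (LinearMap.ext F.symm_apply_apply))
    inv_hom_id := Splitting.Hom.ext (ModuleCat.hom_ext (LinearMap.ext F.apply_symm_apply)) }⟩
  · exact ModuleCat.hom_ext (LinearMap.ext h₁)
  · exact ModuleCat.hom_ext (LinearMap.ext h₀)
  · exact ModuleCat.hom_ext (LinearMap.ext fun y => F.symm_apply_eq.2 (h₁ y).symm)
  · exact ModuleCat.hom_ext (LinearMap.ext fun x =>
      (h₀ (F.symm x)).symm.trans (congrArg Z'.c₀.hom (hF x)))

end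

namespace RingExtension

/-! ### The functor from liftings to splittings, and why it is an equivalence -/

namespace RegularAction

variable {R : Type u} [Ring R] {M : Type u} [AddCommGroup M] [Module R M] [Module Rᵐᵒᵖ M]
  [SMulCommClass R Rᵐᵒᵖ M] {φ : RingExtension R M} {σ : φ.AbSplitting} {S : Type u} [Ring S]
  {i : M →+ S} {q : S →+* R} (A : RegularAction σ i q) (hS : IsSquareZeroExtension M i q)
  {V W U : ModuleCat.{u} R} (hV : IsEquationallyFlat R V) (hW : IsEquationallyFlat R W)
  (hU : IsEquationallyFlat R U)

/-- The splitting defined by a lifting. -/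
def splitting (X : Lifting q V) : φ.SplittingAt V :=
  ((A.twistedSplitting hV).splitting (hS := hS) (D := X.liftData hS)).toSplitting
    (isElementaryExtension_extend hV)

variable {A hS hV hW hU}

variable (A hS hV) in
/-- An element of the splitting defined by a lifting. -/
def cls (X : Lifting q V) (z : (extendTo A.functor).obj V) (v : X.V')
    (h : extendA φ V (A.extendC₀ V z) = X.p v) : (A.splitting hS hV X).obj :=
  (A.twistedSplitting hV).cls hS (X.liftData hS) z v h

theorem exists_cls {X : Lifting q V} (t : (A.splitting hS hV X).obj) :
    ∃ z v h, A.cls hS hV X z v h = t :=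
  (A.twistedSplitting hV).exists_cls hS (X.liftData hS) t

theorem hom_p {f : V ⟶ W} {X : Lifting q V} {Y : Lifting q W} (g : Lifting.HomOver f X Y)
    (v : X.V') : (Y.liftData hS).p (g.hom v) = (A.twistedHom hV hW f).f ((X.liftData hS).p v) :=
  (X.comp_map_eq_iff Y).1 g.w v

variable (A hS hV hW) in
/-- The map of splittings defined by a map of liftings. -/
def splittingMap {f : V ⟶ W} {X : Lifting q V} {Y : Lifting q W} (g : Lifting.HomOver f X Y) :
    Splitting.HomOver ((extend φ.C₁).map f) ((extend φ.C₀).map f) (A.splitting hS hV X)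
      (A.splitting hS hW Y) where
  hom := ModuleCat.ofHom ((A.twistedHom hV hW f).map hS g.hom (hom_p g))
  w₁ := ModuleCat.hom_ext (LinearMap.ext fun y =>
    (A.twistedHom hV hW f).map_k₁ hS g.hom (hom_p g) y)
  w₀ := ModuleCat.hom_ext (LinearMap.ext fun x =>
    (A.twistedHom hV hW f).k₀_map hS g.hom (hom_p g) x)

theorem splittingMap_bijective (f : V ⟶ W) (X : Lifting q V) (Y : Lifting q W) :
    Function.Bijective (A.splittingMap hS hV hW (f := f) (X := X) (Y := Y)) := by
  constructor
  · intro g g' h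
    exact Lifting.HomOver.ext ((A.twistedHom hV hW f).map_injective hS (hg := hom_p g)
      (hg' := hom_p g') (congrArg (fun x => x.hom.hom) h))
  · intro h
    obtain ⟨g, hg, hgh⟩ := (A.twistedHom hV hW f).exists_map_eq hS
      (D := X.liftData hS) (D' := Y.liftData hS) h.hom.hom
      (fun y => congrArg (fun x => x.hom y) h.w₁) (fun x => congrArg (fun k => k.hom x) h.w₀)
    refine ⟨⟨g, (X.comp_map_eq_iff Y).2 hg⟩, Splitting.HomOver.ext (ModuleCat.hom_ext ?_)⟩
    exact hgh

theorem splittingMap_cls {f : V ⟶ W} {X : Lifting q V} {Y : Lifting q W}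
    (g : Lifting.HomOver f X Y) {z : (extendTo A.functor).obj V} {v : X.V'}
    (h : extendA φ V (A.extendC₀ V z) = X.p v) {z' : (extendTo A.functor).obj W} {v' : Y.V'}
    (h' : extendA φ W (A.extendC₀ W z') = Y.p v')
    (hz : ((extendTo A.functor).map f).hom z = z') (hv : g.hom v = v') :
    (A.splittingMap hS hV hW g).hom.hom (A.cls hS hV X z v h) = A.cls hS hW Y z' v' h' := by
  subst hz hv
  rfl

theorem cls_mem {f : V ⟶ W} {X : Lifting q V} {Y : Lifting q W} (g : Lifting.HomOver f X Y)
    (hS : IsSquareZeroExtension M i q) (hV : IsEquationallyFlat R V) (hW : IsEquationallyFlat R W)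
    {z : (extendTo A.functor).obj V} {v : X.V'} (h : extendA φ V (A.extendC₀ V z) = X.p v) :
    extendA φ W (A.extendC₀ W (((extendTo A.functor).map f).hom z)) = Y.p (g.hom v) :=
  (A.twistedHom hV hW f).map_mem (D := X.liftData hS) (D' := Y.liftData hS) h (hom_p g v)

theorem splittingMap_comp {f : V ⟶ W} {g : W ⟶ U} {X : Lifting q V} {Y : Lifting q W}
    {Z : Lifting q U} (x : Lifting.HomOver f X Y) (y : Lifting.HomOver g Y Z) :
    (A.splittingMap hS hV hU (x.comp y)).hom =
      (A.splittingMap hS hV hW x).hom ≫ (A.splittingMap hS hW hU y).hom := by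
  refine ModuleCat.hom_ext (LinearMap.ext fun t => ?_)
  obtain ⟨z, v, h, rfl⟩ := A.exists_cls t
  refine (splittingMap_cls (x.comp y) h (cls_mem y hS hW hU (cls_mem x hS hV hW h)) ?_ rfl).trans ?_
  · exact congrArg (fun k => k.hom z) ((extendTo A.functor).map_comp f g)
  · refine ((congrArg (A.splittingMap hS hW hU y).hom.hom
      (splittingMap_cls x h (cls_mem x hS hV hW h) rfl rfl)).trans ?_).symm
    exact splittingMap_cls y _ _ rfl rfl

theorem splittingMap_id_cls {X Y : Lifting q V} (g : Lifting.HomOver (𝟙 V) X Y)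
    {z : (extendTo A.functor).obj V} {v : X.V'} (h : extendA φ V (A.extendC₀ V z) = X.p v)
    {v' : Y.V'} (h' : extendA φ V (A.extendC₀ V z) = Y.p v') (hv : g.hom v = v') :
    (A.splittingMap hS hV hV g).hom.hom (A.cls hS hV X z v h) = A.cls hS hV Y z v' h' :=
  splittingMap_cls g h h' (congrArg (fun k => k.hom z) ((extendTo A.functor).map_id V)) hv

variable (A hS hV) in
/-- The functor from liftings to splittings. -/
def splittingFunctor : Lifting q V ⥤ φ.SplittingAt V where
  obj X := A.splitting hS hV X
  map g :=
    { hom := (A.splittingMap hS hV hV (Lifting.Hom.toHomOver g)).hom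
      w₁ := by
        rw [(A.splittingMap hS hV hV (Lifting.Hom.toHomOver g)).w₁, CategoryTheory.Functor.map_id,
          Category.id_comp]
      w₀ := by
        rw [(A.splittingMap hS hV hV (Lifting.Hom.toHomOver g)).w₀, CategoryTheory.Functor.map_id,
          Category.comp_id] }
  map_id X := by
    refine Splitting.Hom.ext (ModuleCat.hom_ext (LinearMap.ext fun t => ?_))
    obtain ⟨z, v, h, rfl⟩ := A.exists_cls t
    exact splittingMap_id_cls (Lifting.Hom.toHomOver (𝟙 X)) h h rfl
  map_comp {X Y Z} g g' := by
    refine Splitting.Hom.ext (ModuleCat.hom_ext (LinearMap.ext fun t => ?_))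
    obtain ⟨z, v, h, rfl⟩ := A.exists_cls t
    have h1 : extendA φ V (A.extendC₀ V z) = Y.p ((Lifting.Hom.toHomOver g).hom v) :=
      h.trans ((X.comp_map_eq_iff Y).1 (Lifting.Hom.toHomOver g).w v).symm
    have h2 : extendA φ V (A.extendC₀ V z) =
        Z.p ((Lifting.Hom.toHomOver g').hom ((Lifting.Hom.toHomOver g).hom v)) :=
      h1.trans ((Y.comp_map_eq_iff Z).1 (Lifting.Hom.toHomOver g').w _).symm
    refine (splittingMap_id_cls (Lifting.Hom.toHomOver (g ≫ g')) h h2 rfl).trans ?_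
    refine ((congrArg (A.splittingMap hS hV hV (Lifting.Hom.toHomOver g')).hom.hom
      (splittingMap_id_cls (Lifting.Hom.toHomOver g) h h1 rfl)).trans ?_).symm
    exact splittingMap_id_cls (Lifting.Hom.toHomOver g') h1 h2 rfl

/-- Morphisms of liftings are isomorphisms by definition, whereas `splittingMap_bijective` only
produces linear maps over the identity. The five lemma for extensions of V by M ⊗ V closes the gap.
-/
theorem bijective_hom {X Y : Lifting q V} (hS : IsSquareZeroExtension M i q)
    (g : Lifting.HomOver (𝟙 V) X Y) : Function.Bijective g.hom :=
  (X.liftData hS).bijective (Y.liftData hS) g.hom ((X.comp_map_eq_iff Y).1 g.w)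

instance : (A.splittingFunctor hS hV).Faithful where
  map_injective {X Y g g'} h := by
    have h1 := (A.splittingMap_bijective (hS := hS) (hV := hV) (hW := hV) (𝟙 V) X Y).1
      (Splitting.HomOver.ext (congrArg Splitting.Hom.hom h))
    exact Lifting.Hom.ext (LinearEquiv.toLinearMap_injective (congrArg Lifting.HomOver.hom h1))

instance : (A.splittingFunctor hS hV).Full where
  map_surjective {X Y} h := by
    obtain ⟨g, hg⟩ := (A.splittingMap_bijective (hS := hS) (hV := hV) (hW := hV) (𝟙 V) X Y).2
      ⟨Splitting.Hom.hom h, by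
        rw [CategoryTheory.Functor.map_id, Category.id_comp]
        exact Splitting.Hom.w₁ h, by
        rw [CategoryTheory.Functor.map_id, Category.comp_id]
        exact Splitting.Hom.w₀ h⟩
    refine ⟨⟨LinearEquiv.ofBijective g.hom (bijective_hom hS g), g.w⟩, ?_⟩
    exact Splitting.Hom.ext (congrArg Splitting.HomOver.hom hg)

/-- The lifting (E ×_{C₀(V)} Z) / C₁(V) gives back Z, up to isomorphism. -/
instance : (A.splittingFunctor hS hV).EssSurj where
  mem_essImage Z := by
    let C := A.twistedSplitting hV
    let Y : ModuleSplitting C.d C.α Z.obj := Z.toModuleSplitting (isElementaryExtension_extend hV)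
    let _ : Module S Z.obj := Module.compHom Z.obj q
    let D : LiftData i q (ModuleSplitting.Lift C Y fun _ _ => rfl) V :=
      ModuleSplitting.liftData C Y (fun _ _ => rfl) hS
    let X : Lifting q V := Lifting.ofLiftData hS hV.isFlat D
    obtain ⟨f, h₁, h₀⟩ := ModuleSplitting.exists_map_tot (C := C) (Y := Y) (hX := fun _ _ => rfl) hS
    -- The extension read off from the lifting X has the same projection to V as D, but is not D
    -- itself. The identity of the underlying module compares the two resulting splittings.
    let F := A.twistedHom hV hV (𝟙 V)
    have hg : ∀ v, (X.liftData hS).p (LinearMap.id (R := S) v) = F.f (D.p v) :=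
      Lifting.ofLiftData_p hS hV.isFlat D
    let g := F.map hS (D := D) (D' := X.liftData hS) LinearMap.id hg
    have hf₁ : ∀ y, F.f₁ y = y := fun y => congrArg (fun k => k.hom y) ((extend φ.C₁).map_id V)
    have hf₀ : ∀ y, F.f₀ y = y := fun y => congrArg (fun k => k.hom y) ((extend φ.C₀).map_id V)
    obtain ⟨e⟩ := Splitting.nonempty_iso (Z := Z) (Z' := A.splitting hS hV X)
      (isElementaryExtension_extend hV) (g ∘ₗ f)
      (fun y => (congrArg g (h₁ y)).trans ((F.map_k₁ hS _ hg y).trans (congrArg _ (hf₁ y))))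
      (fun x => (F.k₀_map hS _ hg (f x)).trans ((hf₀ _).trans (h₀ x)))
    exact ⟨X, ⟨e.symm⟩⟩

instance : (A.splittingFunctor hS hV).IsEquivalence where

end RegularAction

/-- The action of the ring of regular endomorphisms on `C₀₁`. -/
def regularAction {R : Type u} [Ring R] {M : Type u} [AddCommGroup M] [Module R M] [Module Rᵐᵒᵖ M]
    {φ : RingExtension R M} (σ : φ.AbSplitting) : RegularAction σ (inclusion σ) (proj σ) where
  ρ := (regularEnd σ).subtype
  isRegularOver := isRegularOver_proj σ
  map_inclusion _ := rfl

end RingExtension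

end

end SqZero

theorem mainTheorem3 {R : Type u} [Ring R] {M : Type u} [AddCommGroup M] [Module R M]
    [Module Rᵐᵒᵖ M] [SMulCommClass R Rᵐᵒᵖ M] (φ : SqZero.RingExtension R M) :
    -- the elementary extension `e_* φ` admits a splitting `C₀₁`, and for every choice of it:
    Nonempty φ.AbSplitting ∧ ∀ σ : φ.AbSplitting,
      -- the ring `R'` of regular endomorphisms of `C₀₁` is a square-zero extension of `R` by `M`
      (∃ i : M →+ SqZero.RingExtension.regularEnd σ,
        (∀ m : M, (i m : End σ.obj) = σ.c₀ ≫ SqZero.forgetMap φ.a ≫ SqZero.tensorElement R m ≫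
          SqZero.forgetMap φ.b ≫ σ.c₁) ∧
        SqZero.IsSquareZeroExtension M i (SqZero.RingExtension.proj σ)) ∧
      -- for flat `V`, the sequence `0 ⟶ M ⊗_R V ⟶ C₁(V) ⟶ C₀(V) ⟶ V ⟶ 0` is exact
      (∀ V : ModuleCat.{u} R, SqZero.IsFlat R V → ∃ _ : IsIso (SqZero.fromTautTensor M V),
        SqZero.IsElementaryExtension
          (inv (SqZero.fromTautTensor M V) ≫ SqZero.extendMap φ.b V)
          (SqZero.extendMap φ.d V)
          (SqZero.extendMap φ.a V ≫ SqZero.fromTaut R V)) ∧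
      -- for flat `V`, liftings of `V` to `R'` are equivalent to splittings of this sequence,
      ∃ (e : ∀ V : ModuleCat.{u} R, SqZero.IsFlat R V →
            (SqZero.Lifting (SqZero.RingExtension.proj σ) V ≌ φ.SplittingAt V))
        -- functorially with respect to all `R`-linear maps `f` between flat modules
        (N : ∀ {V W : ModuleCat.{u} R} (hV : SqZero.IsFlat R V) (hW : SqZero.IsFlat R W)
            (f : V ⟶ W) (X : SqZero.Lifting (SqZero.RingExtension.proj σ) V)
            (Y : SqZero.Lifting (SqZero.RingExtension.proj σ) W),
            SqZero.Lifting.HomOver f X Y ≃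
              SqZero.Splitting.HomOver ((SqZero.extend φ.C₁).map f) ((SqZero.extend φ.C₀).map f)
                ((e V hV).functor.obj X) ((e W hW).functor.obj Y)),
        (∀ {V : ModuleCat.{u} R} (hV : SqZero.IsFlat R V)
          {X Y : SqZero.Lifting (SqZero.RingExtension.proj σ) V} (g : X ⟶ Y),
          (N hV hV (𝟙 V) X Y (SqZero.Lifting.Hom.toHomOver g)).hom =
            SqZero.Splitting.Hom.hom ((e V hV).functor.map g)) ∧
        (∀ {V W U : ModuleCat.{u} R} (hV : SqZero.IsFlat R V) (hW : SqZero.IsFlat R W)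
          (hU : SqZero.IsFlat R U) (f : V ⟶ W) (g : W ⟶ U)
          {X : SqZero.Lifting (SqZero.RingExtension.proj σ) V}
          {Y : SqZero.Lifting (SqZero.RingExtension.proj σ) W}
          {Z : SqZero.Lifting (SqZero.RingExtension.proj σ) U}
          (x : SqZero.Lifting.HomOver f X Y) (y : SqZero.Lifting.HomOver g Y Z),
          (N hV hU (f ≫ g) X Z (x.comp y)).hom = (N hV hW f X Y x).hom ≫ (N hW hU g Y Z y).hom) := by
  refine ⟨SqZero.nonempty_abSplitting φ, fun σ => ?_⟩
  have hS := SqZero.RingExtension.isSquareZeroExtension (σ := σ)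
  let A := SqZero.RingExtension.regularAction σ
  refine ⟨⟨SqZero.RingExtension.inclusion σ, fun _ => rfl, hS⟩, fun V hV => ⟨inferInstance,
    SqZero.RingExtension.isElementaryExtension_extend hV.isEquationallyFlat⟩, ?_⟩
  -- The functor was defined on morphisms through maps over the identity, so its agreement with the
  -- bijections is definitional.
  exact ⟨fun V hV => (A.splittingFunctor hS hV.isEquationallyFlat).asEquivalence,
    fun hV hW f X Y => Equiv.ofBijective
      (A.splittingMap hS hV.isEquationallyFlat hW.isEquationallyFlat)
      (SqZero.RingExtension.RegularAction.splittingMap_bijective f X Y),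
    fun hV X Y g => rfl,
    fun hV hW hU f g X Y Z x y => SqZero.RingExtension.RegularAction.splittingMap_comp x y⟩
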